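/- Let $a,b,c$ be real numbers with $a>0$ and $b>0$, and for real $d$ consider the Liénard system $$\dot x = y-(ax^4+bx^3+cx^2+dx),\qquad \dot y=-x .$$ Project the plane centrally onto the open upper hemisphere of the Poincaré sphere, $(x,y)\mapsto (x,y,1)/\sqrt{x^2+y^2+1}$. By a homoclinic loop at infinity we mean an orbit $\Gamma$ in the plane whose image on the sphere tends to the equatorial point $(0,1,0)$ (a topological saddle) at both ends of its time interval; adding $(0,1,0)$ to this image gives a closed curve $\overline\Gamma$ on the sphere. Then there is a unique real number $d=\psi(a,b,c)$ for which the system has a homoclinic loop at infinity, and $\psi(a,b,c)<0$. For $d=\psi(a,b,c)$ every such loop is attracting (stable) from its interior if and only if the singular point $(0,0)$ is unstable, that is, not Lyapunov stable. Here the interior of the loop is the component of $\mathbb R^2\setminus\Gamma$ that contains the origin, and the loop is attracting from its interior if for every neighbourhood $W$ of $\overline\Gamma$ there is a neighbourhood $V$ of $\overline\Gamma$ such that every solution starting at an interior point whose image lies in $V$ exists for all positive times, has its image in $W$ for all positive times, and has $\overline\Gamma$ as the $\omega$-limit set of that image. -/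

import Mathlib

open Set Filter Topology

noncomputable section

/-- The quartic Liénard vector field
`(x, y) ↦ (y - (a x ^ 4 + b x ^ 3 + c x ^ 2 + d x), -x)`. -/
def lienard (a b c d : ℝ) (p : ℝ × ℝ) : ℝ × ℝ :=
  (p.2 - (a * p.1 ^ 4 + b * p.1 ^ 3 + c * p.1 ^ 2 + d * p.1), -p.1)

/-- Central projection of the plane (identified with the tangent plane `z = 1`) onto the open
upper hemisphere of the unit sphere in `ℝ³`, the Poincaré sphere; its equator is the line at
infinity of the plane. -/
def toPoincareSphere (p : ℝ × ℝ) : EuclideanSpace ℝ (Fin 3) :=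
  (Real.sqrt (p.1 ^ 2 + p.2 ^ 2 + 1))⁻¹ • !₂[p.1, p.2, 1]

/-- The point `(0, 1, 0)` of the equator of the Poincaré sphere. -/
def northPoint : EuclideanSpace ℝ (Fin 3) := !₂[0, 1, 0]

/-- `Γ` is (the part in the plane of) a homoclinic loop of the planar vector field `X` on the
Poincaré sphere, based at `(0, 1, 0)`: an orbit of `X` which, on the Poincaré sphere, tends to
`(0, 1, 0)` at both ends of its time interval. That interval, `(α, ω)`, may be bounded or
unbounded on either side, since rescaling time to extend the field to the equator can turn a
finite escape time into an infinite one. -/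
def IsHomoclinicLoop (X : ℝ × ℝ → ℝ × ℝ) (Γ : Set (ℝ × ℝ)) : Prop :=
  ∃ (α ω : EReal) (γ : ℝ → ℝ × ℝ), α < ω ∧
    (∀ t : ℝ, α < t → t < ω → HasDerivAt γ (X (γ t)) t) ∧
    Tendsto (fun t => toPoincareSphere (γ t))
      (comap ((↑) : ℝ → EReal) (𝓝[>] α)) (𝓝 northPoint) ∧
    Tendsto (fun t => toPoincareSphere (γ t))
      (comap ((↑) : ℝ → EReal) (𝓝[<] ω)) (𝓝 northPoint) ∧
    Γ = γ '' {t : ℝ | α < t ∧ t < ω}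

/-- The closed curve on the Poincaré sphere formed by the planar orbit `Γ` and its base point. -/
def closedLoop (Γ : Set (ℝ × ℝ)) : Set (EuclideanSpace ℝ (Fin 3)) :=
  insert northPoint (toPoincareSphere '' Γ)

/-- The interior of a loop: the component of its complement in the plane that contains the
origin, the only singular point of the Liénard system in the plane. -/
def loopInterior (Γ : Set (ℝ × ℝ)) : Set (ℝ × ℝ) :=
  connectedComponentIn Γᶜ 0

/-- `σ` is a solution of `X` on the time interval `[0, ∞)` that starts at `p`. -/
def IsForwardSolution (X : ℝ × ℝ → ℝ × ℝ) (p : ℝ × ℝ) (σ : ℝ → ℝ × ℝ) : Prop :=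
  σ 0 = p ∧ ∀ t : ℝ, 0 ≤ t → HasDerivWithinAt σ (X (σ t)) (Ici 0) t

/-- The loop is attracting (stable) from its interior: solutions that start in the interior close
enough to the loop on the Poincaré sphere are defined for all positive times, stay as close to the
loop as prescribed, and have the whole loop as their `ω`-limit set on the Poincaré sphere. -/
def IsAttractingLoop (X : ℝ × ℝ → ℝ × ℝ) (Γ : Set (ℝ × ℝ)) : Prop :=
  ∀ W ∈ 𝓝ˢ (closedLoop Γ), ∃ V ∈ 𝓝ˢ (closedLoop Γ),
    ∀ p ∈ loopInterior Γ, toPoincareSphere p ∈ V →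
      ∃ σ : ℝ → ℝ × ℝ, IsForwardSolution X p σ ∧
        (∀ t : ℝ, 0 ≤ t → toPoincareSphere (σ t) ∈ W) ∧
        {z | MapClusterPt z atTop (fun t => toPoincareSphere (σ t))} = closedLoop Γ

/-- Lyapunov stability of the singular point `q` of `X`. -/
def IsStablePoint (X : ℝ × ℝ → ℝ × ℝ) (q : ℝ × ℝ) : Prop :=
  ∀ W ∈ 𝓝 q, ∃ V ∈ 𝓝 q, ∀ p ∈ V,
    ∃ σ : ℝ → ℝ × ℝ, IsForwardSolution X p σ ∧ ∀ t : ℝ, 0 ≤ t → σ t ∈ W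

end

/-!
Write `F` for the quartic, `f = F'`, and `Y = F - W` for a curve below the isocline `y = F x`. The
graph of `Y` is invariant exactly when `W' = f - x / W`, and a homoclinic loop at infinity is the
same thing as the graph over the whole line of such a `Y` with `W` positive and bounded
(`IsSeparatrix`, `IsHomoclinicLoop.exists_isSeparatrix`, `IsSeparatrix.isHomoclinicLoop`). For the
step from loops to graphs, consider the last meeting of a loop with the line `x = 0`: it takes place
below the origin, after it the loop escapes to the left below the isocline, and an earlier meeting
below the origin would have to be higher up, since orbits cannot cross the final piece. The
reflection `(x, t) ↦ (-x, -t)`, which takes the parameters `(a, b, c, d)` to `(a, -b, c, -d)`, gives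
the opposite inequality, so there is only one meeting.

*The parameter.* On each half-line `w' = f - x / w` has exactly one bounded solution; the initial
values below it lead to solutions that reach zero, those above it to unbounded ones. A separatrix
exists when the two half-lines have the same threshold. Both outcomes are open conditions and the
order of the two thresholds is reversed between `d = 0` and some `d = -M`, so that connectedness of
`[-M, 0]` gives a good `d` (`exists_isSeparatrix`). Changing `d` moves the thresholds on the two
sides in opposite directions, hence uniqueness (`IsSeparatrix.param_unique`), and for `d ≥ 0` the
term `b x ^ 3` with `b > 0` separates them (`IsSeparatrix.param_neg`). So `d < 0` always.

*The equivalence.* Both sides of it are true. The origin is unstable as `d < 0`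
(`not_isStablePoint_lienard`), and the loop is attracting from its interior
(`IsSeparatrix.isAttractingLoop`). For the latter put `v = y - Y x > 0`. Then `x' = v - W x` and
`v' = - x v / W x`, so along the loop `log v` changes by `contraction W x = ∫ s / W s ^ 2` up to
small errors. As `W` is close to `x / f` far out, `contraction W x` is about
`(8 / 3) a ^ 2 x ^ 6 + (24 / 5) a b x ^ 5` on both sides. An orbit close to the loop that turns on
the left at `x = -z` turns on the right beyond `x = z - β` for any `β > b / (2 a)`: it starts at the
height `F (-z)` and sinks little. The gain `(48 / 5) a b z ^ 5` from the quintic terms beats the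
loss `16 a ^ 2 β z ^ 5` from the shift when `β < 3 b / (5 a)`, and `β = 11 b / (20 a)` lies in
between. So every lap at least halves `v` (`IsInnerSol.exists_lap`), laps fill the half-line of time
(`IsInnerSol.exists_laps`), and the orbit converges to the loop and accumulates at each of its
points (`IsInnerSol.attraction`). On the Poincaré sphere the neighbourhoods of the closed loop are
described by the condition `NearLoop`.
-/

/-! ### Differential inequalities and ordinary differential equations -/

theorem HasDerivWithinAt.Ici_of_Icc {E : Type*} [NormedAddCommGroup E] [NormedSpace ℝ E]
    {h : ℝ → E} {h' : E} {p q x : ℝ} (hh : HasDerivWithinAt h h' (Icc p q) x)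
    (hx : x ∈ Ico p q) : HasDerivWithinAt h h' (Ici x) x :=
  hh.mono_of_mem_nhdsWithin (Icc_mem_nhdsGE_of_mem hx)

theorem le_of_hasDerivWithinAt_nonneg {h h' : ℝ → ℝ} {p q : ℝ}
    (hh : ∀ x ∈ Icc p q, HasDerivWithinAt h (h' x) (Icc p q) x)
    (hn : ∀ x ∈ Icc p q, 0 ≤ h' x) : ∀ x ∈ Icc p q, h p ≤ h x := by
  intro x hx
  have := image_le_of_deriv_right_le_deriv_boundary (f := fun _ => h p) (f' := fun _ => 0)
    (B := h) (B' := h') continuousOn_const (fun x _ => hasDerivWithinAt_const _ _ _) le_rfl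
    (fun x hx => (hh x hx).continuousWithinAt)
    (fun x hx => (hh x (Ico_subset_Icc_self hx)).Ici_of_Icc hx)
    (fun x hx => hn x (Ico_subset_Icc_self hx))
  exact this hx

theorem le_of_hasDerivWithinAt_nonpos {h h' : ℝ → ℝ} {p q : ℝ}
    (hh : ∀ x ∈ Icc p q, HasDerivWithinAt h (h' x) (Icc p q) x)
    (hn : ∀ x ∈ Icc p q, h' x ≤ 0) : ∀ x ∈ Icc p q, h x ≤ h p := by
  intro x hx
  have := le_of_hasDerivWithinAt_nonneg (h := fun x => - h x) (h' := fun x => - h' x)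
    (fun x hx => (hh x hx).fun_neg) (fun x hx => by linarith [hn x hx]) x hx
  linarith

/-- A function that starts above the level `c`, and does not decrease while it is above `c`,
never falls below its initial value. -/
theorem le_of_hasDerivWithinAt_nonneg_of_lt {h h' : ℝ → ℝ} {p q c : ℝ}
    (hh : ∀ x ∈ Icc p q, HasDerivWithinAt h (h' x) (Icc p q) x) (hp : c < h p)
    (hn : ∀ x ∈ Icc p q, c < h x → 0 ≤ h' x) : ∀ x ∈ Icc p q, h p ≤ h x := by
  have key : ∀ δ > 0, δ * (q - p) < h p - c → ∀ x ∈ Icc p q, h p - δ * (x - p) ≤ h x := by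
    intro δ hδ hδ' x hx
    refine image_le_of_deriv_right_lt_deriv_boundary' (f := fun x => h p - δ * (x - p))
      (f' := fun _ => - δ) (B := h) (B' := h') (by fun_prop) (fun x _ => ?_) (by simp)
      (fun x hx => (hh x hx).continuousWithinAt)
      (fun x hx => (hh x (Ico_subset_Icc_self hx)).Ici_of_Icc hx) ?_ hx
    · have := (((hasDerivAt_id x).sub_const p).const_mul δ).const_sub (h p)
      simpa using this.hasDerivWithinAt
    · intro y hy hey
      have h1 : δ * (y - p) ≤ δ * (q - p) := by
        apply mul_le_mul_of_nonneg_left _ hδ.le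
        linarith [hy.2]
      have := hn y (Ico_subset_Icc_self hy) (by linarith)
      linarith
  intro x hx
  by_contra! hlt
  have hpq : p ≤ q := hx.1.trans hx.2
  set e := min (h p - c) (h p - h x) with he
  have hepos : 0 < e := lt_min (by linarith) (by linarith)
  have hd : 0 < e / (2 * (q - p + 1)) := by positivity
  have h2 : e / (2 * (q - p + 1)) * (q - p) < e := by
    rw [div_mul_eq_mul_div, div_lt_iff₀ (by linarith)]
    nlinarith
  have h3 := key _ hd (h2.trans_le (min_le_left _ _)) x hx
  have h4 : e / (2 * (q - p + 1)) * (x - p) ≤ e / (2 * (q - p + 1)) * (q - p) :=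
    mul_le_mul_of_nonneg_left (by linarith [hx.2]) hd.le
  have h5 := min_le_right (h p - c) (h p - h x)
  linarith

theorem nonpos_of_hasDerivWithinAt_neg {h h' : ℝ → ℝ} {p q : ℝ}
    (hh : ∀ x ∈ Icc p q, HasDerivWithinAt h (h' x) (Icc p q) x) (hp : h p ≤ 0)
    (hn : ∀ x ∈ Icc p q, h x = 0 → h' x < 0) : ∀ x ∈ Icc p q, h x ≤ 0 := by
  intro x hx
  exact image_le_of_deriv_right_lt_deriv_boundary' (B := fun _ => 0) (B' := fun _ => 0)
      (fun x hx => (hh x hx).continuousWithinAt)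
      (fun x hx => (hh x (Ico_subset_Icc_self hx)).Ici_of_Icc hx) hp continuousOn_const
      (fun x _ => hasDerivWithinAt_const _ _ _)
      (fun y hy hey => hn y (Ico_subset_Icc_self hy) hey) hx

theorem neg_of_hasDerivWithinAt_neg {h h' : ℝ → ℝ} {p q : ℝ}
    (hh : ∀ x ∈ Icc p q, HasDerivWithinAt h (h' x) (Icc p q) x) (hp : h p ≤ 0)
    (hn : ∀ x ∈ Icc p q, h x = 0 → h' x < 0) : ∀ x ∈ Ioc p q, h x < 0 := by
  intro x hx
  have hle := nonpos_of_hasDerivWithinAt_neg hh hp hn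
  refine lt_of_le_of_ne (hle x (Ioc_subset_Icc_self hx)) fun h0 => ?_
  have hneg := hn x (Ioc_subset_Icc_self hx) h0
  have hd : HasDerivWithinAt h (h' x) (Iio x) x :=
    (hh x (Ioc_subset_Icc_self hx)).mono_of_mem_nhdsWithin
      (mem_of_superset (Icc_mem_nhdsLT_of_mem hx) le_rfl)
  rw [hasDerivWithinAt_iff_tendsto_slope' (by simp)] at hd
  have h1 := (hd.eventually (gt_mem_nhds hneg)).and
    ((Icc_mem_nhdsLT_of_mem hx : Icc p q ∈ 𝓝[<] x))
  obtain ⟨y, ⟨hy1, hy2⟩, hy3⟩ := (h1.and self_mem_nhdsWithin).exists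
  have hy3 : y < x := hy3
  rw [slope_def_field, h0] at hy1
  have := hle y hy2
  have : 0 ≤ (h y - 0) / (y - x) := div_nonneg_of_nonpos (by linarith) (by linarith)
  linarith

/-- A continuous function that starts above `c` and gets down to `c` reaches `c` a first time. -/
theorem exists_first_eq {h : ℝ → ℝ} {p q c : ℝ} (hc : ContinuousOn h (Icc p q)) (hp : c < h p)
    (hq : ∃ x ∈ Icc p q, h x ≤ c) :
    ∃ x ∈ Ioc p q, h x = c ∧ ∀ y ∈ Ico p x, c < h y := by
  set S := Icc p q ∩ h ⁻¹' Iic c with hS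
  have hScl : IsClosed S := hc.preimage_isClosed_of_isClosed isClosed_Icc isClosed_Iic
  have hSne : S.Nonempty := by
    obtain ⟨x, hx, hx'⟩ := hq
    exact ⟨x, hx, hx'⟩
  have hSb : BddBelow S := ⟨p, fun x hx => hx.1.1⟩
  have hm := hScl.csInf_mem hSne hSb
  set z := sInf S with hz
  have hbelow : ∀ y ∈ Ico p z, c < h y := by
    intro y hy
    by_contra! hle
    have : z ≤ y := csInf_le hSb ⟨⟨hy.1, hy.2.le.trans hm.1.2⟩, hle⟩
    linarith [hy.2]
  have hpz : p < z := by
    refine lt_of_le_of_ne hm.1.1 fun he => ?_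
    have := hm.2
    rw [← he] at this
    exact absurd this (not_le.2 hp)
  refine ⟨z, ⟨hpz, hm.1.2⟩, le_antisymm hm.2 ?_, hbelow⟩
  have hcw : ContinuousWithinAt h (Iio z) z :=
    (hc z hm.1).mono_of_mem_nhdsWithin (Icc_mem_nhdsLT_of_mem ⟨hpz, hm.1.2⟩)
  refine ge_of_tendsto hcw ?_
  filter_upwards [Ico_mem_nhdsLT hpz] with y hy using (hbelow y hy).le

/-- A bounded vector field that is Lipschitz in space has solutions on every compact interval. -/
theorem exists_solution_of_lipschitz_of_bounded {E : Type*} [NormedAddCommGroup E]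
    [NormedSpace ℝ E] [CompleteSpace E] {v : ℝ → E → E} {T L : ℝ} {K : NNReal} (hT : 0 ≤ T)
    (hL : 0 ≤ L) (hK : ∀ t ∈ Icc 0 T, LipschitzWith K (v t))
    (hc : ∀ x, ContinuousOn (fun t => v t x) (Icc 0 T))
    (hb : ∀ t ∈ Icc 0 T, ∀ x, ‖v t x‖ ≤ L) (x₀ : E) :
    ∃ α : ℝ → E, α 0 = x₀ ∧ ∀ t ∈ Icc 0 T, HasDerivWithinAt α (v t (α t)) (Icc 0 T) t := by
  have hpl : IsPicardLindelof v (tmin := 0) (tmax := T) ⟨0, left_mem_Icc.2 hT⟩ x₀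
      (⟨L, hL⟩ * ⟨T, hT⟩) 0 ⟨L, hL⟩ K := by
    refine ⟨fun t ht => (hK t ht).lipschitzOnWith, fun x _ => hc x, fun t ht x _ => hb t ht x, ?_⟩
    simp only [sub_zero, sub_self, max_eq_left hT, NNReal.coe_zero]
    exact le_rfl
  exact hpl.exists_eq_forall_mem_Icc_hasDerivWithinAt₀

/-! ### The scalar equation `w' = f x - x / w` on the half-line -/

/-- `w` is a positive solution of `w' = f x - x / w` on `[0, X]` with `w 0 = s`. -/
def IsHalfSol (f : ℝ → ℝ) (X s : ℝ) (w : ℝ → ℝ) : Prop :=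
  w 0 = s ∧ ∀ x ∈ Icc 0 X, 0 < w x ∧ HasDerivWithinAt w (f x - x / w x) (Icc 0 X) x

namespace IsHalfSol

variable {f g u w : ℝ → ℝ} {X X' s s' : ℝ}

theorem mono (h : IsHalfSol f X s w) (hX : X' ≤ X) : IsHalfSol f X' s w :=
  ⟨h.1, fun x hx => ⟨(h.2 x ⟨hx.1, hx.2.trans hX⟩).1,
    (h.2 x ⟨hx.1, hx.2.trans hX⟩).2.mono (Icc_subset_Icc_right hX)⟩⟩

theorem continuousOn (h : IsHalfSol f X s w) : ContinuousOn w (Icc 0 X) :=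
  fun x hx => (h.2 x hx).2.continuousWithinAt

theorem congr (h : IsHalfSol f X s w) (hX : 0 ≤ X) (he : ∀ x ∈ Icc 0 X, u x = w x) :
    IsHalfSol f X s u := by
  refine ⟨(he 0 ⟨le_rfl, hX⟩).trans h.1, fun x hx => ?_⟩
  rw [he x hx]
  exact ⟨(h.2 x hx).1, (h.2 x hx).2.congr he (he x hx)⟩

theorem exists_lower_bound (h : IsHalfSol f X s w) (hX : 0 ≤ X) :
    ∃ m > 0, ∀ x ∈ Icc 0 X, m ≤ w x := by
  obtain ⟨z, hz, hm⟩ := isCompact_Icc.exists_isMinOn (nonempty_Icc.2 hX) h.continuousOn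
  exact ⟨w z, (h.2 z hz).1, fun x hx => hm hx⟩

/-- Comparison: a larger right-hand side and a larger initial value give a larger solution. -/
theorem le (hu : IsHalfSol f X s u) (hw : IsHalfSol g X s' w) (hfg : ∀ x ∈ Icc 0 X, f x ≤ g x)
    (hs : s ≤ s') : ∀ x ∈ Icc 0 X, u x ≤ w x := by
  intro x hx
  have hX : 0 ≤ X := hx.1.trans hx.2
  obtain ⟨m, hm, hmu⟩ := hu.exists_lower_bound hX
  obtain ⟨n, hn, hnw⟩ := hw.exists_lower_bound hX
  set κ := X / (m * n) + 1 with hκ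
  have key : ∀ δ > 0, u x - w x ≤ δ * Real.exp (κ * x) := by
    intro δ hδ
    refine image_le_of_deriv_right_lt_deriv_boundary (f := fun x => u x - w x)
      (f' := fun x => (f x - x / u x) - (g x - x / w x)) (B := fun x => δ * Real.exp (κ * x))
      (B' := fun x => δ * (Real.exp (κ * x) * κ)) (hu.continuousOn.sub hw.continuousOn)
      (fun y hy => ?_) ?_ (fun y => ?_) ?_ hx
    · exact ((hu.2 y (Ico_subset_Icc_self hy)).2.Ici_of_Icc hy).sub
        ((hw.2 y (Ico_subset_Icc_self hy)).2.Ici_of_Icc hy)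
    · simp only [hu.1, hw.1, mul_zero, Real.exp_zero]
      linarith
    · have : HasDerivAt (fun x => κ * x) κ y := by simpa using (hasDerivAt_id y).const_mul κ
      exact (this.exp).const_mul δ
    · intro y hy hey
      have hy' := Ico_subset_Icc_self hy
      have hup := (hu.2 y hy').1
      have hwp := (hw.2 y hy').1
      have hpos : 0 < u y - w y := by rw [hey]; positivity
      have h1 : y / w y - y / u y = y / (u y * w y) * (u y - w y) := by
        field_simp
      have h2 : y / (u y * w y) ≤ X / (m * n) :=
        div_le_div₀ hX hy.2.le (by positivity)
          (mul_le_mul (hmu y hy') (hnw y hy') hn.le hup.le)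
      have h3 := mul_le_mul_of_nonneg_right h2 hpos.le
      have h4 : δ * (Real.exp (κ * y) * κ) = κ * (u y - w y) := by rw [hey]; ring
      rw [h4, hκ]
      have := hfg y hy'
      linarith
  have hlim : Tendsto (fun δ : ℝ => δ * Real.exp (κ * x)) (𝓝[>] 0) (𝓝 0) := by
    have : Tendsto (fun δ : ℝ => δ * Real.exp (κ * x)) (𝓝 0) (𝓝 (0 * Real.exp (κ * x))) :=
      (continuous_id.mul continuous_const).tendsto _
    rw [zero_mul] at this
    exact this.mono_left nhdsWithin_le_nhds
  have := ge_of_tendsto hlim (eventually_mem_nhdsWithin.mono fun δ hδ => key δ hδ)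
  linarith

theorem unique (hu : IsHalfSol f X s u) (hw : IsHalfSol f X s w) :
    ∀ x ∈ Icc 0 X, u x = w x := fun x hx =>
  le_antisymm (hu.le hw (fun _ _ => le_rfl) le_rfl x hx)
    (hw.le hu (fun _ _ => le_rfl) le_rfl x hx)

/-- Two solutions drift apart at least as fast as their right-hand sides do. -/
theorem add_le (hu : IsHalfSol f X s u) (hw : IsHalfSol g X s' w) {P p : ℝ → ℝ}
    (hP : ∀ x, HasDerivAt P (p x) x) (hP0 : P 0 = 0)
    (hfg : ∀ x ∈ Icc 0 X, f x + p x ≤ g x) (hp : ∀ x ∈ Icc 0 X, 0 ≤ p x)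
    (hs : s ≤ s') : ∀ x ∈ Icc 0 X, (s' - s) + P x ≤ w x - u x := by
  intro x hx
  have hle := hu.le hw (fun x hx => by linarith [hfg x hx, hp x hx]) hs
  have := le_of_hasDerivWithinAt_nonneg (h := fun x => w x - u x - P x)
    (h' := fun x => (g x - x / w x) - (f x - x / u x) - p x) (p := 0) (q := X)
    (fun y hy => ((hw.2 y hy).2.sub (hu.2 y hy).2).sub (hP y).hasDerivWithinAt)
    (fun y hy => by
      have : y / w y ≤ y / u y := div_le_div_of_nonneg_left hy.1 (hu.2 y hy).1 (hle y hy)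
      linarith [hfg y hy]) x hx
  simp only [hu.1, hw.1, hP0] at this
  linarith

end IsHalfSol

/-- Truncating the singular denominator at `ε` makes the equation globally solvable. -/
theorem lipschitz_truncated {x X ε y : ℝ} (hε : 0 < ε) (hx : x ∈ Icc 0 X) :
    LipschitzWith (Real.toNNReal (X / ε ^ 2 + 1)) (fun w : ℝ => y - x / max w ε) := by
  have hX : 0 ≤ X := hx.1.trans hx.2
  refine LipschitzWith.of_dist_le_mul fun p q => ?_
  rw [Real.coe_toNNReal _ (by positivity), Real.dist_eq, Real.dist_eq]
  have hp : 0 < max p ε := lt_max_of_lt_right hε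
  have hq : 0 < max q ε := lt_max_of_lt_right hε
  have h1 : y - x / max p ε - (y - x / max q ε)
      = x / (max p ε * max q ε) * (max p ε - max q ε) := by
    field_simp
    ring
  rw [h1, abs_mul, abs_of_nonneg (div_nonneg hx.1 (by positivity))]
  have h2 : |max p ε - max q ε| ≤ |p - q| := by
    simpa using abs_max_sub_max_le_max p ε q ε
  have h3 : x / (max p ε * max q ε) ≤ X / ε ^ 2 := by
    rw [pow_two]
    exact div_le_div₀ hX hx.2 (by positivity)
      (mul_le_mul (le_max_right _ _) (le_max_right _ _) hε.le hp.le)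
  calc _ ≤ X / ε ^ 2 * |p - q| := mul_le_mul h3 h2 (abs_nonneg _) (by positivity)
    _ ≤ _ := by
      apply mul_le_mul_of_nonneg_right _ (abs_nonneg _)
      linarith

theorem exists_truncated_solution {f : ℝ → ℝ} (hf : Continuous f) {ε X : ℝ} (hε : 0 < ε)
    (hX : 0 ≤ X) (s : ℝ) :
    ∃ w : ℝ → ℝ, w 0 = s ∧
      ∀ x ∈ Icc 0 X, HasDerivWithinAt w (f x - x / max (w x) ε) (Icc 0 X) x := by
  obtain ⟨C, hC⟩ := isCompact_Icc.exists_bound_of_continuousOn (s := Icc 0 X) hf.continuousOn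
  have hC0 : 0 ≤ C := (norm_nonneg _).trans (hC 0 ⟨le_rfl, hX⟩)
  refine exists_solution_of_lipschitz_of_bounded (v := fun x w => f x - x / max w ε)
    (L := C + X / ε) hX (by positivity) (fun x hx => lipschitz_truncated hε hx)
    (fun w => by fun_prop) (fun x hx w => ?_) s
  refine (norm_sub_le _ _).trans (add_le_add (hC x hx) ?_)
  have : 0 < max w ε := lt_max_of_lt_right hε
  rw [Real.norm_eq_abs, abs_of_nonneg (div_nonneg hx.1 this.le)]
  exact div_le_div₀ hX hx.2 hε (le_max_right _ _)

/-- A solution either lives on all of `[0, X]` or gets down to any given level below `s`. -/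
theorem exists_halfSol_or_exists_eq {f : ℝ → ℝ} (hf : Continuous f) {ε X s : ℝ} (hε : 0 < ε)
    (hX : 0 ≤ X) (hs : ε < s) :
    (∃ w, IsHalfSol f X s w) ∨
      ∃ z ∈ Ioc 0 X, ∃ w, IsHalfSol f z s w ∧ w z = ε ∧ ∀ x ∈ Icc 0 z, ε ≤ w x := by
  obtain ⟨w, hw0, hw⟩ := exists_truncated_solution hf hε hX s
  by_cases hall : ∀ x ∈ Icc 0 X, ε < w x
  · refine Or.inl ⟨w, hw0, fun x hx => ⟨hε.trans (hall x hx), ?_⟩⟩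
    have := hw x hx
    rwa [max_eq_left (hall x hx).le] at this
  · push Not at hall
    obtain ⟨z, hz, hze, hlt⟩ := exists_first_eq (fun x hx => (hw x hx).continuousWithinAt)
      (by rw [hw0]; exact hs) hall
    have hge : ∀ x ∈ Icc 0 z, ε ≤ w x := by
      intro x hx
      rcases hx.2.eq_or_lt with rfl | h
      · exact hze.ge
      · exact (hlt x ⟨hx.1, h⟩).le
    refine Or.inr ⟨z, hz, w, ⟨hw0, fun x hx => ⟨hε.trans_le (hge x hx), ?_⟩⟩, hze, hge⟩
    have := (hw x ⟨hx.1, hx.2.trans hz.2⟩).mono (Icc_subset_Icc_right hz.2)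
    rwa [max_eq_left (hge x hx)] at this

/-- Continuous dependence on the initial value and on the right-hand side. -/
theorem IsHalfSol.exists_near {f : ℝ → ℝ} {X s : ℝ} {w : ℝ → ℝ} (h : IsHalfSol f X s w)
    (hX : 0 ≤ X) {η : ℝ} (hη : 0 < η) :
    ∃ δ > 0, ∀ (g : ℝ → ℝ) (s' : ℝ), Continuous g → (∀ x, |g x - f x| ≤ δ) → |s' - s| ≤ δ →
      ∃ w', IsHalfSol g X s' w' ∧ ∀ x ∈ Icc 0 X, |w' x - w x| ≤ η := by
  obtain ⟨m, hm, hmw⟩ := h.exists_lower_bound hX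
  set ε := m / 2 with hεdef
  have hε : 0 < ε := by positivity
  set K : ℝ := X / ε ^ 2 + 1 with hK
  have hK0 : 0 < K := by positivity
  set C : ℝ := Real.exp (K * X) + (Real.exp (K * X) - 1) / K with hC
  have hC0 : 0 < C := by
    have : 1 ≤ Real.exp (K * X) := Real.one_le_exp (by positivity)
    have : 0 ≤ (Real.exp (K * X) - 1) / K := div_nonneg (by linarith) hK0.le
    positivity
  refine ⟨min η ε / C, by positivity, fun g s' hg hgf hs => ?_⟩
  set δ := min η ε / C with hδ
  have hδ0 : 0 < δ := by positivity
  obtain ⟨w', hw0, hw⟩ := exists_truncated_solution hg hε hX s'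
  have hbound : ∀ x ∈ Icc 0 X, dist (w' x) (w x) ≤ min η ε := by
    intro x hx
    have := dist_le_of_approx_trajectories_ODE_of_mem (f := w') (g := w) (a := 0) (b := X)
      (f' := fun x => g x - x / max (w' x) ε) (g' := fun x => f x - x / w x)
      (v := fun x w => f x - x / max w ε) (s := fun _ => univ) (εf := δ) (εg := 0) (δ := δ)
      (K := Real.toNNReal K)
      (fun x hx => (lipschitz_truncated hε (Ico_subset_Icc_self hx)).lipschitzOnWith)
      (fun x hx => (hw x hx).continuousWithinAt)
      (fun x hx => (hw x (Ico_subset_Icc_self hx)).Ici_of_Icc hx)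
      (fun x _ => by
        rw [Real.dist_eq]
        have : g x - x / max (w' x) ε - (f x - x / max (w' x) ε) = g x - f x := by ring
        rw [this]
        exact hgf x)
      (fun _ _ => trivial) h.continuousOn
      (fun x hx => (h.2 x (Ico_subset_Icc_self hx)).2.Ici_of_Icc hx)
      (fun x hx => by
        rw [max_eq_left (by linarith [hmw x (Ico_subset_Icc_self hx)]), dist_self])
      (fun _ _ => trivial) (by rw [hw0, h.1, Real.dist_eq]; exact hs) x hx
    refine this.trans ?_
    rw [Real.coe_toNNReal _ hK0.le, gronwallBound_of_K_ne_0 hK0.ne', sub_zero, add_zero]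
    have he : Real.exp (K * x) ≤ Real.exp (K * X) :=
      Real.exp_le_exp.2 (mul_le_mul_of_nonneg_left hx.2 hK0.le)
    have h2 : δ * C = min η ε := div_mul_cancel₀ _ hC0.ne'
    have h3 : δ / K * (Real.exp (K * x) - 1) ≤ δ * ((Real.exp (K * X) - 1) / K) := by
      rw [div_mul_eq_mul_div, mul_div_assoc]
      gcongr
    have h4 := mul_le_mul_of_nonneg_left he hδ0.le
    rw [← h2]
    calc _ ≤ δ * Real.exp (K * X) + δ * ((Real.exp (K * X) - 1) / K) := add_le_add h4 h3
      _ = δ * C := by rw [hC]; ring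
  refine ⟨w', ⟨hw0, fun x hx => ?_⟩, fun x hx => (hbound x hx).trans (min_le_left _ _)⟩
  have h1 := (hbound x hx).trans (min_le_right _ _)
  rw [Real.dist_eq, abs_le] at h1
  have h2 : ε ≤ w' x := by linarith [hmw x hx]
  refine ⟨hε.trans_le h2, ?_⟩
  have := hw x hx
  rwa [max_eq_left h2] at this

/-- A positive solution cannot get too close to zero: it then reaches zero in finite time. -/
theorem not_isHalfSol_of_small {f w : ℝ → ℝ} {X s z M η : ℝ} (hz : 0 < z) (hη : 0 < η)
    (hf : ∀ x ∈ Icc z (z + 1), f x ≤ M) (hsmall : 2 * M * η + 4 * η ^ 2 ≤ z) (hX : z + 1 ≤ X)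
    (hw : w z ≤ η) : ¬ IsHalfSol f X s w := by
  intro h
  have hsub : Icc z (z + 1) ⊆ Icc 0 X := Icc_subset_Icc hz.le hX
  have hd : ∀ x ∈ Icc z (z + 1), HasDerivWithinAt w (f x - x / w x) (Icc z (z + 1)) x :=
    fun x hx => (h.2 x (hsub hx)).2.mono hsub
  have hM : M - z / (2 * η) ≤ - (2 * η) := by
    have : M + 2 * η ≤ z / (2 * η) := by
      rw [le_div_iff₀ (by positivity)]
      nlinarith
    linarith
  have hest : ∀ x ∈ Icc z (z + 1), w x ≤ 2 * η → f x - x / w x ≤ - (2 * η) := by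
    intro x hx hwx
    have hp := (h.2 x (hsub hx)).1
    have h1 : z / (2 * η) ≤ x / w x :=
      div_le_div₀ (hz.le.trans hx.1) hx.1 hp hwx
    linarith [hf x hx]
  have hle := nonpos_of_hasDerivWithinAt_neg (h := fun x => w x - 2 * η)
    (fun x hx => (hd x hx).sub_const _) (by linarith)
    (fun x hx h0 => by linarith [hest x hx (by linarith)])
  have := le_of_hasDerivWithinAt_nonpos (h := fun x => w x + 2 * η * x)
    (h' := fun x => f x - x / w x + 2 * η)
    (fun x hx => by
      have h1 := ((hasDerivAt_id x).const_mul (2 * η)).hasDerivWithinAt (s := Icc z (z + 1))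
      rw [mul_one] at h1
      exact (hd x hx).add h1)
    (fun x hx => by linarith [hest x hx (by linarith [hle x hx])]) (z + 1)
    ⟨by linarith, le_rfl⟩
  have hp := (h.2 (z + 1) (hsub ⟨by linarith, le_rfl⟩)).1
  linarith

/-- Failing to live on `[0, X]` is an open condition, up to an increase of the interval. -/
theorem exists_not_halfSol_near {f : ℝ → ℝ} (hf : Continuous f) {X s : ℝ} (hX : 0 ≤ X)
    (hs : 0 < s) (h : ¬ ∃ w, IsHalfSol f X s w) :
    ∃ δ > 0, ∀ (g : ℝ → ℝ) (s' : ℝ), Continuous g → (∀ x, |g x - f x| ≤ δ) → |s' - s| ≤ δ →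
      ¬ ∃ w, IsHalfSol g (X + 1) s' w := by
  obtain ⟨z₁, hz₁, w₁, hw₁, -, hge₁⟩ :=
    (exists_halfSol_or_exists_eq hf (half_pos hs) hX (half_lt_self hs)).resolve_left h
  obtain ⟨C, hC⟩ := isCompact_Icc.exists_bound_of_continuousOn (s := Icc 0 (X + 1))
    hf.continuousOn
  have hC0 : 0 ≤ C := (norm_nonneg _).trans (hC 0 ⟨le_rfl, by linarith⟩)
  set η := min (s / 2) (min 1 (z₁ / (2 * (C + 1) + 4))) with hη
  have hη0 : 0 < η := by
    have := hz₁.1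
    positivity
  have hη1 : η ≤ s / 2 := min_le_left _ _
  have hη2 : η ≤ 1 := (min_le_right _ _).trans (min_le_left _ _)
  have hη3 : η * (2 * (C + 1) + 4) ≤ z₁ := by
    rw [← le_div_iff₀ (by positivity)]
    exact (min_le_right _ _).trans (min_le_right _ _)
  obtain ⟨z₂, hz₂, w₂, hw₂, hwz₂, -⟩ :=
    (exists_halfSol_or_exists_eq hf (half_pos hη0) hX (by linarith)).resolve_left h
  have hz12 : z₁ < z₂ := by
    by_contra! hle
    have h1 := (hw₁.mono hle).unique hw₂ z₂ ⟨hz₂.1.le, le_rfl⟩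
    have h2 := hge₁ z₂ ⟨hz₂.1.le, hle⟩
    linarith
  obtain ⟨δ, hδ, hnear⟩ := hw₂.exists_near hz₂.1.le (half_pos hη0)
  refine ⟨min δ 1, by positivity, ?_⟩
  rintro g s' hg hgf hss ⟨w, hw⟩
  obtain ⟨w', hw', hcl⟩ := hnear g s' hg (fun x => (hgf x).trans (min_le_left _ _))
    (hss.trans (min_le_left _ _))
  have h1 := hcl z₂ ⟨hz₂.1.le, le_rfl⟩
  have h2 := (hw.mono (X' := z₂) (by linarith [hz₂.2])).unique hw' z₂ ⟨hz₂.1.le, le_rfl⟩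
  rw [abs_le] at h1
  refine not_isHalfSol_of_small (z := z₂) (M := C + 1) hz₂.1 hη0 (fun x hx => ?_) ?_
    (by linarith [hz₂.2]) (by linarith) hw
  · have h3 := hC x ⟨hz₂.1.le.trans hx.1, hx.2.trans (by linarith [hz₂.2])⟩
    have h4 := (hgf x).trans (min_le_right _ _)
    rw [Real.norm_eq_abs, abs_le] at h3
    rw [abs_le] at h4
    linarith
  · nlinarith

/-- The solution of `w' = f x - x / w` with `w 0 = s` exists and stays positive on `[0, ∞)`. -/
def Survives (f : ℝ → ℝ) (s : ℝ) : Prop := ∀ X, 0 ≤ X → ∃ w, IsHalfSol f X s w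

/-- The solution of `w' = f x - x / w` with `w 0 = s` exceeds `1` somewhere beyond `x₀`. When
`x ≤ f x` beyond `x₀`, this is the case exactly for the unbounded solutions on `[0, ∞)`. -/
def Grows (f : ℝ → ℝ) (x₀ s : ℝ) : Prop := ∃ X ≥ x₀, ∃ w, IsHalfSol f X s w ∧ 1 < w X

theorem exists_not_survives_near {f : ℝ → ℝ} (hf : Continuous f) {s : ℝ}
    (hs : 0 < s) (h : ¬ Survives f s) :
    ∃ δ > 0, ∀ (g : ℝ → ℝ) (s' : ℝ), Continuous g → (∀ x, |g x - f x| ≤ δ) → |s' - s| ≤ δ →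
      ¬ Survives g s' := by
  unfold Survives at h
  push Not at h
  obtain ⟨X, hX, h⟩ := h
  obtain ⟨δ, hδ, H⟩ := exists_not_halfSol_near hf hX hs (fun ⟨w, hw⟩ => h w hw)
  exact ⟨δ, hδ, fun g s' hg hgf hss hsv => H g s' hg hgf hss (hsv (X + 1) (by linarith))⟩

theorem exists_grows_near {f : ℝ → ℝ} {x₀ s : ℝ} (hx₀ : 0 ≤ x₀) (h : Grows f x₀ s) :
    ∃ δ > 0, ∀ (g : ℝ → ℝ) (s' : ℝ), Continuous g → (∀ x, |g x - f x| ≤ δ) → |s' - s| ≤ δ →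
      Grows g x₀ s' := by
  obtain ⟨X, hX, w, hw, h1⟩ := h
  have hX0 : 0 ≤ X := hx₀.trans hX
  obtain ⟨δ, hδ, H⟩ := hw.exists_near hX0 (η := (w X - 1) / 2) (by linarith)
  refine ⟨δ, hδ, fun g s' hg hgf hss => ?_⟩
  obtain ⟨w', hw', hcl⟩ := H g s' hg hgf hss
  have := hcl X ⟨hX0, le_rfl⟩
  rw [abs_le] at this
  exact ⟨X, hX, w', hw', by linarith⟩

theorem Survives.mono {f g : ℝ → ℝ} (hg : Continuous g) {s s' : ℝ} (h : Survives f s)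
    (hfg : ∀ x, 0 ≤ x → f x ≤ g x) (hs : 0 < s) (hss : s ≤ s') : Survives g s' := by
  intro X hX
  obtain ⟨u, hu⟩ := h X hX
  obtain ⟨m, hm, hmu⟩ := hu.exists_lower_bound hX
  have hms : m ≤ s := by simpa [hu.1] using hmu 0 ⟨le_rfl, hX⟩
  refine (exists_halfSol_or_exists_eq hg (half_pos hm) hX (by linarith)).resolve_right ?_
  rintro ⟨z, hz, w, hw, hwz, -⟩
  have h1 := (hu.mono hz.2).le hw (fun x hx => hfg x hx.1) hss z ⟨hz.1.le, le_rfl⟩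
  have h2 := hmu z ⟨hz.1.le, hz.2⟩
  linarith

theorem Grows.survives {f : ℝ → ℝ} (hf : Continuous f) {x₀ s : ℝ} (hx₀ : 0 ≤ x₀)
    (hfx : ∀ x ≥ x₀, x ≤ f x) (h : Grows f x₀ s) : Survives f s := by
  intro X' hX'
  obtain ⟨X, hX, w, hw, h1⟩ := h
  have hX0 : 0 ≤ X := hx₀.trans hX
  obtain ⟨m, hm, hmw⟩ := hw.exists_lower_bound hX0
  have hms : m ≤ s := by simpa [hw.1] using hmw 0 ⟨le_rfl, hX0⟩
  have hε : 0 < min m 1 / 2 := by positivity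
  have hε1 : min m 1 / 2 < 1 := by linarith [min_le_right m 1]
  have hε2 : min m 1 / 2 < m := by linarith [min_le_left m 1]
  refine (exists_halfSol_or_exists_eq hf hε hX' (by linarith)).resolve_right ?_
  rintro ⟨z, hz, w₂, hw₂, hwz, -⟩
  rcases le_or_gt z X with hzX | hzX
  · have h3 := (hw.mono hzX).unique hw₂ z ⟨hz.1.le, le_rfl⟩
    have h2 := hmw z ⟨hz.1.le, hzX⟩
    linarith
  · have h3 := hw.unique (hw₂.mono hzX.le) X ⟨hX0, le_rfl⟩
    have hsub : Icc X z ⊆ Icc 0 z := Icc_subset_Icc_left hX0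
    have := le_of_hasDerivWithinAt_nonneg_of_lt (h := w₂) (c := 1) (p := X) (q := z)
      (fun x hx => (hw₂.2 x (hsub hx)).2.mono hsub) (by linarith)
      (fun x hx hlt => by
        have h4 : x / w₂ x ≤ x := div_le_self (hX0.trans hx.1) hlt.le
        linarith [hfx x (hX.le.trans hx.1)]) z ⟨hzX.le, le_rfl⟩
    linarith

theorem Survives.exists_global {f : ℝ → ℝ} {s : ℝ} (h : Survives f s) :
    ∃ w : ℝ → ℝ, ∀ X, 0 ≤ X → IsHalfSol f X s w := by
  choose! W hW using h
  refine ⟨fun x => W (x + 1) x, fun X hX => ?_⟩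
  have key : ∀ x ∈ Icc 0 X, W (x + 1) x = W (X + 1) x := fun x hx =>
    (hW (x + 1) (by linarith [hx.1])).unique
      ((hW (X + 1) (by linarith)).mono (by linarith [hx.2])) x ⟨hx.1, by linarith⟩
  exact ((hW (X + 1) (by linarith)).mono (by linarith)).congr hX key

/-- Among the solutions on `[0, ∞)` at most one is bounded: all above it grow. -/
theorem Survives.grows_of_lt {f : ℝ → ℝ} (hf : Continuous f) {x₀ s s' : ℝ} (hx₀ : 1 ≤ x₀)
    (h : Survives f s) (hs : 0 < s) (hss : s < s') : Grows f x₀ s' := by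
  obtain ⟨u, hu⟩ := h.exists_global
  obtain ⟨w, hw⟩ := (h.mono hf (fun _ _ => le_rfl) hs hss.le).exists_global
  by_contra hng
  have hw1 : ∀ x ≥ x₀, w x ≤ 1 := by
    intro x hx
    by_contra! hlt
    exact hng ⟨x, hx, w, hw x (by linarith), hlt⟩
  set e := s' - s with he
  have he0 : 0 < e := by linarith
  set Z := x₀ + 2 / e with hZ
  have hZ0 : x₀ ≤ Z := by
    have : 0 < 2 / e := by positivity
    linarith
  have hsub : Icc x₀ Z ⊆ Icc 0 Z := Icc_subset_Icc_left (by linarith)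
  have hlow : ∀ x ∈ Icc 0 Z, e ≤ w x - u x := fun x hx => by
    have := (hu Z (by linarith)).add_le (hw Z (by linarith)) (P := fun _ => 0) (p := fun _ => 0)
      (fun x => hasDerivAt_const _ _) rfl (by simp) (by simp) hss.le x hx
    linarith
  have hw' := hw Z (by linarith)
  have hu' := hu Z (by linarith)
  have := le_of_hasDerivWithinAt_nonneg (h := fun x => w x - u x - e * x)
    (h' := fun x => (f x - x / w x) - (f x - x / u x) - e) (p := x₀) (q := Z)
    (fun x hx => by
      have h1 := ((hasDerivAt_id x).const_mul e).hasDerivWithinAt (s := Icc x₀ Z)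
      rw [mul_one] at h1
      exact (((hw'.2 x (hsub hx)).2.sub (hu'.2 x (hsub hx)).2).mono hsub).sub h1)
    (fun x hx => by
      have hwp := (hw'.2 x (hsub hx)).1
      have hup := (hu'.2 x (hsub hx)).1
      have h1 := hlow x (hsub hx)
      have h2 := hw1 x hx.1
      have h3 : x / u x - x / w x = x * (w x - u x) / (u x * w x) := by
        field_simp
      have hx0 : 1 ≤ x := hx₀.trans hx.1
      have h4 : e ≤ x * (w x - u x) / (u x * w x) := by
        rw [le_div_iff₀ (by positivity)]
        have h5 : u x * w x ≤ 1 := by nlinarith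
        nlinarith
      linarith) Z ⟨hZ0, le_rfl⟩
  have h1 := hlow x₀ ⟨by linarith, hZ0⟩
  have h2 := hw1 Z hZ0
  have h3 := (hu'.2 Z ⟨by linarith, le_rfl⟩).1
  have h4 : e * Z = e * x₀ + 2 := by rw [hZ]; field_simp
  linarith

/-! ### Existence of the parameter -/

/-- The quartic `F`, whose graph `y = F x` is the vertical isocline of the Liénard system. -/
def lienardCurve (a b c d x : ℝ) : ℝ := a * x ^ 4 + b * x ^ 3 + c * x ^ 2 + d * x

/-- The derivative `f = F'` of `lienardCurve`. -/
def lienardDamping (a b c d x : ℝ) : ℝ := 4 * a * x ^ 3 + 3 * b * x ^ 2 + 2 * c * x + d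

theorem hasDerivAt_lienardCurve (a b c d x : ℝ) :
    HasDerivAt (lienardCurve a b c d) (lienardDamping a b c d x) x := by
  have h := ((((hasDerivAt_pow 4 x).const_mul a).add ((hasDerivAt_pow 3 x).const_mul b)).add
    ((hasDerivAt_pow 2 x).const_mul c)).add ((hasDerivAt_id x).const_mul d)
  refine h.congr_deriv ?_
  unfold lienardDamping
  norm_num
  ring

@[fun_prop]
theorem continuous_lienardCurve (a b c d : ℝ) : Continuous (lienardCurve a b c d) := by
  unfold lienardCurve
  fun_prop

@[fun_prop]
theorem continuous_lienardDamping (a b c d : ℝ) : Continuous (lienardDamping a b c d) := by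
  unfold lienardDamping
  fun_prop

theorem lienardCurve_neg (a b c d x : ℝ) :
    lienardCurve a b c d (-x) = lienardCurve a (-b) c (-d) x := by
  unfold lienardCurve
  ring

theorem lienardDamping_neg (a b c d x : ℝ) :
    lienardDamping a b c d (-x) = - lienardDamping a (-b) c (-d) x := by
  unfold lienardDamping
  ring

/-- `W` is the height of the isocline `y = F x` over a homoclinic loop: then `y = F x - W x` is an
invariant curve of the Liénard system, and the boundedness of `W` makes it follow the isocline to
infinity on both sides. -/
structure IsSeparatrix (a b c d : ℝ) (W : ℝ → ℝ) : Prop where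
  pos : ∀ x, 0 < W x
  hasDerivAt : ∀ x, HasDerivAt W (lienardDamping a b c d x - x / W x) x
  bdd : ∃ B, ∀ x, W x ≤ B

/-- On `[0, 1]` the damping is at most `C * x` when `d ≤ 0`, so `- x / w` makes small solutions
reach zero there. -/
theorem exists_not_survives {a b c d : ℝ} (ha : 0 < a) (hd : d ≤ 0) :
    ∃ s > 0, ¬ Survives (lienardDamping a b c d) s := by
  set C := 2 * |c| + 3 * |b| + 4 * a with hC
  have hC0 : 0 < C := by positivity
  set s := min (1 / (4 * C)) (1 / 2) with hs
  have hs0 : 0 < s := by positivity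
  have hsC : 4 * C * s ≤ 1 := by
    have : s ≤ 1 / (4 * C) := min_le_left _ _
    rw [le_div_iff₀ (by positivity)] at this
    linarith
  have hs2 : s ≤ 1 / 2 := min_le_right _ _
  refine ⟨s, hs0, fun h => ?_⟩
  obtain ⟨w, hw⟩ := h 1 zero_le_one
  have hf : ∀ x ∈ Icc (0 : ℝ) 1, lienardDamping a b c d x ≤ C * x := by
    intro x hx
    unfold lienardDamping
    have h1 : c * x ≤ |c| * x := mul_le_mul_of_nonneg_right (le_abs_self c) hx.1
    have h2 : b * x ^ 2 ≤ |b| * x := by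
      have h3 : b * x ^ 2 ≤ |b| * x ^ 2 := mul_le_mul_of_nonneg_right (le_abs_self b) (by positivity)
      have h4 : x ^ 2 ≤ x := by nlinarith [hx.1, hx.2]
      have := mul_le_mul_of_nonneg_left h4 (abs_nonneg b)
      linarith
    have h3 : a * x ^ 3 ≤ a * x := by
      have h4 : x ^ 3 ≤ x := by
        have := hx.1
        have : x ^ 2 ≤ 1 := by nlinarith [hx.1, hx.2]
        nlinarith
      exact mul_le_mul_of_nonneg_left h4 ha.le
    rw [hC]
    linarith
  have hle := nonpos_of_hasDerivWithinAt_neg (h := fun x => w x - 2 * s)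
    (fun x hx => (hw.2 x hx).2.sub_const _) (by linarith [hw.1])
    (fun x hx h0 => by
      have hx0 : x ≠ 0 := by
        rintro rfl
        rw [hw.1] at h0
        linarith
      have hxp : 0 < x := lt_of_le_of_ne hx.1 hx0.symm
      have hwx : w x = 2 * s := by linarith
      have h1 := hf x hx
      have h2 : 2 * C * x ≤ x / w x := by
        rw [hwx, le_div_iff₀ (by positivity)]
        nlinarith
      have : 0 < C * x := by positivity
      linarith)
  have := le_of_hasDerivWithinAt_nonpos (h := fun x => w x ^ 2 + x ^ 2 / 2)
    (h' := fun x => 2 * w x * (lienardDamping a b c d x - x / w x) + x) (p := 0) (q := 1)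
    (fun x hx => by
      have h1 := ((hw.2 x hx).2.pow 2).add
        (((hasDerivAt_pow 2 x).div_const 2).hasDerivWithinAt (s := Icc 0 1))
      refine h1.congr_deriv ?_
      norm_num)
    (fun x hx => by
      have hp := (hw.2 x hx).1
      have h1 := hf x hx
      have h2 := hle x hx
      have h3 : 2 * w x * (lienardDamping a b c d x - x / w x)
          = 2 * w x * lienardDamping a b c d x - 2 * x := by field_simp
      rw [h3]
      have h4 : w x * lienardDamping a b c d x ≤ w x * (C * x) :=
        mul_le_mul_of_nonneg_left h1 hp.le
      have h5 : w x * (C * x) ≤ 2 * s * (C * x) :=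
        mul_le_mul_of_nonneg_right (by linarith) (mul_nonneg hC0.le hx.1)
      nlinarith [hx.1]) 1 ⟨zero_le_one, le_rfl⟩
  rw [hw.1] at this
  nlinarith [sq_nonneg (w 1)]

theorem exists_grows {f : ℝ → ℝ} (hf : Continuous f) {x₀ : ℝ} (hx₀ : 0 ≤ x₀) :
    ∃ s > 0, Grows f x₀ s := by
  obtain ⟨C, hC⟩ := isCompact_Icc.exists_bound_of_continuousOn (s := Icc 0 x₀) hf.continuousOn
  have hC0 : 0 ≤ C := (norm_nonneg _).trans (hC 0 ⟨le_rfl, hx₀⟩)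
  set s := 2 + (C + x₀) * x₀ with hs
  have hs1 : 1 < s := by
    have : 0 ≤ (C + x₀) * x₀ := by positivity
    linarith
  have key : ∀ z ∈ Ioc 0 x₀, ∀ w, IsHalfSol f z s w → (∀ x ∈ Icc 0 z, 1 ≤ w x) → w z ≠ 1 := by
    intro z hz w hw hge h1
    have := le_of_hasDerivWithinAt_nonneg (h := fun x => w x + (C + x₀) * x)
      (h' := fun x => f x - x / w x + (C + x₀)) (p := 0) (q := z)
      (fun x hx => by
        have h1 := ((hasDerivAt_id x).const_mul (C + x₀)).hasDerivWithinAt (s := Icc 0 z)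
        rw [mul_one] at h1
        exact (hw.2 x hx).2.add h1)
      (fun x hx => by
        have h2 := hC x ⟨hx.1, hx.2.trans hz.2⟩
        rw [Real.norm_eq_abs, abs_le] at h2
        have h3 : x / w x ≤ x := div_le_self hx.1 (hge x hx)
        linarith [hx.2, hz.2]) z ⟨hz.1.le, le_rfl⟩
    rw [hw.1, h1] at this
    have : (C + x₀) * z ≤ (C + x₀) * x₀ := mul_le_mul_of_nonneg_left hz.2 (by positivity)
    linarith
  obtain ⟨w, hw⟩ | ⟨z, hz, w, hw, h1, h2⟩ := exists_halfSol_or_exists_eq hf one_pos hx₀ hs1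
  · refine ⟨s, by linarith, x₀, le_rfl, w, hw, ?_⟩
    by_contra! hle
    obtain ⟨z, hz, hze, hlt⟩ := exists_first_eq hw.continuousOn (c := 1) (by rw [hw.1]; exact hs1)
      ⟨x₀, ⟨hx₀, le_rfl⟩, hle⟩
    refine key z hz w (hw.mono hz.2) (fun x hx => ?_) hze
    rcases hx.2.eq_or_lt with rfl | h
    · exact hze.ge
    · exact (hlt x ⟨hx.1, h⟩).le
  · exact absurd h1 (key z hz w hw h2)

/-- When the isocline lies above the line `y = 2 x`, all solutions grow: the orbits below the
line `y = x` cannot cross it. -/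
theorem grows_of_le_lienardCurve {a b c d x₀ s : ℝ} (hs : 0 < s)
    (h : ∀ x, 0 ≤ x → 2 * x ≤ lienardCurve a b c d x) :
    Grows (lienardDamping a b c d) x₀ s := by
  have key : ∀ z, ∀ w, IsHalfSol (lienardDamping a b c d) z s w → ∀ x ∈ Icc 0 z, s + x ≤ w x := by
    intro z w hw x hx
    have hz : 0 ≤ z := hx.1.trans hx.2
    have h0 : lienardCurve a b c d 0 = 0 := by simp [lienardCurve]
    have := le_of_hasDerivWithinAt_nonneg_of_lt (h := fun x => w x - (lienardCurve a b c d x - x))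
      (h' := fun x => (lienardDamping a b c d x - x / w x) - (lienardDamping a b c d x - 1))
      (p := 0) (q := z) (c := 0)
      (fun x hx => (hw.2 x hx).2.sub
        ((hasDerivAt_lienardCurve a b c d x).sub (hasDerivAt_id x)).hasDerivWithinAt)
      (by simp [hw.1, h0, hs])
      (fun x hx hlt => by
        have h1 := h x hx.1
        have h2 : x / w x ≤ 1 := (div_le_one (hw.2 x hx).1).2 (by linarith)
        linarith) x hx
    simp only [hw.1, h0] at this
    linarith [h x hx.1]
  have hX : 0 ≤ max x₀ 1 := zero_le_one.trans (le_max_right _ _)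
  obtain ⟨w, hw⟩ | ⟨z, hz, w, hw, h1, h2⟩ :=
    exists_halfSol_or_exists_eq (continuous_lienardDamping a b c d) (half_pos hs) hX (half_lt_self hs)
  · refine ⟨max x₀ 1, le_max_left _ _, w, hw, ?_⟩
    have := key _ w hw (max x₀ 1) ⟨hX, le_rfl⟩
    linarith [le_max_right x₀ 1]
  · have := key z w hw z ⟨hz.1.le, le_rfl⟩
    linarith [hz.1]

/-- The bounded solution on the half-line, as the threshold between the solutions that reach zero
and the solutions that grow. -/
theorem exists_threshold {a b c d x₀ : ℝ} (ha : 0 < a) (hd : d ≤ 0) (hx₀ : 1 ≤ x₀)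
    (hfx : ∀ x ≥ x₀, x ≤ lienardDamping a b c d x) :
    ∃ σ > 0, Survives (lienardDamping a b c d) σ ∧ ¬ Grows (lienardDamping a b c d) x₀ σ ∧
      ∀ s, 0 < s → s < σ → ¬ Survives (lienardDamping a b c d) s := by
  set f := lienardDamping a b c d with hf
  have hfc : Continuous f := continuous_lienardDamping a b c d
  set S := {s | 0 < s ∧ Survives f s} with hS
  obtain ⟨s₁, hs₁, hd₁⟩ := exists_not_survives (b := b) (c := c) ha hd
  obtain ⟨s₂, hs₂, hg₂⟩ := exists_grows hfc (zero_le_one.trans hx₀)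
  have hlow : ∀ s ∈ S, s₁ ≤ s := by
    intro s hs
    by_contra! hlt
    exact hd₁ (hs.2.mono hfc (fun _ _ => le_rfl) hs.1 hlt.le)
  have hne : S.Nonempty := ⟨s₂, hs₂, hg₂.survives hfc (by linarith) hfx⟩
  have hbdd : BddBelow S := ⟨s₁, hlow⟩
  have hσ : 0 < sInf S := hs₁.trans_le (le_csInf hne hlow)
  have hbelow : ∀ s, 0 < s → s < sInf S → ¬ Survives f s := fun s h0 h1 h2 =>
    absurd (csInf_le hbdd ⟨h0, h2⟩) (not_le.2 h1)
  refine ⟨sInf S, hσ, ?_, ?_, hbelow⟩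
  · by_contra hns
    obtain ⟨δ, hδ, H⟩ := exists_not_survives_near hfc hσ hns
    obtain ⟨s, hsS, hs⟩ := exists_lt_of_csInf_lt hne (lt_add_of_pos_right (sInf S) hδ)
    have h1 := csInf_le hbdd hsS
    exact H f s hfc (by simp [hδ.le]) (by rw [abs_le]; constructor <;> linarith) hsS.2
  · intro hg
    obtain ⟨δ, hδ, H⟩ := exists_grows_near (zero_le_one.trans hx₀) hg
    have h1 : max (sInf S - δ) (sInf S / 2) < sInf S := max_lt (by linarith) (by linarith)
    refine hbelow _ (lt_max_of_lt_right (half_pos hσ)) h1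
      ((H f _ hfc (by simp [hδ.le]) ?_).survives hfc (by linarith) hfx)
    rw [abs_le]
    constructor <;> linarith [le_max_left (sInf S - δ) (sInf S / 2)]

theorem abs_lienardDamping_sub (a b c d d' x : ℝ) :
    |lienardDamping a b c d' x - lienardDamping a b c d x| = |d' - d| := by
  unfold lienardDamping
  congr 1
  ring

/-- At `d = 0` the right-hand sides of the equations on the right and on the left differ by
`6 * b * x ^ 2`, so that a solution on the left stays too far below a bounded one on the right. -/
theorem not_survives_left_of_zero {a b c x₀ σ : ℝ} (hb : 0 < b) (hx₀ : 1 ≤ x₀)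
    (hS : Survives (lienardDamping a b c 0) σ) (hG : ¬ Grows (lienardDamping a b c 0) x₀ σ) :
    ¬ Survives (lienardDamping a (-b) c 0) σ := by
  intro hL
  obtain ⟨w, hw⟩ := hS.exists_global
  obtain ⟨u, hu⟩ := hL.exists_global
  set Z := x₀ + 1 / b with hZ
  have hb' : 0 < 1 / b := by positivity
  have hZ1 : 1 ≤ Z := by linarith
  have h1 := (hu Z (by linarith)).add_le (hw Z (by linarith)) (P := fun x => 2 * b * x ^ 3)
    (p := fun x => 6 * b * x ^ 2) (fun x => by
      refine ((hasDerivAt_pow 3 x).const_mul (2 * b)).congr_deriv ?_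
      norm_num
      ring) (by norm_num) (fun x _ => by unfold lienardDamping; linarith)
    (fun x _ => by positivity) le_rfl Z ⟨by linarith, le_rfl⟩
  have h2 := ((hu Z (by linarith)).2 Z ⟨by linarith, le_rfl⟩).1
  have h3 : w Z ≤ 1 := by
    by_contra! hlt
    exact hG ⟨Z, by linarith, w, hw Z (by linarith), hlt⟩
  have h4 : Z ≤ Z ^ 3 := by
    have : 1 ≤ Z ^ 2 := one_le_pow₀ hZ1
    nlinarith
  have h5 : 1 ≤ b * Z := by
    have : b * Z = b * x₀ + 1 := by rw [hZ]; field_simp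
    nlinarith
  nlinarith

/-- For some `d` the bounded solutions on the right and on the left have the same initial value.
The set `O₁` contains the `d` with the threshold on the left strictly below the one on the right,
`O₂` those with the opposite order; both are open and meet the interval `[-M, 0]`. -/
theorem exists_common_threshold (a b c : ℝ) (ha : 0 < a) (hb : 0 < b) :
    ∃ d x₀ s : ℝ, 1 ≤ x₀ ∧
      Survives (lienardDamping a b c d) s ∧ ¬ Grows (lienardDamping a b c d) x₀ s ∧
      Survives (lienardDamping a (-b) c (-d)) s ∧
      ¬ Grows (lienardDamping a (-b) c (-d)) x₀ s := by
  set r := 1 + (b + |c|) / a with hr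
  set M := b * r ^ 2 + |c| * r + 2 with hM
  have hr1 : 1 ≤ r := by
    have : 0 ≤ (b + |c|) / a := by positivity
    linarith
  have har : a * r = a + b + |c| := by rw [hr]; field_simp; ring
  have hM0 : 0 < M := by positivity
  set x₀ := 1 + (3 * b + 2 * |c| + M + 1) / a with hx₀
  have hx1 : 1 ≤ x₀ := by
    have : 0 ≤ (3 * b + 2 * |c| + M + 1) / a := by positivity
    linarith
  have hax : a * x₀ = a + 3 * b + 2 * |c| + M + 1 := by rw [hx₀]; field_simp; ring
  have hgrow : ∀ β d : ℝ, -b ≤ β → -M ≤ d → ∀ x ≥ x₀, x ≤ lienardDamping a β c d x := by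
    intro β d hβ hd x hx
    have hx1' : 1 ≤ x := hx1.trans hx
    have h1 : 3 * b + 2 * |c| + M + 1 ≤ a * x := by
      have := mul_le_mul_of_nonneg_left hx ha.le
      linarith
    have h2 : (3 * b + 2 * |c| + M + 1) * x ^ 2 ≤ a * x ^ 3 := by
      have := mul_le_mul_of_nonneg_right h1 (sq_nonneg x)
      linarith
    have h3 : -(b * x ^ 2) ≤ β * x ^ 2 := by nlinarith [sq_nonneg x]
    have h4 : -(|c| * x ^ 2) ≤ c * x := by
      have h5 : -(|c| * x) ≤ c * x := by nlinarith [neg_abs_le c]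
      have h6 : |c| * x ≤ |c| * x ^ 2 :=
        mul_le_mul_of_nonneg_left (by nlinarith) (abs_nonneg c)
      linarith
    have h5 : 0 < a * x ^ 3 := by positivity
    have h6 : x ≤ x ^ 2 := by nlinarith
    have h7 : M ≤ M * x ^ 2 := le_mul_of_one_le_right hM0.le (one_le_pow₀ hx1')
    unfold lienardDamping
    linarith
  have hMgrow : ∀ x, 0 ≤ x → 2 * x ≤ lienardCurve a (-b) c M x := by
    intro x hx
    have key : 0 ≤ a * x ^ 3 - b * x ^ 2 + c * x + (M - 2) := by
      have hc : -(|c| * x) ≤ c * x := by nlinarith [neg_abs_le c]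
      rcases le_total x r with hxr | hxr
      · have h1 : b * x ^ 2 ≤ b * r ^ 2 := by gcongr
        have h2 : |c| * x ≤ |c| * r := by gcongr
        have h3 : 0 ≤ a * x ^ 3 := by positivity
        linarith
      · have h1 : b + |c| ≤ a * x := by
          have := mul_le_mul_of_nonneg_left hxr ha.le
          linarith
        have h2 : (b + |c|) * x ^ 2 ≤ a * x ^ 3 := by
          have := mul_le_mul_of_nonneg_right h1 (sq_nonneg x)
          linarith
        have h3 : |c| * x ≤ |c| * x ^ 2 :=
          mul_le_mul_of_nonneg_left (by nlinarith) (abs_nonneg c)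
        have : 0 ≤ b * r ^ 2 + |c| * r := by positivity
        linarith
    have := mul_nonneg key hx
    unfold lienardCurve
    linarith
  have hR : ∀ d ∈ Icc (-M) 0, ∀ x ≥ x₀, x ≤ lienardDamping a b c d x := fun d hd =>
    hgrow b d (by linarith) hd.1
  have hL : ∀ d ∈ Icc (-M) 0, ∀ x ≥ x₀, x ≤ lienardDamping a (-b) c (-d) x := fun d hd =>
    hgrow (-b) (-d) le_rfl (by linarith [hd.2])
  set fR := fun d => lienardDamping a b c d with hfR
  set fL := fun d => lienardDamping a (-b) c (-d) with hfL
  have hRc : ∀ d, Continuous (fR d) := fun d => continuous_lienardDamping _ _ _ _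
  have hLc : ∀ d, Continuous (fL d) := fun d => continuous_lienardDamping _ _ _ _
  have hRd : ∀ d d' x, |fR d' x - fR d x| = |d' - d| := fun d d' x =>
    abs_lienardDamping_sub _ _ _ _ _ _
  have hLd : ∀ d d' x, |fL d' x - fL d x| = |d' - d| := fun d d' x => by
    rw [abs_lienardDamping_sub, neg_sub_neg, abs_sub_comm]
  have hx0 : 0 ≤ x₀ := by linarith
  set O₁ := {d | ∃ s > 0, ¬ Survives (fR d) s ∧ Grows (fL d) x₀ s} with hO₁
  set O₂ := {d | ∃ s > 0, Grows (fR d) x₀ s ∧ ¬ Survives (fL d) s} with hO₂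
  have hopen₁ : IsOpen O₁ := by
    rw [Metric.isOpen_iff]
    rintro d ⟨s, hs, h1, h2⟩
    obtain ⟨δ₁, hδ₁, H₁⟩ := exists_not_survives_near (hRc d) hs h1
    obtain ⟨δ₂, hδ₂, H₂⟩ := exists_grows_near hx0 h2
    refine ⟨min δ₁ δ₂, by positivity, fun d' hd' => ⟨s, hs, ?_, ?_⟩⟩
    all_goals rw [Metric.mem_ball, Real.dist_eq] at hd'
    · exact H₁ _ s (hRc d') (fun x => by rw [hRd]; exact hd'.le.trans (min_le_left _ _))
        (by simp [hδ₁.le])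
    · exact H₂ _ s (hLc d') (fun x => by rw [hLd]; exact hd'.le.trans (min_le_right _ _))
        (by simp [hδ₂.le])
  have hopen₂ : IsOpen O₂ := by
    rw [Metric.isOpen_iff]
    rintro d ⟨s, hs, h2, h1⟩
    obtain ⟨δ₁, hδ₁, H₁⟩ := exists_not_survives_near (hLc d) hs h1
    obtain ⟨δ₂, hδ₂, H₂⟩ := exists_grows_near hx0 h2
    refine ⟨min δ₁ δ₂, by positivity, fun d' hd' => ⟨s, hs, ?_, ?_⟩⟩
    all_goals rw [Metric.mem_ball, Real.dist_eq] at hd'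
    · exact H₂ _ s (hRc d') (fun x => by rw [hRd]; exact hd'.le.trans (min_le_right _ _))
        (by simp [hδ₂.le])
    · exact H₁ _ s (hLc d') (fun x => by rw [hLd]; exact hd'.le.trans (min_le_left _ _))
        (by simp [hδ₁.le])
  -- at `d = -M` no orbit on the left is bounded, so the threshold on the left is lower
  have hmem₁ : -M ∈ O₁ := by
    obtain ⟨σ, hσ, -, -, h3⟩ := exists_threshold ha (by linarith) hx1
      (hR (-M) ⟨le_rfl, by linarith⟩)
    refine ⟨σ / 2, half_pos hσ, h3 _ (half_pos hσ) (half_lt_self hσ), ?_⟩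
    have : fL (-M) = lienardDamping a (-b) c M := by simp [hfL]
    rw [this]
    exact grows_of_le_lienardCurve (half_pos hσ) hMgrow
  have hmem₂ : (0 : ℝ) ∈ O₂ := by
    obtain ⟨σ, hσ, h1, h2, -⟩ := exists_threshold ha le_rfl hx1
      (hR 0 ⟨by linarith, le_rfl⟩)
    have h4 : ¬ Survives (fL 0) σ := by
      have := not_survives_left_of_zero hb hx1 h1 h2
      simpa [hfL] using this
    obtain ⟨δ, hδ, H⟩ := exists_not_survives_near (hLc 0) hσ h4
    exact ⟨σ + δ, by linarith, h1.grows_of_lt (hRc 0) hx1 hσ (by linarith),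
      H _ _ (hLc 0) (by simp [hδ.le]) (by simp [abs_of_pos hδ])⟩
  have hdisj : ∀ d ∈ Icc (-M) 0, d ∈ O₁ → d ∉ O₂ := by
    rintro d hd ⟨s, hs, h1, h2⟩ ⟨s', hs', h3, h4⟩
    rcases le_total s' s with hle | hle
    · exact h1 ((h3.survives (hRc d) hx0 (hR d hd)).mono (hRc d) (fun _ _ => le_rfl) hs' hle)
    · exact h4 ((h2.survives (hLc d) hx0 (hL d hd)).mono (hLc d) (fun _ _ => le_rfl) hs hle)
  have hM0' : -M ≤ 0 := by linarith
  obtain ⟨d, hd, hd₁, hd₂⟩ : ∃ d ∈ Icc (-M) 0, d ∉ O₁ ∧ d ∉ O₂ := by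
    by_contra! hcon
    obtain ⟨d, hd, h1, h2⟩ := isPreconnected_Icc (a := -M) (b := (0 : ℝ)) O₁ O₂ hopen₁ hopen₂
      (fun d hd => by
        by_cases h : d ∈ O₁
        · exact Or.inl h
        · exact Or.inr (hcon d hd h))
      ⟨-M, ⟨le_rfl, hM0'⟩, hmem₁⟩ ⟨0, ⟨hM0', le_rfl⟩, hmem₂⟩
    exact hdisj d hd h1 h2
  obtain ⟨σ, hσ, h1, h2, h3⟩ := exists_threshold ha hd.2 hx1 (hR d hd)
  refine ⟨d, x₀, σ, hx1, h1, h2, ?_, ?_⟩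
  · by_contra h4
    obtain ⟨δ, hδ, H⟩ := exists_not_survives_near (f := fL d) (hLc d) hσ h4
    exact hd₂ ⟨σ + δ, by linarith, h1.grows_of_lt (hRc d) hx1 hσ (by linarith),
      H _ _ (hLc d) (by simp [hδ.le]) (by simp [abs_of_pos hδ])⟩
  · intro h4
    obtain ⟨δ, hδ, H⟩ := exists_grows_near hx0 h4
    have h5 : max (σ - δ) (σ / 2) < σ := max_lt (by linarith) (by linarith)
    have h6 : 0 < max (σ - δ) (σ / 2) := lt_max_of_lt_right (half_pos hσ)
    refine hd₁ ⟨_, h6, h3 _ h6 h5, H _ _ (hLc d) (by simp [hfL, hδ.le]) ?_⟩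
    rw [abs_le]
    constructor <;> linarith [le_max_left (σ - δ) (σ / 2)]

/-- Two bounded half-line solutions with the same initial value are the two halves of a
separatrix. -/
theorem isSeparatrix_of_halves {a b c d s x₀ : ℝ} {w u : ℝ → ℝ}
    (hw : ∀ X, 0 ≤ X → IsHalfSol (lienardDamping a b c d) X s w)
    (hu : ∀ X, 0 ≤ X → IsHalfSol (lienardDamping a (-b) c (-d)) X s u)
    (hwb : ∀ x ≥ x₀, w x ≤ 1) (hub : ∀ x ≥ x₀, u x ≤ 1) :
    IsSeparatrix a b c d (fun x => if 0 ≤ x then w x else u (-x)) := by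
  have hbound : ∀ (f v : ℝ → ℝ), (∀ X, 0 ≤ X → IsHalfSol f X s v) → (∀ x ≥ x₀, v x ≤ 1) →
      ∃ B, ∀ x, 0 ≤ x → v x ≤ B := by
    intro f v hv hv1
    obtain ⟨B, hB⟩ := isCompact_Icc.exists_bound_of_continuousOn
      (hv (max x₀ 0) (le_max_right _ _)).continuousOn
    refine ⟨max B 1, fun x hx => ?_⟩
    rcases le_total x (max x₀ 0) with h | h
    · exact (le_abs_self _).trans ((hB x ⟨hx, h⟩).trans (le_max_left _ _))
    · exact (hv1 x ((le_max_left _ _).trans h)).trans (le_max_right _ _)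
  have hright : ∀ (f v : ℝ → ℝ), (∀ X, 0 ≤ X → IsHalfSol f X s v) → ∀ x, 0 ≤ x →
      HasDerivWithinAt v (f x - x / v x) (Ici 0) x := by
    intro f v hv x hx
    refine ((hv (x + 1) (by linarith)).2 x ⟨hx, by linarith⟩).2.mono_of_mem_nhdsWithin ?_
    rw [← Ici_inter_Iic]
    exact inter_mem self_mem_nhdsWithin (mem_nhdsWithin_of_mem_nhds (Iic_mem_nhds (by linarith)))
  have hpos : ∀ (f v : ℝ → ℝ), (∀ X, 0 ≤ X → IsHalfSol f X s v) → ∀ x, 0 ≤ x → 0 < v x :=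
    fun f v hv x hx => ((hv x hx).2 x ⟨hx, le_rfl⟩).1
  have h0 : w 0 = u 0 := (hw 0 le_rfl).1.trans (hu 0 le_rfl).1.symm
  refine ⟨fun x => ?_, fun x => ?_, ?_⟩
  · split_ifs with h
    · exact hpos _ _ hw x h
    · exact hpos _ _ hu (-x) (by linarith)
  · have hR : ∀ x, 0 ≤ x → HasDerivWithinAt (fun x => if 0 ≤ x then w x else u (-x))
        (lienardDamping a b c d x - x / w x) (Ici 0) x := fun x hx =>
      (hright _ _ hw x hx).congr (fun y hy => if_pos hy) (if_pos hx)
    have hL : ∀ x, x ≤ 0 → HasDerivWithinAt (fun x => if 0 ≤ x then w x else u (-x))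
        (lienardDamping a b c d x - x / u (-x)) (Iic 0) x := by
      intro x hx
      have heq : ∀ y ∈ Iic (0 : ℝ), (if 0 ≤ y then w y else u (-y)) = u (-y) := by
        intro y hy
        split_ifs with h
        · have : y = 0 := le_antisymm hy h
          rw [this, neg_zero, h0]
        · rfl
      have h1 := (hright _ _ hu (-x) (by linarith)).scomp x ((hasDerivAt_neg x).hasDerivWithinAt
        (s := Iic 0)) (fun y hy => by simpa using hy)
      refine (h1.congr_deriv ?_).congr (fun y hy => ?_) ?_
      · have := lienardDamping_neg a b c d (-x)
        rw [neg_neg] at this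
        rw [this]
        simp
        ring
      · exact heq y hy
      · exact heq x hx
    rcases lt_trichotomy x 0 with h | h | h
    · rw [if_neg (not_le.2 h)]
      exact (hL x h.le).hasDerivAt (Iic_mem_nhds h)
    · subst h
      have h1 := hR 0 le_rfl
      have h2 := hL 0 le_rfl
      simp only [zero_div, le_refl, if_true] at h1 h2 ⊢
      have := h2.union h1
      rwa [Iic_union_Ici, hasDerivWithinAt_univ] at this
    · rw [if_pos h.le]
      exact (hR x h.le).hasDerivAt (Ici_mem_nhds h)
  · obtain ⟨B₁, h₁⟩ := hbound _ _ hw hwb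
    obtain ⟨B₂, h₂⟩ := hbound _ _ hu hub
    refine ⟨max B₁ B₂, fun x => ?_⟩
    split_ifs with h
    · exact (h₁ x h).trans (le_max_left _ _)
    · exact (h₂ (-x) (by linarith)).trans (le_max_right _ _)

/-- Existence of a parameter with a separatrix. -/
theorem exists_isSeparatrix (a b c : ℝ) (ha : 0 < a) (hb : 0 < b) :
    ∃ (d : ℝ) (W : ℝ → ℝ), IsSeparatrix a b c d W := by
  obtain ⟨d, x₀, s, hx₀, h1, h2, h3, h4⟩ := exists_common_threshold a b c ha hb
  obtain ⟨w, hw⟩ := h1.exists_global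
  obtain ⟨u, hu⟩ := h3.exists_global
  refine ⟨d, _, isSeparatrix_of_halves (x₀ := x₀) hw hu (fun x hx => ?_) (fun x hx => ?_)⟩
  · by_contra! hlt
    exact h2 ⟨x, hx, w, hw x (by linarith), hlt⟩
  · by_contra! hlt
    exact h4 ⟨x, hx, u, hu x (by linarith), hlt⟩

/-! ### Uniqueness and sign of the parameter -/

namespace IsSeparatrix

variable {a b c d d' : ℝ} {W V : ℝ → ℝ}

/-- The symmetry `(x, t) ↦ (-x, -t)` of the family of Liénard systems. -/
theorem reflect (h : IsSeparatrix a b c d W) :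
    IsSeparatrix a (-b) c (-d) (fun x => W (-x)) := by
  refine ⟨fun x => h.pos (-x), fun x => ?_, ?_⟩
  · have := (h.hasDerivAt (-x)).scomp x (hasDerivAt_neg x)
    refine this.congr_deriv ?_
    rw [lienardDamping_neg]
    simp
    ring
  · obtain ⟨B, hB⟩ := h.bdd
    exact ⟨B, fun x => hB (-x)⟩

theorem isHalfSol (h : IsSeparatrix a b c d W) (X : ℝ) :
    IsHalfSol (lienardDamping a b c d) X (W 0) W :=
  ⟨rfl, fun x _ => ⟨h.pos x, (h.hasDerivAt x).hasDerivWithinAt⟩⟩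

theorem continuous (h : IsSeparatrix a b c d W) : Continuous W :=
  continuous_iff_continuousAt.2 fun x => (h.hasDerivAt x).continuousAt

/-- On the right, a larger `d` makes the distance of two solutions grow linearly at least. -/
theorem not_lt_of_le (h : IsSeparatrix a b c d W) (h' : IsSeparatrix a b c d' V)
    (hle : W 0 ≤ V 0) : ¬ d < d' := by
  intro hlt
  obtain ⟨B, hB⟩ := h'.bdd
  have hB0 : 0 < B := (h'.pos 0).trans_le (hB 0)
  have hδ : 0 < d' - d := by linarith
  have := (h.isHalfSol (B / (d' - d))).add_le (h'.isHalfSol (B / (d' - d)))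
    (P := fun x => (d' - d) * x) (p := fun _ => d' - d)
    (fun x => by simpa using (hasDerivAt_id x).const_mul (d' - d)) (by simp)
    (fun x _ => by unfold lienardDamping; linarith) (fun x _ => hδ.le) hle
    (B / (d' - d)) ⟨by positivity, le_rfl⟩
  rw [mul_div_cancel₀ _ hδ.ne'] at this
  linarith [hB (B / (d' - d)), h.pos (B / (d' - d))]

/-- The system is a rotated family in `d`, so that two values of `d` cannot both have a
separatrix. -/
theorem param_unique (h : IsSeparatrix a b c d W) (h' : IsSeparatrix a b c d' V) : d = d' := by
  have key : ∀ {d d' : ℝ} {W V : ℝ → ℝ}, IsSeparatrix a b c d W → IsSeparatrix a b c d' V →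
      ¬ d < d' := by
    intro d d' W V h h' hlt
    rcases le_total (W 0) (V 0) with hle | hle
    · exact h.not_lt_of_le h' hle hlt
    · exact h'.reflect.not_lt_of_le h.reflect (by simpa using hle) (by linarith)
  exact le_antisymm (not_lt.1 (key h' h)) (not_lt.1 (key h h'))

/-- For `d ≥ 0` the right-hand side on the right exceeds the one on the left by `6 * b * x ^ 2` at
least, and the two halves of a separatrix, equal at `0`, could not both be bounded. -/
theorem param_neg (hb : 0 < b) (h : IsSeparatrix a b c d W) : d < 0 := by
  by_contra! hd
  obtain ⟨B, hB⟩ := h.bdd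
  have hB0 : 0 < B := (h.pos 0).trans_le (hB 0)
  set Z := 1 + B / b with hZ
  have hBb : 0 < B / b := by positivity
  have := (h.reflect.isHalfSol Z).add_le (h.isHalfSol Z)
    (P := fun x => 2 * b * x ^ 3) (p := fun x => 6 * b * x ^ 2)
    (fun x => by
      refine ((hasDerivAt_pow 3 x).const_mul (2 * b)).congr_deriv ?_
      norm_num
      ring) (by norm_num) (fun x _ => by unfold lienardDamping; linarith)
    (fun x _ => by positivity) (by simp) Z ⟨by linarith, le_rfl⟩
  have h1 := hB Z
  have h2 := h.pos (-Z)
  have h3 : B ≤ b * Z := by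
    have : b * Z = b + B := by rw [hZ]; field_simp
    linarith
  have h4 : Z ≤ Z ^ 3 := by
    have h1Z : 1 ≤ Z := by linarith
    have : 1 ≤ Z ^ 2 := one_le_pow₀ h1Z
    nlinarith
  have h5 : b * Z ≤ b * Z ^ 3 := mul_le_mul_of_nonneg_left h4 hb.le
  simp only [neg_zero, sub_self, zero_add] at this
  linarith

end IsSeparatrix

/-! ### Asymptotics of the separatrix -/

theorem hasDerivAt_lienardDamping (a b c d x : ℝ) :
    HasDerivAt (lienardDamping a b c d) (12 * a * x ^ 2 + 6 * b * x + 2 * c) x := by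
  have h := (((hasDerivAt_pow 3 x).const_mul (4 * a)).add
    ((hasDerivAt_pow 2 x).const_mul (3 * b))).add ((hasDerivAt_id x).const_mul (2 * c))
  refine (h.add_const d).congr_deriv ?_
  norm_num
  ring

/-- For large `x` the leading term of a quartic dominates the others. -/
theorem exists_dominant {a : ℝ} (ha : 0 < a) (b c d : ℝ) :
    ∃ X ≥ (1 : ℝ), ∀ x ≥ X, 1 ≤ a * x ∧
      10 * (|b| * x ^ 2 + |c| * x + |d|) ≤ a * x ^ 3 := by
  set E := 10 * (|b| + |c| + |d|) + 1 with hE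
  have hE0 : 0 < E := by positivity
  have hEa : 0 < E / a := by positivity
  refine ⟨1 + E / a, by linarith, fun x hx => ?_⟩
  have hx1 : 1 ≤ x := by linarith
  have hax : E ≤ a * x := by
    have h1 : a * (1 + E / a) = a + E := by field_simp
    have := mul_le_mul_of_nonneg_left hx ha.le
    linarith
  refine ⟨?_, ?_⟩
  · have : 0 ≤ |b| + |c| + |d| := by positivity
    linarith
  · have h1 : E * x ^ 2 ≤ a * x ^ 3 := by
      have := mul_le_mul_of_nonneg_right hax (sq_nonneg x)
      linarith
    have h2 : |c| * x ≤ |c| * x ^ 2 := mul_le_mul_of_nonneg_left (by nlinarith) (abs_nonneg c)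
    have h3 : |d| ≤ |d| * x ^ 2 := le_mul_of_one_le_right (abs_nonneg d) (one_le_pow₀ hx1)
    nlinarith [sq_nonneg x]

/-- Bounds for `f = lienardDamping` and for `x * f'` far out. -/
theorem exists_damping_bounds {a : ℝ} (ha : 0 < a) (b c d : ℝ) :
    ∃ X ≥ (1 : ℝ), ∀ x ≥ X, 3 * x ≤ lienardDamping a b c d x ∧
      3 * a * x ^ 3 ≤ lienardDamping a b c d x ∧ lienardDamping a b c d x ≤ 5 * a * x ^ 3 ∧
      lienardDamping a b c d x ≤ x * (12 * a * x ^ 2 + 6 * b * x + 2 * c) ∧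
      x * (12 * a * x ^ 2 + 6 * b * x + 2 * c) ≤ 4 * lienardDamping a b c d x := by
  obtain ⟨X, hX, H⟩ := exists_dominant ha b c d
  refine ⟨X, hX, fun x hx => ?_⟩
  obtain ⟨h1, h2⟩ := H x hx
  have hx1 : 1 ≤ x := hX.le.trans hx
  have hb1 : -(|b| * x ^ 2) ≤ b * x ^ 2 := by nlinarith [neg_abs_le b, sq_nonneg x]
  have hb2 : b * x ^ 2 ≤ |b| * x ^ 2 := by nlinarith [le_abs_self b, sq_nonneg x]
  have hc1 : -(|c| * x) ≤ c * x := by nlinarith [neg_abs_le c]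
  have hc2 : c * x ≤ |c| * x := by nlinarith [le_abs_self c]
  have hd1 := neg_abs_le d
  have hd2 := le_abs_self d
  have hb0 : 0 ≤ |b| * x ^ 2 := by positivity
  have hc0 : 0 ≤ |c| * x := by positivity
  have hd0 : 0 ≤ |d| := abs_nonneg d
  have hA : x ≤ a * x ^ 3 := by
    have : x ^ 2 ≤ a * x ^ 3 := by
      have := mul_le_mul_of_nonneg_right h1 (sq_nonneg x)
      linarith
    nlinarith
  unfold lienardDamping
  refine ⟨?_, ?_, ?_, ?_, ?_⟩ <;> linarith

namespace IsSeparatrix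

variable {a b c d : ℝ} {W : ℝ → ℝ}

/-- Above the curve `W = x / f x` a solution of `W' = f x - x / W` is unbounded. -/
theorem exists_mul_damping_le (ha : 0 < a) (h : IsSeparatrix a b c d W) :
    ∃ X ≥ (1 : ℝ), ∀ x ≥ X, W x * lienardDamping a b c d x ≤ x := by
  obtain ⟨X, hX, H⟩ := exists_damping_bounds ha b c d
  obtain ⟨B, hB⟩ := h.bdd
  refine ⟨X, hX, fun x₁ hx₁ => ?_⟩
  by_contra! hlt
  set f := lienardDamping a b c d with hf
  set g := fun x => W x * f x - x with hg
  have hg1 : 0 < g x₁ := by simp only [hg]; linarith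
  have hB0 : 0 < B := (h.pos 0).trans_le (hB 0)
  have hgd : ∀ x, HasDerivAt g ((f x - x / W x) * f x
      + W x * (12 * a * x ^ 2 + 6 * b * x + 2 * c) - 1) x := fun x =>
    ((h.hasDerivAt x).mul (hasDerivAt_lienardDamping a b c d x)).sub (hasDerivAt_id x)
  set x₂ := x₁ + B * (B / g x₁) with hx₂
  have h12 : x₁ ≤ x₂ := by
    have : 0 < B * (B / g x₁) := by positivity
    linarith
  have hWd : ∀ x, f x - x / W x = g x / W x := fun x => by
    have := (h.pos x).ne'
    simp only [hg]
    field_simp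
  have hmono := le_of_hasDerivWithinAt_nonneg_of_lt (h := g) (p := x₁) (q := x₂) (c := 0)
    (fun x _ => (hgd x).hasDerivWithinAt) hg1 (fun x hx hgx => by
      have hp := h.pos x
      obtain ⟨h1, -, -, h2, -⟩ := H x (hx₁.le.trans hx.1)
      have hx0 : 0 < x := by linarith [hx.1]
      rw [hWd]
      have hf0 : 0 < f x := by linarith
      have h3 : 0 ≤ g x / W x * f x := by positivity
      have h4 : x < W x * f x := by simp only [hg] at hgx; linarith
      have h5 : 1 ≤ W x * (12 * a * x ^ 2 + 6 * b * x + 2 * c) := by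
        have h6 := mul_le_mul_of_nonneg_left h2 hp.le
        have h7 : x * 1 < x * (W x * (12 * a * x ^ 2 + 6 * b * x + 2 * c)) := by linarith
        exact (lt_of_mul_lt_mul_left h7 hx0.le).le
      linarith)
  have hgrow := le_of_hasDerivWithinAt_nonneg (h := fun x => W x - g x₁ / B * x)
    (h' := fun x => (f x - x / W x) - g x₁ / B) (p := x₁) (q := x₂)
    (fun x _ => by
      have h1 := (hasDerivAt_id x).const_mul (g x₁ / B)
      rw [mul_one] at h1
      exact ((h.hasDerivAt x).sub h1).hasDerivWithinAt)
    (fun x hx => by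
      rw [hWd]
      have : g x₁ / B ≤ g x / W x :=
        div_le_div₀ (hg1.le.trans (hmono x hx)) (hmono x hx) (h.pos x) (hB x)
      linarith) x₂ ⟨h12, le_rfl⟩
  have h3 : g x₁ / B * x₂ = g x₁ / B * x₁ + B := by
    rw [hx₂]
    field_simp
  have := hB x₂
  have := h.pos x₁
  linarith

/-- Slightly below the curve `W = x / f x` a solution of `W' = f x - x / W` reaches zero. -/
theorem exists_le_mul_damping (ha : 0 < a) (h : IsSeparatrix a b c d W) :
    ∃ X ≥ (1 : ℝ), ∀ x ≥ X, x - 1 / x ≤ W x * lienardDamping a b c d x := by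
  obtain ⟨X, hX, H⟩ := exists_damping_bounds ha b c d
  obtain ⟨X', hX', H'⟩ := h.exists_mul_damping_le ha
  refine ⟨max X X', hX.le.trans (le_max_left _ _), fun x₁ hx₁ => ?_⟩
  by_contra! hlt
  set f := lienardDamping a b c d with hf
  set g := fun x => x - W x * f x with hg
  have hx1 : 1 ≤ x₁ := hX.le.trans ((le_max_left _ _).trans hx₁)
  have hg1 : 1 / x₁ < g x₁ := by simp only [hg]; linarith
  have hgd : ∀ x, HasDerivAt g (1 - ((f x - x / W x) * f x
      + W x * (12 * a * x ^ 2 + 6 * b * x + 2 * c))) x := fun x =>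
    (hasDerivAt_id x).sub ((h.hasDerivAt x).mul (hasDerivAt_lienardDamping a b c d x))
  have hest : ∀ x ∈ Icc x₁ (2 * x₁), 1 / x₁ < g x → 2 ≤ 1 - ((f x - x / W x) * f x
      + W x * (12 * a * x ^ 2 + 6 * b * x + 2 * c)) := by
    intro x hx hgx
    have hp := h.pos x
    have hx0 : 1 ≤ x := hx1.trans hx.1
    obtain ⟨h1, -, -, -, h2⟩ := H x (((le_max_left _ _).trans hx₁).trans hx.1)
    have h3 := H' x (((le_max_right _ _).trans hx₁).trans hx.1)
    have hf0 : 0 < f x := by linarith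
    have h4 : (f x - x / W x) * f x = - (g x * (f x / W x)) := by
      simp only [hg]
      field_simp
      ring
    have h5 : 9 * x ≤ f x / W x := by
      rw [le_div_iff₀ hp]
      have h6 : 3 * (W x * f x) ≤ 3 * x := by linarith
      nlinarith
    have h6 : 1 / x ≤ g x := by
      have : 1 / x ≤ 1 / x₁ := one_div_le_one_div_of_le (by linarith) hx.1
      linarith
    have h7 : 9 ≤ g x * (f x / W x) := by
      have h8 : 1 / x * (9 * x) ≤ g x * (f x / W x) :=
        mul_le_mul h6 h5 (by positivity) (le_trans (by positivity) h6)
      have h9 : 1 / x * (9 * x) = 9 := by field_simp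
      linarith
    have h8 : W x * (12 * a * x ^ 2 + 6 * b * x + 2 * c) ≤ 4 := by
      have h9 := mul_le_mul_of_nonneg_left h2 hp.le
      have h10 : x * (W x * (12 * a * x ^ 2 + 6 * b * x + 2 * c)) ≤ x * 4 := by linarith
      exact le_of_mul_le_mul_left h10 (by linarith)
    linarith
  have hmono := le_of_hasDerivWithinAt_nonneg_of_lt (h := g) (p := x₁) (q := 2 * x₁) (c := 1 / x₁)
    (fun x _ => (hgd x).hasDerivWithinAt) hg1 (fun x hx hgx => by linarith [hest x hx hgx])
  have hgrow := le_of_hasDerivWithinAt_nonneg (h := fun x => g x - 2 * x)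
    (h' := fun x => 1 - ((f x - x / W x) * f x
      + W x * (12 * a * x ^ 2 + 6 * b * x + 2 * c)) - 2) (p := x₁) (q := 2 * x₁)
    (fun x _ => by
      have h1 := (hasDerivAt_id x).const_mul 2
      rw [mul_one] at h1
      exact ((hgd x).sub h1).hasDerivWithinAt)
    (fun x hx => by linarith [hest x hx (hg1.trans_le (hmono x hx))]) (2 * x₁)
    ⟨by linarith, le_rfl⟩
  obtain ⟨h1, -⟩ := H (2 * x₁) (((le_max_left _ _).trans hx₁).trans (by linarith))
  have h2 : 0 < W (2 * x₁) * f (2 * x₁) := mul_pos (h.pos _) (by linarith)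
  have h3 : 0 < 1 / x₁ := by positivity
  have h4 : g (2 * x₁) = 2 * x₁ - W (2 * x₁) * f (2 * x₁) := rfl
  linarith

end IsSeparatrix

/-- The primitive of `x / W x ^ 2` that vanishes at `0`. It measures the contraction of the flow
towards the separatrix on the right (`0 < x`) and its expansion on the left (`x < 0`). -/
noncomputable def contraction (W : ℝ → ℝ) (x : ℝ) : ℝ := ∫ s in (0 : ℝ)..x, s / W s ^ 2

theorem sub_pow_succ_ge {z β : ℝ} (hβ : 0 ≤ β) (hz : β ≤ z) (n : ℕ) :
    z ^ (n + 1) - (n + 1) * β * z ^ n ≤ (z - β) ^ (n + 1) := by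
  induction n with
  | zero => simp
  | succ n ih =>
    have h1 := mul_le_mul_of_nonneg_right ih (sub_nonneg.2 hz)
    have hz0 : 0 ≤ z := hβ.trans hz
    have h2 : 0 ≤ (n + 1) * β ^ 2 * z ^ n := by positivity
    rw [pow_succ (z - β) (n + 1)]
    refine le_trans ?_ h1
    push_cast
    have : (z ^ (n + 1) - (n + 1) * β * z ^ n) * (z - β)
        = z ^ (n + 1 + 1) - (n + 1 + 1) * β * z ^ (n + 1) + (n + 1) * β ^ 2 * z ^ n := by ring
    rw [this]
    linarith

namespace IsSeparatrix

variable {a b c d : ℝ} {W : ℝ → ℝ}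

theorem hasDerivAt_contraction (h : IsSeparatrix a b c d W) (x : ℝ) :
    HasDerivAt (contraction W) (x / W x ^ 2) x := by
  have hc : Continuous fun s => s / W s ^ 2 :=
    continuous_id.div (h.continuous.pow 2) fun x => pow_ne_zero _ (h.pos x).ne'
  exact intervalIntegral.integral_hasDerivAt_right (hc.intervalIntegrable _ _)
    (hc.stronglyMeasurableAtFilter _ _) hc.continuousAt

theorem contraction_zero : contraction W 0 = 0 := by simp [contraction]

theorem contraction_le_of_nonneg (h : IsSeparatrix a b c d W) {x y : ℝ} (hx : 0 ≤ x)
    (hxy : x ≤ y) : contraction W x ≤ contraction W y :=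
  le_of_hasDerivWithinAt_nonneg (fun _ _ => (h.hasDerivAt_contraction _).hasDerivWithinAt)
    (fun _ hz => div_nonneg (hx.trans hz.1) (sq_nonneg _)) y ⟨hxy, le_rfl⟩

theorem contraction_le_of_nonpos (h : IsSeparatrix a b c d W) {x y : ℝ} (hy : y ≤ 0)
    (hxy : x ≤ y) : contraction W y ≤ contraction W x :=
  le_of_hasDerivWithinAt_nonpos (fun _ _ => (h.hasDerivAt_contraction _).hasDerivWithinAt)
    (fun _ hz => div_nonpos_of_nonpos_of_nonneg (hz.2.trans hy) (sq_nonneg _)) y ⟨hxy, le_rfl⟩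

/-- Since `W ≤ x / f` far out, the integrand `x / W ^ 2` is at least `f ^ 2 / x`. -/
theorem exists_le_contraction (ha : 0 < a) (h : IsSeparatrix a b c d W) :
    ∃ C₀ C X : ℝ, 1 ≤ X ∧ 0 ≤ C ∧ ∀ x ≥ X,
      8 / 3 * a ^ 2 * x ^ 6 + 24 / 5 * (a * b) * x ^ 5 - C * x ^ 4 - C₀ ≤ contraction W x := by
  obtain ⟨X₁, hX₁, H₁⟩ := exists_damping_bounds ha b c d
  obtain ⟨X₂, hX₂, H₂⟩ := h.exists_mul_damping_le ha
  set ρ := 2 * |c| + |d| with hρ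
  set C := ρ * (4 * a + 3 * |b|) with hC
  have hC0 : 0 ≤ C := by positivity
  set X := max X₁ X₂ with hX
  have hX1 : 1 ≤ X := hX₁.le.trans (le_max_left _ _)
  set P : ℝ → ℝ := fun x => 8 / 3 * a ^ 2 * x ^ 6 + 24 / 5 * (a * b) * x ^ 5 - C * x ^ 4 with hP
  have hPd : ∀ x, HasDerivAt P (16 * a ^ 2 * x ^ 5 + 24 * (a * b) * x ^ 4 - 4 * C * x ^ 3) x := by
    intro x
    have := (((hasDerivAt_pow 6 x).const_mul (8 / 3 * a ^ 2)).add
      ((hasDerivAt_pow 5 x).const_mul (24 / 5 * (a * b)))).sub ((hasDerivAt_pow 4 x).const_mul C)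
    refine this.congr_deriv ?_
    norm_num
    ring
  refine ⟨P X - contraction W X, C, X, hX1, hC0, fun x hx => ?_⟩
  have := le_of_hasDerivWithinAt_nonneg (h := fun x => contraction W x - P x)
    (fun z _ => ((h.hasDerivAt_contraction z).sub (hPd z)).hasDerivWithinAt) (p := X) (q := x)
    (fun z hz => by
      have hz1 : 1 ≤ z := hX1.trans hz.1
      obtain ⟨h1, -⟩ := H₁ z ((le_max_left _ _).trans hz.1)
      have h2 := H₂ z ((le_max_right _ _).trans hz.1)
      have hp := h.pos z
      set f := lienardDamping a b c d z with hf
      have hf0 : 0 < f := by linarith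
      have h3 : (W z * f) ^ 2 ≤ z ^ 2 := pow_le_pow_left₀ (by positivity) h2 2
      have h4 : f ^ 2 / z ≤ z / W z ^ 2 := by
        rw [div_le_div_iff₀ (by linarith) (by positivity)]
        nlinarith
      have h5 : 16 * a ^ 2 * z ^ 5 + 24 * (a * b) * z ^ 4 - 4 * C * z ^ 3 ≤ f ^ 2 / z := by
        rw [le_div_iff₀ (by linarith)]
        set G := 4 * a * z ^ 3 + 3 * b * z ^ 2 with hG
        set r := 2 * c * z + d with hr
        have hfG : f = G + r := by rw [hf, hG, hr, lienardDamping]; ring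
        have hr1 : |r| ≤ ρ * z := by
          have h6 : |r| ≤ |2 * c * z| + |d| := abs_add_le _ _
          have h7 : |2 * c * z| = 2 * |c| * z := by
            rw [abs_mul, abs_mul, abs_of_pos (by linarith : (0 : ℝ) < z)]
            norm_num
          have h8 : |d| ≤ |d| * z := le_mul_of_one_le_right (abs_nonneg d) hz1
          rw [hρ]
          linarith
        have hG1 : |G| ≤ (4 * a + 3 * |b|) * z ^ 3 := by
          have h6 : |G| ≤ |4 * a * z ^ 3| + |3 * b * z ^ 2| := abs_add_le _ _
          have h7 : |4 * a * z ^ 3| = 4 * a * z ^ 3 := abs_of_pos (by positivity)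
          have h8 : |3 * b * z ^ 2| = 3 * |b| * z ^ 2 := by
            rw [abs_mul, abs_mul, abs_of_nonneg (sq_nonneg z)]
            norm_num
          have h9 : |b| * z ^ 2 ≤ |b| * z ^ 3 :=
            mul_le_mul_of_nonneg_left (pow_le_pow_right₀ hz1 (by norm_num)) (abs_nonneg b)
          linarith
        have h6 : |G * r| ≤ C * z ^ 4 := by
          rw [abs_mul]
          calc |G| * |r| ≤ ((4 * a + 3 * |b|) * z ^ 3) * (ρ * z) :=
              mul_le_mul hG1 hr1 (abs_nonneg _) (by positivity)
            _ = C * z ^ 4 := by rw [hC]; ring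
        have h7 := (abs_le.1 h6).1
        have h8 : G ^ 2 = (16 * a ^ 2 * z ^ 5 + 24 * (a * b) * z ^ 4) * z + 9 * b ^ 2 * z ^ 4 := by
          rw [hG]; ring
        rw [hfG]
        have h9 : 0 ≤ C * z ^ 4 := by positivity
        nlinarith [sq_nonneg r, sq_nonneg (b * z ^ 2)]
      linarith) x ⟨hx, le_rfl⟩
  simp only [hP] at this ⊢
  linarith

/-- Since `W` is only slightly smaller than `x / f` far out, the integrand `x / W ^ 2` is only
slightly larger than `f ^ 2 / x`. -/
theorem exists_contraction_le (ha : 0 < a) (h : IsSeparatrix a b c d W) :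
    ∃ C₀ C X : ℝ, 1 ≤ X ∧ 0 ≤ C ∧ ∀ x ≥ X,
      contraction W x ≤ 8 / 3 * a ^ 2 * x ^ 6 + 24 / 5 * (a * b) * x ^ 5 + C * x ^ 4 + C₀ := by
  obtain ⟨X₁, hX₁, H₁⟩ := exists_damping_bounds ha b c d
  obtain ⟨X₂, hX₂, H₂⟩ := h.exists_le_mul_damping ha
  set ρ := 2 * |c| + |d| with hρ
  set C := ρ * (4 * a + 3 * |b|) + 9 * b ^ 2 + ρ ^ 2 + 100 * a ^ 2 with hC
  have hC0 : 0 ≤ C := by positivity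
  set X := max (max X₁ X₂) 2 with hX
  have hX1 : 2 ≤ X := le_max_right _ _
  set P : ℝ → ℝ := fun x => 8 / 3 * a ^ 2 * x ^ 6 + 24 / 5 * (a * b) * x ^ 5 + C * x ^ 4 with hP
  have hPd : ∀ x, HasDerivAt P (16 * a ^ 2 * x ^ 5 + 24 * (a * b) * x ^ 4 + 4 * C * x ^ 3) x := by
    intro x
    have := (((hasDerivAt_pow 6 x).const_mul (8 / 3 * a ^ 2)).add
      ((hasDerivAt_pow 5 x).const_mul (24 / 5 * (a * b)))).add ((hasDerivAt_pow 4 x).const_mul C)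
    refine this.congr_deriv ?_
    norm_num
    ring
  refine ⟨contraction W X - P X, C, X, by linarith, hC0, fun x hx => ?_⟩
  have := le_of_hasDerivWithinAt_nonpos (h := fun x => contraction W x - P x)
    (fun z _ => ((h.hasDerivAt_contraction z).sub (hPd z)).hasDerivWithinAt) (p := X) (q := x)
    (fun z hz => by
      have hz2 : 2 ≤ z := hX1.trans hz.1
      have hz1 : 1 ≤ z := by linarith
      have hzX : max X₁ X₂ ≤ z := (le_max_left _ _).trans hz.1
      obtain ⟨h1, -, h1', -⟩ := H₁ z ((le_max_left _ _).trans hzX)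
      have h2 := H₂ z ((le_max_right _ _).trans hzX)
      have hp := h.pos z
      set f := lienardDamping a b c d z with hf
      have hf0 : 0 < f := by linarith
      set s := 1 / z ^ 2 with hs
      have hs0 : 0 < s := by positivity
      have hs1 : s ≤ 1 / 4 := by
        rw [hs]
        apply one_div_le_one_div_of_le (by norm_num)
        nlinarith
      have h2' : z * (1 - s) ≤ W z * f := by
        have : z * (1 - s) = z - 1 / z := by rw [hs]; field_simp
        rw [this]
        exact h2
      have h3 : (z * (1 - s)) ^ 2 ≤ (W z * f) ^ 2 :=
        pow_le_pow_left₀ (mul_nonneg (by linarith) (by linarith)) h2' 2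
      have hkey : 1 ≤ (1 - s) ^ 2 * (1 + 4 * s) := by
        nlinarith [mul_nonneg hs0.le (by linarith : 0 ≤ 2 - 7 * s), pow_pos hs0 3]
      have h4 : z / W z ^ 2 ≤ f ^ 2 * (1 + 4 * s) / z := by
        rw [div_le_div_iff₀ (by positivity) (by linarith)]
        have h5 : z ^ 2 * 1 ≤ z ^ 2 * ((1 - s) ^ 2 * (1 + 4 * s)) :=
          mul_le_mul_of_nonneg_left hkey (sq_nonneg z)
        have h6 := mul_le_mul_of_nonneg_right h3 (by linarith : 0 ≤ 1 + 4 * s)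
        nlinarith
      have h4s : f ^ 2 * (1 + 4 * s) = f ^ 2 + 4 * (f ^ 2 * s) := by ring
      have h5s : f ^ 2 * s ≤ 25 * a ^ 2 * z ^ 4 := by
        have h6 : f ^ 2 ≤ (5 * a * z ^ 3) ^ 2 := pow_le_pow_left₀ hf0.le h1' 2
        rw [hs, mul_one_div, div_le_iff₀ (by positivity)]
        calc f ^ 2 ≤ (5 * a * z ^ 3) ^ 2 := h6
          _ = _ := by ring
      have h5 : f ^ 2 * (1 + 4 * s) / z
          ≤ 16 * a ^ 2 * z ^ 5 + 24 * (a * b) * z ^ 4 + 4 * C * z ^ 3 := by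
        rw [div_le_iff₀ (by linarith), h4s]
        set G := 4 * a * z ^ 3 + 3 * b * z ^ 2 with hG
        set r := 2 * c * z + d with hr
        have hfG : f = G + r := by rw [hf, hG, hr, lienardDamping]; ring
        have hr1 : |r| ≤ ρ * z := by
          have h6 : |r| ≤ |2 * c * z| + |d| := abs_add_le _ _
          have h7 : |2 * c * z| = 2 * |c| * z := by
            rw [abs_mul, abs_mul, abs_of_pos (by linarith : (0 : ℝ) < z)]
            norm_num
          have h8 : |d| ≤ |d| * z := le_mul_of_one_le_right (abs_nonneg d) hz1
          rw [hρ]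
          linarith
        have hG1 : |G| ≤ (4 * a + 3 * |b|) * z ^ 3 := by
          have h6 : |G| ≤ |4 * a * z ^ 3| + |3 * b * z ^ 2| := abs_add_le _ _
          have h7 : |4 * a * z ^ 3| = 4 * a * z ^ 3 := abs_of_pos (by positivity)
          have h8 : |3 * b * z ^ 2| = 3 * |b| * z ^ 2 := by
            rw [abs_mul, abs_mul, abs_of_nonneg (sq_nonneg z)]
            norm_num
          have h9 : |b| * z ^ 2 ≤ |b| * z ^ 3 :=
            mul_le_mul_of_nonneg_left (pow_le_pow_right₀ hz1 (by norm_num)) (abs_nonneg b)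
          linarith
        have h6 : |G * r| ≤ ρ * (4 * a + 3 * |b|) * z ^ 4 := by
          rw [abs_mul]
          calc |G| * |r| ≤ ((4 * a + 3 * |b|) * z ^ 3) * (ρ * z) :=
              mul_le_mul hG1 hr1 (abs_nonneg _) (by positivity)
            _ = _ := by ring
        have h7 := (abs_le.1 h6).2
        have h8 : G ^ 2 = (16 * a ^ 2 * z ^ 5 + 24 * (a * b) * z ^ 4) * z + 9 * b ^ 2 * z ^ 4 := by
          rw [hG]; ring
        have h9 : r ^ 2 ≤ ρ ^ 2 * z ^ 4 := by
          have h10 : r ^ 2 ≤ (ρ * z) ^ 2 := by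
            rw [← sq_abs r]
            exact pow_le_pow_left₀ (abs_nonneg _) hr1 2
          have h11 : z ^ 2 ≤ z ^ 4 := pow_le_pow_right₀ hz1 (by norm_num)
          have := mul_le_mul_of_nonneg_left h11 (sq_nonneg ρ)
          linarith [mul_pow ρ z 2]
        have h10 : C * z ^ 4 = ρ * (4 * a + 3 * |b|) * z ^ 4 + 9 * b ^ 2 * z ^ 4
            + ρ ^ 2 * z ^ 4 + 100 * a ^ 2 * z ^ 4 := by rw [hC]; ring
        have h11 : (G + r) ^ 2 = G ^ 2 + 2 * (G * r) + r ^ 2 := by ring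
        have h12 : (0 : ℝ) ≤ 9 * b ^ 2 * z ^ 4 := by positivity
        have h13 : (0 : ℝ) ≤ ρ ^ 2 * z ^ 4 := by positivity
        have h14 : (0 : ℝ) ≤ 100 * a ^ 2 * z ^ 4 := by positivity
        have h15 : (0 : ℝ) ≤ ρ * (4 * a + 3 * |b|) * z ^ 4 := by positivity
        rw [← hfG] at h11
        have h16 : (16 * a ^ 2 * z ^ 5 + 24 * (a * b) * z ^ 4 + 4 * C * z ^ 3) * z
            = (16 * a ^ 2 * z ^ 5 + 24 * (a * b) * z ^ 4) * z + 4 * (C * z ^ 4) := by ring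
        linarith
      linarith) x ⟨hx, le_rfl⟩
  simp only [hP] at this ⊢
  linarith

/-- Far out on the right, `W` and `log W - contraction W` decrease, as `W * f ≤ x`. -/
theorem exists_antitone (ha : 0 < a) (h : IsSeparatrix a b c d W) :
    ∃ X ≥ (1 : ℝ), ∀ x ≥ X, W x ≤ 1 ∧ W x * (3 * a * x ^ 2) ≤ 1 ∧
      ∀ y ≥ x, W y ≤ W x ∧
        Real.log (W y) - contraction W y ≤ Real.log (W x) - contraction W x := by
  obtain ⟨X₁, hX₁, H₁⟩ := exists_damping_bounds ha b c d
  obtain ⟨X₂, hX₂, H₂⟩ := h.exists_mul_damping_le ha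
  refine ⟨max X₁ X₂, hX₁.le.trans (le_max_left _ _), fun x hx => ?_⟩
  have hx1 : 1 ≤ x := hX₁.le.trans ((le_max_left _ _).trans hx)
  have hp := h.pos x
  obtain ⟨h1, h1', -⟩ := H₁ x ((le_max_left _ _).trans hx)
  have h2 := H₂ x ((le_max_right _ _).trans hx)
  have hdW : ∀ z ≥ x, lienardDamping a b c d z - z / W z ≤ 0 := fun z hz => by
    have h3 := H₂ z ((le_max_right _ _).trans (hx.le.trans hz))
    have : lienardDamping a b c d z ≤ z / W z := by
      rw [le_div_iff₀ (h.pos z)]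
      linarith
    linarith
  refine ⟨?_, ?_, fun y hy => ⟨?_, ?_⟩⟩
  · have h3 := mul_le_mul_of_nonneg_left h1 hp.le
    have h4 : x * W x ≤ x * 1 := by nlinarith
    exact le_of_mul_le_mul_left h4 (by linarith)
  · have h3 := mul_le_mul_of_nonneg_left h1' hp.le
    have h4 : x * (W x * (3 * a * x ^ 2)) ≤ x * 1 := by
      calc _ = W x * (3 * a * x ^ 3) := by ring
        _ ≤ _ := by linarith
    exact le_of_mul_le_mul_left h4 (by linarith)
  · exact le_of_hasDerivWithinAt_nonpos (fun z _ => (h.hasDerivAt z).hasDerivWithinAt)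
      (fun z hz => hdW z hz.1) y ⟨hy, le_rfl⟩
  · refine le_of_hasDerivWithinAt_nonpos (h := fun y => Real.log (W y) - contraction W y)
      (fun z _ => (((h.hasDerivAt z).log (h.pos z).ne').sub
        (h.hasDerivAt_contraction z)).hasDerivWithinAt)
      (fun z hz => ?_) y ⟨hy, le_rfl⟩
    have h3 : (lienardDamping a b c d z - z / W z) / W z ≤ 0 :=
      div_nonpos_of_nonpos_of_nonneg (hdW z hz.1) (h.pos z).le
    have h4 : 0 ≤ z / W z ^ 2 := div_nonneg (by linarith [hz.1]) (sq_nonneg _)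
    linarith

theorem contraction_reflect (x : ℝ) :
    contraction (fun x => W (-x)) x = contraction W (-x) := by
  unfold contraction
  have h := intervalIntegral.integral_comp_neg (a := 0) (b := x) (fun s => s / W s ^ 2)
  rw [neg_zero] at h
  rw [intervalIntegral.integral_symm (-x) 0, ← h, ← intervalIntegral.integral_neg]
  congr 1
  ext s
  ring

theorem exists_le_log (ha : 0 < a) (h : IsSeparatrix a b c d W) :
    ∃ X ≥ (1 : ℝ), ∀ x ≥ X, - (5 * a * x ^ 3) ≤ Real.log (W x) := by
  obtain ⟨X₁, hX₁, H₁⟩ := exists_damping_bounds ha b c d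
  obtain ⟨X₂, hX₂, H₂⟩ := h.exists_le_mul_damping ha
  refine ⟨max (max X₁ X₂) 2, le_trans (by norm_num) (le_max_right _ _), fun x hx => ?_⟩
  have hx2 : 2 ≤ x := (le_max_right _ _).trans hx
  have hxX : max X₁ X₂ ≤ x := (le_max_left _ _).trans hx
  obtain ⟨h1, -, h1', -⟩ := H₁ x ((le_max_left _ _).trans hxX)
  have h2 := H₂ x ((le_max_right _ _).trans hxX)
  have hp := h.pos x
  have h3 : 1 / x ≤ 1 / 2 := one_div_le_one_div_of_le (by norm_num) hx2
  have h4 : 1 ≤ W x * (5 * a * x ^ 3) := by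
    have := mul_le_mul_of_nonneg_left h1' hp.le
    linarith
  have h5 : (W x)⁻¹ ≤ 5 * a * x ^ 3 := by
    rw [inv_le_iff_one_le_mul₀ hp]
    linarith
  have h6 := Real.log_le_sub_one_of_pos (inv_pos.2 hp)
  rw [Real.log_inv] at h6
  linarith

/-- An orbit that turns on the left at `x = -z`, hence at the height `F (-z)`, gets on the right
at least to `x = z - 11 b / (20 a)`: at speed at least `1` its height drops on the way by at most
`x * (x + 1)`. Any shift larger than the asymptotic one, `b / (2 a)`, would do. -/
theorem exists_lienardCurve_comparison {a b : ℝ} (ha : 0 < a) (hb : 0 < b) (c d : ℝ) :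
    ∃ Z ≥ (1 : ℝ), 11 * b / (20 * a) ≤ Z ∧ ∀ z ≥ Z, ∀ x ∈ Icc 0 (z - 11 * b / (20 * a)),
      lienardCurve a b c d x + (z - 11 * b / (20 * a)) * (z - 11 * b / (20 * a) + 1) + 1
        ≤ lienardCurve a b c d (-z) := by
  set β := 11 * b / (20 * a) with hβ
  have hβ0 : 0 < β := by positivity
  have haβ : a * β = 11 / 20 * b := by rw [hβ]; field_simp
  set D := 6 * a * β ^ 2 + 2 * |c| + 2 * |d| + 3 with hD
  have hD0 : 0 < D := by positivity
  have e2 : 0 < 5 * D / b := by positivity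
  refine ⟨1 + β + 5 * D / b, by linarith, by linarith, fun z hz x hx => ?_⟩
  have hz1 : 1 ≤ z := by linarith
  have hz0 : 0 < z := by linarith
  have hzD : 5 * D / b ≤ z := by linarith
  have hz12 : z ≤ z ^ 2 := by nlinarith
  set w := z - β with hw
  have hw0 : 0 ≤ w := by linarith
  have hwz : w ≤ z := by linarith
  have h1 : lienardCurve a b c d x ≤ a * w ^ 4 + b * w ^ 3 + |c| * w ^ 2 + |d| * w := by
    unfold lienardCurve
    have hx0 := hx.1
    have hxw := hx.2
    refine add_le_add (add_le_add (add_le_add ?_ ?_) ?_) ?_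
    · gcongr
    · gcongr
    · calc c * x ^ 2 ≤ |c| * x ^ 2 := mul_le_mul_of_nonneg_right (le_abs_self c) (by positivity)
        _ ≤ _ := by gcongr
    · calc d * x ≤ |d| * x := mul_le_mul_of_nonneg_right (le_abs_self d) hx0
        _ ≤ _ := by gcongr
  have h2 : a * z ^ 4 - b * z ^ 3 - |c| * z ^ 2 - |d| * z ≤ lienardCurve a b c d (-z) := by
    have e1 : -(|c| * z ^ 2) ≤ c * z ^ 2 := by
      rw [← neg_mul]
      exact mul_le_mul_of_nonneg_right (neg_abs_le c) (sq_nonneg z)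
    have e2 : d * z ≤ |d| * z := mul_le_mul_of_nonneg_right (le_abs_self d) hz0.le
    have : lienardCurve a b c d (-z) = a * z ^ 4 - b * z ^ 3 + c * z ^ 2 - d * z := by
      unfold lienardCurve; ring
    rw [this]
    linarith only [e1, e2]
  have h3 : w ^ 4 ≤ z ^ 4 - 4 * β * z ^ 3 + 6 * β ^ 2 * z ^ 2 := by
    have : w ^ 4 = z ^ 4 - 4 * β * z ^ 3 + 6 * β ^ 2 * z ^ 2 - β ^ 3 * (4 * z - β) := by
      rw [hw]; ring
    rw [this]
    have : 0 ≤ β ^ 3 * (4 * z - β) := mul_nonneg (by positivity) (by linarith)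
    linarith only [this]
  have h4 : w ^ 3 ≤ z ^ 3 := by gcongr
  have h5 : |c| * w ^ 2 ≤ |c| * z ^ 2 := by gcongr
  have h6 : |d| * w ≤ |d| * z ^ 2 :=
    mul_le_mul_of_nonneg_left (hwz.trans hz12) (abs_nonneg d)
  have h6' : |d| * z ≤ |d| * z ^ 2 := mul_le_mul_of_nonneg_left hz12 (abs_nonneg d)
  have h7 : w * (w + 1) + 1 ≤ 3 * z ^ 2 := by
    have : w * (w + 1) ≤ z * (z + 1) := by gcongr
    have : 1 ≤ z ^ 2 := one_le_pow₀ hz1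
    linarith
  have h8 : a * w ^ 4 ≤ a * z ^ 4 - 11 / 5 * b * z ^ 3 + 6 * a * β ^ 2 * z ^ 2 := by
    have e := mul_le_mul_of_nonneg_left h3 ha.le
    have : a * (z ^ 4 - 4 * β * z ^ 3 + 6 * β ^ 2 * z ^ 2)
        = a * z ^ 4 - 4 * (a * β) * z ^ 3 + 6 * a * β ^ 2 * z ^ 2 := by ring
    rw [this, haβ] at e
    linarith only [e]
  have h9 : b * w ^ 3 ≤ b * z ^ 3 := by gcongr
  have h10 : 5 * D ≤ b * z := by
    rw [div_le_iff₀ hb] at hzD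
    linarith only [hzD]
  have h11 : 5 * D * z ^ 2 ≤ b * z ^ 3 := by
    have := mul_le_mul_of_nonneg_right h10 (sq_nonneg z)
    linarith only [this]
  have h12 : D * z ^ 2 = 6 * a * β ^ 2 * z ^ 2 + 2 * |c| * z ^ 2 + 2 * |d| * z ^ 2
    + 3 * z ^ 2 := by rw [hD]; ring
  linarith only [h1, h2, h5, h6, h6', h7, h8, h9, h11, h12]

/-- The contraction from `x = z - 11 b / (20 a)` inwards on the right exceeds the expansion up to
`x = -z` on the left, since `∫ f ^ 2 / x` is larger by about `(4 / 5) a b z ^ 5`. Any shift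
smaller than `3 b / (5 a)` would do. -/
theorem exists_contraction_comparison (ha : 0 < a) (hb : 0 < b) (h : IsSeparatrix a b c d W) :
    ∃ Z : ℝ, ∀ z ≥ Z, ∀ x ≥ z - 11 * b / (20 * a), Real.log (W x) - contraction W x
        ≤ Real.log (W (-z)) - contraction W (-z) - 2 := by
  set β := 11 * b / (20 * a) with hβ
  have hβ0 : 0 < β := by positivity
  have haβ : a * β = 11 / 20 * b := by rw [hβ]; field_simp
  obtain ⟨C₀, C, X₁, hX₁, hC, H₁⟩ := h.exists_le_contraction ha
  obtain ⟨C₀', C', X₂, hX₂, hC', H₂⟩ := h.reflect.exists_contraction_le ha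
  obtain ⟨X₃, hX₃, H₃⟩ := h.exists_antitone ha
  obtain ⟨X₅, hX₅, H₅⟩ := h.reflect.exists_le_log ha
  set D := 24 * (a * b) * β + C + C' + 5 * a + |C₀| + |C₀'| + 2 with hD
  have hab : 0 < a * b := mul_pos ha hb
  have hD0 : 0 < D := by positivity
  have e1 : 0 < 5 * D / (4 * (a * b)) := by positivity
  refine ⟨X₁ + X₂ + X₃ + X₅ + β + 5 * D / (4 * (a * b)), fun z hz x hx => ?_⟩
  have hz1 : 1 ≤ z := by linarith
  have hzβ : β ≤ z := by linarith
  have hzD : 5 * D / (4 * (a * b)) ≤ z := by linarith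
  have hz3 : z ^ 3 ≤ z ^ 4 := pow_le_pow_right₀ hz1 (by norm_num)
  have hz4 : 1 ≤ z ^ 4 := one_le_pow₀ hz1
  set w := z - β with hw
  have hw0 : 0 ≤ w := by linarith
  have hwz : w ≤ z := by linarith
  obtain ⟨h1, -, h2⟩ := H₃ w (by linarith)
  obtain ⟨-, h2⟩ := h2 x hx
  have h3 : Real.log (W w) ≤ 0 := Real.log_nonpos (h.pos w).le h1
  have h4 := H₁ w (by linarith)
  have h5 := H₂ z (by linarith)
  rw [contraction_reflect] at h5
  have h6 := H₅ z (by linarith)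
  have h7 : z ^ 6 - 6 * β * z ^ 5 ≤ w ^ 6 := by
    have := sub_pow_succ_ge hβ0.le hzβ 5
    norm_num at this
    linarith only [this]
  have h8 : z ^ 5 - 5 * β * z ^ 4 ≤ w ^ 5 := by
    have := sub_pow_succ_ge hβ0.le hzβ 4
    norm_num at this
    linarith only [this]
  have h9 : w ^ 4 ≤ z ^ 4 := by gcongr
  have g1 : 8 / 3 * a ^ 2 * z ^ 6 - 44 / 5 * (a * b) * z ^ 5 ≤ 8 / 3 * a ^ 2 * w ^ 6 := by
    have e := mul_le_mul_of_nonneg_left h7 (by positivity : 0 ≤ 8 / 3 * a ^ 2)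
    have : 8 / 3 * a ^ 2 * (z ^ 6 - 6 * β * z ^ 5)
        = 8 / 3 * a ^ 2 * z ^ 6 - 16 * a * (a * β) * z ^ 5 := by ring
    rw [this, haβ] at e
    linarith only [e]
  have g2 : 24 / 5 * (a * b) * z ^ 5 - 24 * (a * b) * β * z ^ 4 ≤ 24 / 5 * (a * b) * w ^ 5 := by
    have e := mul_le_mul_of_nonneg_left h8 (by positivity : 0 ≤ 24 / 5 * (a * b))
    linarith only [e]
  have g3 : C * w ^ 4 ≤ C * z ^ 4 := mul_le_mul_of_nonneg_left h9 hC
  have g4 : 5 * D ≤ 4 * (a * b) * z := by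
    rw [div_le_iff₀ (by positivity)] at hzD
    linarith only [hzD]
  have g5 : D * z ^ 4 ≤ 4 / 5 * (a * b) * z ^ 5 := by
    have := mul_le_mul_of_nonneg_right g4 (by positivity : 0 ≤ z ^ 4)
    linarith only [this]
  have g6 : D * z ^ 4 = 24 * (a * b) * β * z ^ 4 + C * z ^ 4 + C' * z ^ 4 + 5 * a * z ^ 4
      + |C₀| * z ^ 4 + |C₀'| * z ^ 4 + 2 * z ^ 4 := by rw [hD]; ring
  have g7 : C₀ ≤ |C₀| * z ^ 4 :=
    (le_abs_self _).trans (le_mul_of_one_le_right (abs_nonneg _) hz4)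
  have g8 : C₀' ≤ |C₀'| * z ^ 4 :=
    (le_abs_self _).trans (le_mul_of_one_le_right (abs_nonneg _) hz4)
  have g9 : 5 * a * z ^ 3 ≤ 5 * a * z ^ 4 := mul_le_mul_of_nonneg_left hz3 (by linarith)
  have g10 : a * -b = - (a * b) := by ring
  rw [g10] at h5
  linarith only [h2, h3, h4, h5, h6, g1, g2, g3, g5, g6, g7, g8, g9, hz4]

theorem exists_le_on_left (ha : 0 < a) (h : IsSeparatrix a b c d W) :
    ∃ Z : ℝ, ∀ z ≥ Z, ∀ x ∈ Icc (-z) 0, W (-z) ≤ W x := by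
  obtain ⟨X₄, hX₄, H₄⟩ := h.reflect.exists_antitone ha
  obtain ⟨m, hm, hmW⟩ : ∃ m > 0, ∀ x ∈ Icc (-X₄) 0, m ≤ W x := by
    obtain ⟨x, hx, hmin⟩ := isCompact_Icc.exists_isMinOn
      (nonempty_Icc.2 (by linarith : -X₄ ≤ 0)) h.continuous.continuousOn
    exact ⟨W x, h.pos x, fun y hy => hmin hy⟩
  have e3 : 0 < 1 / (3 * a * m) := by positivity
  refine ⟨X₄ + 1 / (3 * a * m), fun z hz x hx => ?_⟩
  rcases le_total x (-X₄) with hx4 | hx4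
  · have := ((H₄ (-x) (by linarith)).2.2 z (by linarith [hx.1])).1
    simpa using this
  · refine le_trans ?_ (hmW x ⟨hx4, hx.2⟩)
    have h1 := (H₄ z (by linarith)).2.1
    have hp := h.pos (-z)
    have h2 : 1 / (3 * a * m) ≤ z ^ 2 := by nlinarith
    rw [div_le_iff₀ (by positivity)] at h2
    by_contra! hlt
    have hz0 : 0 < z := by linarith
    have h3 : m * (3 * a * z ^ 2) < W (-z) * (3 * a * z ^ 2) :=
      mul_lt_mul_of_pos_right hlt (by positivity)
    have h4 : z ^ 2 * (3 * a * m) = m * (3 * a * z ^ 2) := by ring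
    linarith

end IsSeparatrix

/-! ### Orbits inside the loop -/

/-- The Liénard system in the coordinates `(x, v)`, where `v = y - (F x - W x)` is the height above
the separatrix, on the time interval `[0, ∞)` and on the side `0 < v` of the origin. -/
structure IsInnerSol (W x v : ℝ → ℝ) : Prop where
  dx : ∀ t, 0 ≤ t → HasDerivWithinAt x (v t - W (x t)) (Ici 0) t
  dv : ∀ t, 0 ≤ t → HasDerivWithinAt v (-(x t * v t / W (x t))) (Ici 0) t
  pos : ∀ t, 0 ≤ t → 0 < v t

namespace IsInnerSol

variable {a b c d : ℝ} {W x v : ℝ → ℝ} {p q τ : ℝ}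

theorem Icc_subset (hp : 0 ≤ p) : Icc p q ⊆ Ici 0 := fun _ ht => hp.trans ht.1

theorem dx' (s : IsInnerSol W x v) (hp : 0 ≤ p) {t : ℝ} (ht : t ∈ Icc p q) :
    HasDerivWithinAt x (v t - W (x t)) (Icc p q) t :=
  (s.dx t (hp.trans ht.1)).mono (Icc_subset hp)

theorem dv' (s : IsInnerSol W x v) (hp : 0 ≤ p) {t : ℝ} (ht : t ∈ Icc p q) :
    HasDerivWithinAt v (-(x t * v t / W (x t))) (Icc p q) t :=
  (s.dv t (hp.trans ht.1)).mono (Icc_subset hp)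

/-- The velocity `v - W x` of `x`, and its derivative. -/
theorem dspeed (h : IsSeparatrix a b c d W) (s : IsInnerSol W x v) (hp : 0 ≤ p) {t : ℝ}
    (ht : t ∈ Icc p q) :
    HasDerivWithinAt (fun t => v t - W (x t)) (-(x t * v t / W (x t)) -
      (lienardDamping a b c d (x t) - x t / W (x t)) * (v t - W (x t))) (Icc p q) t :=
  (s.dv' hp ht).sub ((h.hasDerivAt (x t)).comp_hasDerivWithinAt t (s.dx' hp ht))

theorem dy (h : IsSeparatrix a b c d W) (s : IsInnerSol W x v) (hp : 0 ≤ p) {t : ℝ}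
    (ht : t ∈ Icc p q) :
    HasDerivWithinAt (fun t => lienardCurve a b c d (x t) + (v t - W (x t))) (- x t)
      (Icc p q) t := by
  have h1 := ((hasDerivAt_lienardCurve a b c d (x t)).comp_hasDerivWithinAt t (s.dx' hp ht)).add
    (s.dspeed h hp ht)
  refine h1.congr_deriv ?_
  have := (h.pos (x t)).ne'
  field_simp
  ring

/-- `log v - contraction W x` is monotone on either side of the line `x = 0`. -/
theorem dM (h : IsSeparatrix a b c d W) (s : IsInnerSol W x v) (hp : 0 ≤ p) {t : ℝ}
    (ht : t ∈ Icc p q) :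
    HasDerivWithinAt (fun t => Real.log (v t) - contraction W (x t))
      (-(x t * v t / W (x t) ^ 2)) (Icc p q) t := by
  have hv := s.pos t (hp.trans ht.1)
  have h1 := ((s.dv' hp ht).log hv.ne').sub
    ((h.hasDerivAt_contraction (x t)).comp_hasDerivWithinAt t (s.dx' hp ht))
  refine h1.congr_deriv ?_
  have := (h.pos (x t)).ne'
  have := hv.ne'
  field_simp
  ring

theorem continuousOn_x (s : IsInnerSol W x v) (hp : 0 ≤ p) : ContinuousOn x (Icc p q) :=
  fun _ ht => (s.dx' hp ht).continuousWithinAt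

theorem continuousOn_speed (h : IsSeparatrix a b c d W) (s : IsInnerSol W x v) (hp : 0 ≤ p) :
    ContinuousOn (fun t => v t - W (x t)) (Icc p q) :=
  fun _ ht => (s.dspeed h hp ht).continuousWithinAt

/-- An orbit below the isocline on the left turns at a point of the isocline. -/
theorem exists_left_turn (h : IsSeparatrix a b c d W) (s : IsInnerSol W x v) (hτ : 0 ≤ τ)
    (hx : x τ ≤ 0) (hv : v τ < W (x τ)) :
    ∃ t₁ > τ, v t₁ = W (x t₁) ∧ x t₁ < 0 ∧
      ∀ t ∈ Icc τ t₁, v t ≤ W (x t) ∧ x t₁ ≤ x t ∧ x t ≤ x τ := by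
  obtain ⟨B, hB⟩ := h.bdd
  have hB0 : 0 < B := (h.pos 0).trans_le (hB 0)
  obtain ⟨q, hq, hvq⟩ : ∃ q ≥ τ, W (x q) ≤ v q := by
    by_contra! hcon
    have hneg := neg_of_hasDerivWithinAt_neg (p := τ) (q := τ + 1)
      (fun t ht => s.dx' hτ ht) hx (fun t ht _ => by linarith [hcon t ht.1])
      (τ + 1) ⟨by linarith, le_rfl⟩
    set u := - x (τ + 1) with hu
    have hu0 : 0 < u := by linarith
    have hτ1 : 0 ≤ τ + 1 := by linarith
    set κ := u * v (τ + 1) / B with hκ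
    have hv1 := s.pos _ hτ1
    have hκ0 : 0 < κ := by positivity
    set T := τ + 1 + B / κ with hT
    have hT1 : τ + 1 ≤ T := by
      have : 0 < B / κ := by positivity
      linarith
    have hxle := le_of_hasDerivWithinAt_nonpos (p := τ + 1) (q := T)
      (fun t ht => s.dx' hτ1 ht) (fun t ht => by linarith [hcon t (by linarith [ht.1])])
    have hvge := le_of_hasDerivWithinAt_nonneg (p := τ + 1) (q := T)
      (fun t ht => s.dv' hτ1 ht) (fun t ht => by
        have h1 := hxle t ht
        have h2 : x t * v t / W (x t) ≤ 0 := div_nonpos_of_nonpos_of_nonneg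
          (mul_nonpos_of_nonpos_of_nonneg (by linarith) (s.pos t (hτ1.trans ht.1)).le)
          (h.pos _).le
        linarith)
    have hgrow := le_of_hasDerivWithinAt_nonneg (p := τ + 1) (q := T)
      (h := fun t => v t - κ * t) (h' := fun t => -(x t * v t / W (x t)) - κ)
      (fun t ht => by
        have h1 := ((hasDerivAt_id t).const_mul κ).hasDerivWithinAt (s := Icc (τ + 1) T)
        rw [mul_one] at h1
        exact (s.dv' hτ1 ht).sub h1)
      (fun t ht => by
        have h1 : u ≤ - x t := by linarith [hxle t ht]
        have h2 := hvge t ht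
        have h3 : κ ≤ (- x t) * v t / W (x t) :=
          div_le_div₀ (mul_nonneg (hu0.le.trans h1) (hv1.le.trans h2))
            (mul_le_mul h1 h2 hv1.le (hu0.le.trans h1)) (h.pos _) (hB _)
        have h4 : (- x t) * v t / W (x t) = -(x t * v t / W (x t)) := by ring
        linarith) T ⟨hT1, le_rfl⟩
    have h5 : κ * T = κ * (τ + 1) + B := by rw [hT]; field_simp
    have h6 := hcon T (by linarith)
    have h7 := hB (x T)
    linarith
  obtain ⟨t₁, ht₁, he, hlt⟩ := exists_first_eq (h := fun t => -(v t - W (x t))) (c := 0)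
    (s.continuousOn_speed h hτ (q := q)).neg (by linarith) ⟨q, ⟨hq, le_rfl⟩, by linarith⟩
  have hle : ∀ t ∈ Icc τ t₁, v t ≤ W (x t) := by
    intro t ht
    rcases ht.2.eq_or_lt with rfl | h1
    · linarith
    · linarith [hlt t ⟨ht.1, h1⟩]
  have hanti : ∀ p ∈ Icc τ t₁, ∀ t ∈ Icc p t₁, x t ≤ x p := fun p hp =>
    le_of_hasDerivWithinAt_nonpos (fun t ht => s.dx' (hτ.trans hp.1) ht)
      (fun t ht => by linarith [hle t ⟨hp.1.trans ht.1, ht.2⟩])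
  set m := (τ + t₁) / 2 with hm
  have hm1 : τ < m := by linarith [ht₁.1]
  have hm2 : m < t₁ := by linarith [ht₁.1]
  have hxm := neg_of_hasDerivWithinAt_neg (p := τ) (q := m)
      (fun t ht => s.dx' hτ ht) hx (fun t ht _ => by linarith [hlt t ⟨ht.1, ht.2.trans_lt hm2⟩])
      m ⟨hm1, le_rfl⟩
  have hxt := hanti m ⟨hm1.le, hm2.le⟩ t₁ ⟨hm2.le, le_rfl⟩
  exact ⟨t₁, ht₁.1, by linarith, by linarith, fun t ht =>
    ⟨hle t ht, hanti t ht t₁ ⟨ht.2, le_rfl⟩, hanti τ ⟨le_rfl, ht₁.1.le⟩ t ht⟩⟩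

/-- On the left and below the isocline, `log v - contraction W x` grows by at most `v / m`,
where `m` bounds `W` from below. -/
theorem left_estimate (h : IsSeparatrix a b c d W) (s : IsInnerSol W x v) (hτ : 0 ≤ τ) {t m : ℝ}
    (ht : τ ≤ t) (hm : 0 < m) (hmW : ∀ r ∈ Icc τ t, x r ≤ 0 ∧ m ≤ W (x r)) :
    Real.log (v t) - contraction W (x t) - v t / m
      ≤ Real.log (v τ) - contraction W (x τ) := by
  have := le_of_hasDerivWithinAt_nonpos (p := τ) (q := t)
    (h := fun t => Real.log (v t) - contraction W (x t) - v t / m)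
    (h' := fun t => -(x t * v t / W (x t) ^ 2) - -(x t * v t / W (x t)) / m)
    (fun r hr => (s.dM h hτ hr).sub ((s.dv' hτ hr).div_const m))
    (fun r hr => by
      obtain ⟨h1, h2⟩ := hmW r hr
      have hp := h.pos (x r)
      have hv := s.pos r (hτ.trans hr.1)
      have h3 : -(x r * v r / W (x r) ^ 2) - -(x r * v r / W (x r)) / m
          = -(x r) * v r / W (x r) * (1 / W (x r) - 1 / m) := by
        field_simp
        ring
      rw [h3]
      refine mul_nonpos_of_nonneg_of_nonpos
        (div_nonneg (mul_nonneg (by linarith) hv.le) hp.le) ?_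
      have := one_div_le_one_div_of_le hm h2
      linarith) t ⟨ht, le_rfl⟩
  have h1 : 0 < v τ / m := div_pos (s.pos τ hτ) hm
  linarith

/-- An orbit above the isocline on the left reaches the line `x = 0`, rising on the way. -/
theorem exists_reach_top (h : IsSeparatrix a b c d W) (s : IsInnerSol W x v) (hτ : 0 ≤ τ)
    (hx : x τ ≤ 0) (hv : W (x τ) ≤ v τ)
    (hy : 0 < lienardCurve a b c d (x τ) + (v τ - W (x τ))) :
    ∃ t₁ ≥ τ, x t₁ = 0 ∧ ∀ t ∈ Icc τ t₁, x t ≤ 0 ∧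
      lienardCurve a b c d (x τ) + (v τ - W (x τ))
        ≤ lienardCurve a b c d (x t) + (v t - W (x t)) := by
  set y := fun t => lienardCurve a b c d (x t) + (v t - W (x t)) with hydef
  have hyτ : 0 < y τ := hy
  rcases hx.eq_or_lt with hx0 | hx0
  · refine ⟨τ, le_rfl, hx0, fun t ht => ?_⟩
    obtain rfl : t = τ := le_antisymm ht.2 ht.1
    exact ⟨hx, le_rfl⟩
  have hmono : ∀ q, (∀ t ∈ Icc τ q, x t ≤ 0) → ∀ t ∈ Icc τ q, y τ ≤ y t := fun q hq =>
    le_of_hasDerivWithinAt_nonneg (fun t ht => s.dy h hτ ht) (fun t ht => by linarith [hq t ht])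
  obtain ⟨q, hq, hxq⟩ : ∃ q ≥ τ, 0 ≤ x q := by
    by_contra! hcon
    have hsp : ∀ t ≥ τ, W (x t) ≤ v t := by
      intro t ht
      have := nonpos_of_hasDerivWithinAt_neg (p := τ) (q := t) (h := fun t => -(v t - W (x t)))
        (fun r hr => (s.dspeed h hτ hr).fun_neg) (by linarith)
        (fun r hr h0 => by
          have h1 : v r - W (x r) = 0 := by linarith
          rw [h1, mul_zero, sub_zero, neg_neg]
          exact div_neg_of_neg_of_pos (mul_neg_of_neg_of_pos (hcon r hr.1)
            (s.pos r (hτ.trans hr.1))) (h.pos _)) t ⟨ht, le_rfl⟩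
      linarith
    have hxmono : ∀ p ≥ τ, ∀ t ≥ p, x p ≤ x t := fun p hp t ht =>
      le_of_hasDerivWithinAt_nonneg (p := p) (q := t)
        (fun r hr => s.dx' (hτ.trans hp) hr)
        (fun r hr => by linarith [hsp r (hp.le.trans hr.1)]) t ⟨ht, le_rfl⟩
    obtain ⟨C, hC⟩ := (isCompact_Icc (a := x τ) (b := 0)).exists_bound_of_continuousOn
      (continuous_lienardCurve a b c d).continuousOn
    have hC0 : 0 ≤ C := (norm_nonneg _).trans (hC 0 ⟨hx, le_rfl⟩)
    have hF0 : Tendsto (lienardCurve a b c d) (𝓝 0) (𝓝 0) := by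
      have := (continuous_lienardCurve a b c d).tendsto 0
      simpa [lienardCurve] using this
    obtain ⟨δ, hδ, hδF⟩ := Metric.eventually_nhds_iff.1
      (hF0.eventually (gt_mem_nhds (half_pos hyτ)))
    have hδF' : ∀ z, -δ < z → z ≤ 0 → lienardCurve a b c d z ≤ y τ / 2 := fun z h1 h2 =>
      (hδF (by rw [Real.dist_eq, abs_lt]; constructor <;> linarith)).le
    set κ := min 1 (y τ / 2) with hκ
    have hκ0 : 0 < κ := lt_min one_pos (half_pos hyτ)
    set T := τ + (C + 1) / δ with hT
    have hTτ : τ ≤ T := by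
      have : 0 < (C + 1) / δ := by positivity
      linarith
    have hspeed : ∀ t ≥ T, κ ≤ v t - W (x t) := by
      intro t ht
      have htτ : τ ≤ t := hTτ.trans ht
      have h0 : v t - W (x t) = y t - lienardCurve a b c d (x t) := by simp only [hydef]; ring
      rcases lt_or_ge (-δ) (x t) with h1 | h1
      · have h2 := hδF' (x t) h1 (hcon t htτ).le
        have h3 := hmono t (fun r hr => (hcon r hr.1).le) t ⟨htτ, le_rfl⟩
        have h4 := min_le_right 1 (y τ / 2)
        linarith
      · have h2 := le_of_hasDerivWithinAt_nonneg (p := τ) (q := t) (h := fun t => y t - δ * t)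
          (h' := fun t => - x t - δ)
          (fun r hr => by
            have h1 := ((hasDerivAt_id r).const_mul δ).hasDerivWithinAt (s := Icc τ t)
            rw [mul_one] at h1
            exact (s.dy h hτ hr).sub h1)
          (fun r hr => by linarith [hxmono r hr.1 t hr.2]) t ⟨htτ, le_rfl⟩
        have h3 : C + 1 ≤ δ * (t - τ) := by
          have : (C + 1) / δ ≤ t - τ := by linarith
          rw [div_le_iff₀ hδ] at this
          linarith
        have h4 := hC (x t) ⟨hxmono τ le_rfl t htτ, (hcon t htτ).le⟩
        have h5 := (le_abs_self _).trans h4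
        have h6 := min_le_left 1 (y τ / 2)
        linarith
    have hκi : 0 < - x T / κ := div_pos (by linarith [hcon T hTτ]) hκ0
    have hfin := le_of_hasDerivWithinAt_nonneg (p := T) (q := T + - x T / κ)
      (h := fun t => x t - κ * t) (h' := fun t => v t - W (x t) - κ)
      (fun r hr => by
        have h1 := ((hasDerivAt_id r).const_mul κ).hasDerivWithinAt (s := Icc T (T + - x T / κ))
        rw [mul_one] at h1
        exact (s.dx' (hτ.trans hTτ) hr).sub h1)
      (fun r hr => by linarith [hspeed r hr.1]) (T + - x T / κ) ⟨by linarith, le_rfl⟩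
    have h1 : κ * (T + - x T / κ) = κ * T - x T := by field_simp; ring
    have h2 := hcon (T + - x T / κ) (by linarith)
    linarith
  obtain ⟨t₁, ht₁, he, hlt⟩ := exists_first_eq (h := fun t => - x t) (c := 0)
    (s.continuousOn_x hτ (q := q)).neg (by linarith) ⟨q, ⟨hq, le_rfl⟩, by linarith⟩
  have hle : ∀ t ∈ Icc τ t₁, x t ≤ 0 := by
    intro t ht
    rcases ht.2.eq_or_lt with rfl | h1
    · linarith
    · linarith [hlt t ⟨ht.1, h1⟩]
  exact ⟨t₁, ht₁.1.le, by linarith, fun t ht => ⟨hle t ht, hmono t₁ hle t ht⟩⟩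

/-- An orbit that starts high enough on the right reaches `x = X` before it turns. -/
theorem exists_reach_right (h : IsSeparatrix a b c d W) (s : IsInnerSol W x v) (hτ : 0 ≤ τ)
    (hx : 0 ≤ x τ) {X : ℝ} (hX : 0 < X) (hF : ∀ z ∈ Icc 0 X, lienardCurve a b c d z
      + X * (X + 1) + 1 ≤ lienardCurve a b c d (x τ) + (v τ - W (x τ)))
    (hv : W (x τ) ≤ v τ) :
    ∃ t₁ ≥ τ, X ≤ x t₁ ∧ W (x t₁) ≤ v t₁ ∧ ∀ t ∈ Icc τ t₁, 0 ≤ x t ∧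
      lienardCurve a b c d (x τ) + (v τ - W (x τ)) - X * (X + 1)
        ≤ lienardCurve a b c d (x t) + (v t - W (x t)) := by
  set y := fun t => lienardCurve a b c d (x t) + (v t - W (x t)) with hydef
  rcases le_or_gt X (x τ) with hXτ | hXτ
  · refine ⟨τ, le_rfl, hXτ, hv, fun t ht => ?_⟩
    obtain rfl : t = τ := le_antisymm ht.2 ht.1
    have : 0 < X * (X + 1) := by positivity
    exact ⟨hx, by linarith⟩
  have key : ∀ q ≤ τ + (X + 1), (∀ t ∈ Icc τ q, x t ≤ X) → ∀ t ∈ Icc τ q,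
      0 ≤ x t ∧ y τ - X * (X + 1) ≤ y t ∧ 1 ≤ v t - W (x t) := by
    intro q hq hxX
    have hyge : ∀ t ∈ Icc τ q, y τ - X * (X + 1) ≤ y t := by
      intro t ht
      have := le_of_hasDerivWithinAt_nonneg (p := τ) (q := q) (h := fun t => y t + X * t)
        (h' := fun t => - x t + X)
        (fun r hr => by
          have h1 := ((hasDerivAt_id r).const_mul X).hasDerivWithinAt (s := Icc τ q)
          rw [mul_one] at h1
          exact (s.dy h hτ hr).add h1)
        (fun r hr => by linarith [hxX r hr]) t ht
      have h1 : X * (t - τ) ≤ X * (X + 1) :=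
        mul_le_mul_of_nonneg_left (by linarith [ht.2]) hX.le
      linarith
    have hx0 : ∀ t ∈ Icc τ q, 0 ≤ x t := by
      intro t ht
      have := nonpos_of_hasDerivWithinAt_neg (p := τ) (q := q) (h := fun t => - x t)
        (fun r hr => (s.dx' hτ hr).fun_neg) (by linarith)
        (fun r hr h0 => by
          have h1 : x r = 0 := by linarith
          have h2 := hyge r hr
          have h3 := hF (x r) (by rw [h1]; exact ⟨le_rfl, hX.le⟩)
          have h4 : v r - W (x r) = y r - lienardCurve a b c d (x r) := by
            simp only [hydef]; ring
          linarith) t ht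
      linarith
    refine fun t ht => ⟨hx0 t ht, hyge t ht, ?_⟩
    have h2 := hyge t ht
    have h3 := hF (x t) ⟨hx0 t ht, hxX t ht⟩
    have h4 : v t - W (x t) = y t - lienardCurve a b c d (x t) := by
      simp only [hydef]; ring
    linarith
  have hex : ∃ q ∈ Icc τ (τ + (X + 1)), X - x q ≤ 0 := by
    by_contra! hcon
    have hk := key (τ + (X + 1)) le_rfl (fun t ht => by linarith [hcon t ht])
    have := le_of_hasDerivWithinAt_nonneg (p := τ) (q := τ + (X + 1)) (h := fun t => x t - t)
      (h' := fun t => v t - W (x t) - 1)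
      (fun r hr => (s.dx' hτ hr).sub (hasDerivWithinAt_id _ _))
      (fun r hr => by linarith [(hk r hr).2.2]) (τ + (X + 1)) ⟨by linarith, le_rfl⟩
    have := hcon (τ + (X + 1)) ⟨by linarith, le_rfl⟩
    linarith
  obtain ⟨t₁, ht₁, he, hlt⟩ := exists_first_eq (h := fun t => X - x t) (c := 0)
    (continuousOn_const.sub (s.continuousOn_x hτ)) (by linarith) hex
  have hle : ∀ t ∈ Icc τ t₁, x t ≤ X := by
    intro t ht
    rcases ht.2.eq_or_lt with rfl | h1
    · linarith
    · linarith [hlt t ⟨ht.1, h1⟩]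
  have hk := key t₁ ht₁.2 hle
  have h1 := (hk t₁ ⟨ht₁.1.le, le_rfl⟩).2.2
  exact ⟨t₁, ht₁.1.le, by linarith, by linarith, fun t ht => ⟨(hk t ht).1, (hk t ht).2.1⟩⟩

theorem exists_lienardCurve_ge {a : ℝ} (ha : 0 < a) (b c d : ℝ) :
    ∃ C, ∀ z, 0 ≤ z → C ≤ lienardCurve a b c d z := by
  obtain ⟨X, hX, H⟩ := exists_damping_bounds ha b c d
  obtain ⟨C, hC⟩ := (isCompact_Icc (a := 0) (b := X)).exists_bound_of_continuousOn
    (continuous_lienardCurve a b c d).continuousOn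
  have hlow : ∀ z ∈ Icc 0 X, -C ≤ lienardCurve a b c d z := fun z hz => (abs_le.1 (hC z hz)).1
  refine ⟨-C, fun z hz => ?_⟩
  rcases le_total z X with hzX | hzX
  · exact hlow z ⟨hz, hzX⟩
  · have := le_of_hasDerivWithinAt_nonneg (p := X) (q := z)
      (fun r _ => (hasDerivAt_lienardCurve a b c d r).hasDerivWithinAt)
      (fun r hr => by
        have := (H r hr.1).1
        linarith [hr.1]) z ⟨hzX, le_rfl⟩
    exact (hlow X ⟨by linarith, le_rfl⟩).trans this

/-- An orbit above the isocline on the right turns at a point of the isocline. -/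
theorem exists_right_turn (ha : 0 < a) (h : IsSeparatrix a b c d W) (s : IsInnerSol W x v)
    (hτ : 0 ≤ τ) (hx : 0 < x τ) (hv : W (x τ) ≤ v τ) :
    ∃ t₁ ≥ τ, v t₁ = W (x t₁) ∧ ∀ t ∈ Icc τ t₁, x τ ≤ x t := by
  rcases hv.eq_or_lt with hv0 | hv0
  · refine ⟨τ, le_rfl, hv0.symm, fun t ht => ?_⟩
    obtain rfl : t = τ := le_antisymm ht.2 ht.1
    exact le_rfl
  have hmono : ∀ q, (∀ t ∈ Icc τ q, W (x t) ≤ v t) → ∀ t ∈ Icc τ q, x τ ≤ x t := fun q hq =>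
    le_of_hasDerivWithinAt_nonneg (fun t ht => s.dx' hτ ht) (fun t ht => by linarith [hq t ht])
  obtain ⟨q, hq, hvq⟩ : ∃ q ≥ τ, v q ≤ W (x q) := by
    by_contra! hcon
    obtain ⟨C, hC⟩ := exists_lienardCurve_ge ha b c d
    set y := fun t => lienardCurve a b c d (x t) + (v t - W (x t)) with hydef
    have hxge : ∀ t ≥ τ, x τ ≤ x t := fun t ht =>
      hmono t (fun r hr => (hcon r hr.1).le) t ⟨ht, le_rfl⟩
    have hyC : ∀ t ≥ τ, C < y t := fun t ht => by
      have h1 := hC (x t) (hx.le.trans (hxge t ht))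
      have h2 := hcon t ht
      simp only [hydef]
      linarith
    set T := τ + (y τ - C) / x τ with hT
    have h0 := hyC τ le_rfl
    have hTτ : τ ≤ T := by
      have : 0 < (y τ - C) / x τ := div_pos (by linarith) hx
      linarith
    have h1 := le_of_hasDerivWithinAt_nonpos (p := τ) (q := T) (h := fun t => y t + x τ * t)
      (h' := fun t => - x t + x τ)
      (fun r hr => by
        have h1 := ((hasDerivAt_id r).const_mul (x τ)).hasDerivWithinAt (s := Icc τ T)
        rw [mul_one] at h1
        exact (s.dy h hτ hr).add h1)
      (fun r hr => by linarith [hxge r hr.1]) T ⟨hTτ, le_rfl⟩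
    have h2 : x τ * T = x τ * τ + (y τ - C) := by rw [hT]; field_simp
    have h3 := hyC T hTτ
    linarith
  obtain ⟨t₁, ht₁, he, hlt⟩ := exists_first_eq (h := fun t => v t - W (x t)) (c := 0)
    (s.continuousOn_speed h hτ (q := q)) (by linarith) ⟨q, ⟨hq, le_rfl⟩, by linarith⟩
  refine ⟨t₁, ht₁.1.le, by linarith, hmono t₁ fun t ht => ?_⟩
  rcases ht.2.eq_or_lt with rfl | h1
  · linarith
  · linarith [hlt t ⟨ht.1, h1⟩]

/-- An orbit below the isocline on the right, close enough to the separatrix, reaches the line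
`x = 0` below the isocline again. -/
theorem exists_return (ha : 0 < a) (h : IsSeparatrix a b c d W) :
    ∃ Λ : ℝ, ∀ (x v : ℝ → ℝ), IsInnerSol W x v → ∀ τ, 0 ≤ τ → 0 ≤ x τ → v τ ≤ W (x τ) →
      Real.log (v τ) - contraction W (x τ) ≤ Λ →
      ∃ t₁ ≥ τ, x t₁ = 0 ∧ v t₁ < W 0 ∧ ∀ t ∈ Icc τ t₁, 0 ≤ x t ∧ v t ≤ W (x t) ∧
        Real.log (v t) - contraction W (x t) ≤ Real.log (v τ) - contraction W (x τ) := by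
  have hW0 := h.pos 0
  obtain ⟨δ, hδ, hδW⟩ := Metric.eventually_nhds_iff.1
    ((h.continuous.tendsto 0).eventually (lt_mem_nhds (half_lt_self hW0)))
  have hδW' : ∀ z, 0 ≤ z → z < δ → W 0 / 2 ≤ W z := fun z h1 h2 =>
    (hδW (by rw [Real.dist_eq, abs_lt]; constructor <;> linarith)).le
  refine ⟨Real.log (W 0 / 4) - contraction W δ, fun x v s τ hτ hx hv hΛ => ?_⟩
  obtain ⟨C, hC⟩ := exists_lienardCurve_ge ha b c d
  set y := fun t => lienardCurve a b c d (x t) + (v t - W (x t)) with hydef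
  set M := fun t => Real.log (v t) - contraction W (x t) with hM
  have hMle : ∀ q, (∀ t ∈ Icc τ q, 0 ≤ x t) → ∀ t ∈ Icc τ q, M t ≤ M τ := fun q hq =>
    le_of_hasDerivWithinAt_nonpos (fun t ht => s.dM h hτ ht) (fun t ht => by
      have : 0 ≤ x t * v t / W (x t) ^ 2 :=
        div_nonneg (mul_nonneg (hq t ht) (s.pos t (hτ.trans ht.1)).le) (sq_nonneg _)
      linarith)
  have hvs : ∀ t, τ ≤ t → M t ≤ M τ → 0 ≤ x t → x t ≤ δ → v t ≤ W 0 / 4 := by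
    intro t ht hMt hx0 hxδ
    have h1 := h.contraction_le_of_nonneg hx0 hxδ
    have h2 : Real.log (v t) ≤ Real.log (W 0 / 4) := by
      simp only [hM] at hMt
      linarith
    exact (Real.log_le_log_iff (s.pos t (hτ.trans ht)) (by positivity)).1 h2
  have hspeed : ∀ q, (∀ t ∈ Ico τ q, 0 < x t) → ∀ t ∈ Ico τ q, v t ≤ W (x t) := by
    intro q hq t ht
    have := nonpos_of_hasDerivWithinAt_neg (p := τ) (q := t) (h := fun t => v t - W (x t))
      (fun r hr => s.dspeed h hτ hr) (by linarith)
      (fun r hr h0 => by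
        have hxr := hq r ⟨hr.1, hr.2.trans_lt ht.2⟩
        have hvr := s.pos r (hτ.trans hr.1)
        have : 0 < x r * v r / W (x r) := div_pos (mul_pos hxr hvr) (h.pos _)
        rw [h0, mul_zero, sub_zero]
        linarith) t ⟨ht.1, le_rfl⟩
    linarith
  obtain ⟨t₁, ht₁, hx1, hxp⟩ : ∃ t₁ ≥ τ, x t₁ = 0 ∧ ∀ t ∈ Ico τ t₁, 0 < x t := by
    rcases hx.eq_or_lt with hx0 | hx0
    · exact ⟨τ, le_rfl, hx0.symm, by simp⟩
    obtain ⟨q, hq, hxq⟩ : ∃ q ≥ τ, x q ≤ 0 := by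
      by_contra! hcon
      have hsp : ∀ t ≥ τ, v t ≤ W (x t) := fun t ht =>
        hspeed (t + 1) (fun r hr => hcon r hr.1) t ⟨ht, by linarith⟩
      have hMt : ∀ t ≥ τ, M t ≤ M τ := fun t ht =>
        hMle t (fun r hr => (hcon r hr.1).le) t ⟨ht, le_rfl⟩
      have hxanti : ∀ p ≥ τ, ∀ t ≥ p, x t ≤ x p := fun p hp t ht =>
        le_of_hasDerivWithinAt_nonpos (p := p) (q := t) (fun r hr => s.dx' (hτ.trans hp) hr)
          (fun r hr => by linarith [hsp r (hp.le.trans hr.1)]) t ⟨ht, le_rfl⟩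
      set κ := min 1 (W 0 / 4) with hκ
      have hκ0 : 0 < κ := by positivity
      set T := τ + (|y τ - C| + 1) / δ with hT
      have hTτ : τ ≤ T := by
        have : 0 < (|y τ - C| + 1) / δ := by positivity
        linarith
      have hfast : ∀ t ≥ T, v t - W (x t) ≤ -κ := by
        intro t ht
        have htτ : τ ≤ t := hTτ.trans ht
        rcases lt_or_ge (x t) δ with h1 | h1
        · have h2 := hvs t htτ (hMt t htτ) (hcon t htτ).le h1.le
          have h3 := hδW' (x t) (hcon t htτ).le h1
          linarith [min_le_right 1 (W 0 / 4)]
        · have h2 := le_of_hasDerivWithinAt_nonpos (p := τ) (q := t) (h := fun t => y t + δ * t)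
            (h' := fun t => - x t + δ)
            (fun r hr => by
              have h1 := ((hasDerivAt_id r).const_mul δ).hasDerivWithinAt (s := Icc τ t)
              rw [mul_one] at h1
              exact (s.dy h hτ hr).add h1)
            (fun r hr => by linarith [hxanti r hr.1 t hr.2]) t ⟨htτ, le_rfl⟩
          have h3 : |y τ - C| + 1 ≤ δ * (t - τ) := by
            have : (|y τ - C| + 1) / δ ≤ t - τ := by linarith
            rw [div_le_iff₀ hδ] at this
            linarith
          have h4 := hC (x t) (hcon t htτ).le
          have h5 := le_abs_self (y τ - C)
          have h6 := min_le_left 1 (W 0 / 4)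
          have h7 : y t = lienardCurve a b c d (x t) + (v t - W (x t)) := rfl
          linarith
      have hκi : 0 < x T / κ := div_pos (hcon T hTτ) hκ0
      have hfin := le_of_hasDerivWithinAt_nonpos (p := T) (q := T + x T / κ)
        (h := fun t => x t + κ * t) (h' := fun t => v t - W (x t) + κ)
        (fun r hr => by
          have h1 := ((hasDerivAt_id r).const_mul κ).hasDerivWithinAt (s := Icc T (T + x T / κ))
          rw [mul_one] at h1
          exact (s.dx' (hτ.trans hTτ) hr).add h1)
        (fun r hr => by linarith [hfast r hr.1]) (T + x T / κ) ⟨by linarith, le_rfl⟩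
      have h1 : κ * (T + x T / κ) = κ * T + x T := by field_simp
      have h2 := hcon (T + x T / κ) (by linarith)
      linarith
    obtain ⟨t₁, ht₁, he, hlt⟩ := exists_first_eq (h := x) (c := 0)
      (s.continuousOn_x hτ (q := q)) hx0 ⟨q, ⟨hq, le_rfl⟩, hxq⟩
    exact ⟨t₁, ht₁.1.le, he, hlt⟩
  have hx0 : ∀ t ∈ Icc τ t₁, 0 ≤ x t := by
    intro t ht
    rcases ht.2.eq_or_lt with rfl | h1
    · exact hx1.ge
    · exact (hxp t ⟨ht.1, h1⟩).le
  have hMt := hMle t₁ hx0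
  have hv1 : v t₁ < W 0 := by
    have := hvs t₁ ht₁ (hMt t₁ ⟨ht₁, le_rfl⟩) hx1.ge (by rw [hx1]; exact hδ.le)
    linarith
  refine ⟨t₁, ht₁, hx1, hv1, fun t ht => ⟨hx0 t ht, ?_, hMt t ht⟩⟩
  rcases ht.2.eq_or_lt with rfl | h1
  · rw [hx1]
    exact hv1.le
  · exact hspeed t₁ hxp t ⟨ht.1, h1⟩

end IsInnerSol

/-! ### Asymptotics of orbits close to the loop -/

theorem tendsto_lienardCurve_atTop {a : ℝ} (ha : 0 < a) (b c d : ℝ) :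
    Tendsto (lienardCurve a b c d) atTop atTop := by
  obtain ⟨X, hX, H⟩ := exists_damping_bounds ha b c d
  refine tendsto_atTop_mono' atTop (f₁ := fun x => lienardCurve a b c d X - X + x) ?_
    (tendsto_atTop_add_const_left _ _ tendsto_id)
  filter_upwards [eventually_ge_atTop X] with x hx
  have := le_of_hasDerivWithinAt_nonneg (p := X) (q := x) (h := fun x => lienardCurve a b c d x - x)
    (fun r _ => ((hasDerivAt_lienardCurve a b c d r).sub (hasDerivAt_id r)).hasDerivWithinAt)
    (fun r hr => by
      have := (H r hr.1).1
      linarith [hr.1]) x ⟨hx, le_rfl⟩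
  linarith

theorem tendsto_lienardCurve_atBot {a : ℝ} (ha : 0 < a) (b c d : ℝ) :
    Tendsto (lienardCurve a b c d) atBot atTop := by
  have := (tendsto_lienardCurve_atTop ha (-b) c (-d)).comp tendsto_neg_atBot_atTop
  refine this.congr fun x => ?_
  rw [Function.comp_apply, ← lienardCurve_neg, neg_neg]

theorem IsSeparatrix.tendsto_log_sub_contraction {a b c d : ℝ} {W : ℝ → ℝ} (ha : 0 < a)
    (h : IsSeparatrix a b c d W) :
    Tendsto (fun x => Real.log (W x) - contraction W x) atTop atBot := by
  obtain ⟨X, hX, H⟩ := h.exists_antitone ha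
  refine tendsto_atBot_mono' atTop (f₁ := fun x => X - contraction W X + -x) ?_
    (tendsto_atBot_add_const_left _ _ tendsto_neg_atTop_atBot)
  filter_upwards [eventually_ge_atTop X] with x hx
  have h1 := le_of_hasDerivWithinAt_nonneg (p := X) (q := x) (h := fun x => contraction W x - x)
    (fun r _ => ((h.hasDerivAt_contraction r).sub (hasDerivAt_id r)).hasDerivWithinAt)
    (fun r hr => by
      have h1 := (H r hr.1).1
      have h2 := h.pos r
      have h3 : W r ^ 2 ≤ 1 := pow_le_one₀ h2.le h1
      have h4 : 1 ≤ r / W r ^ 2 := by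
        rw [le_div_iff₀ (by positivity)]
        linarith [hr.1]
      linarith) x ⟨hx, le_rfl⟩
  have h2 := Real.log_nonpos (h.pos x).le (H x hx).1
  linarith

/-- The point `(x, F x + (v - W x))` inside the loop is far out in the plane or close to the
separatrix. These conditions describe the neighbourhoods of the loop on the Poincaré sphere. -/
def NearLoop (a b c d : ℝ) (W : ℝ → ℝ) (R ε H x v : ℝ) : Prop :=
  R < |x| ∨ H < lienardCurve a b c d x + (v - W x) ∨ v < ε

namespace IsInnerSol

variable {a b c d : ℝ} {W : ℝ → ℝ}

/-- An orbit on the right below the isocline and close to the separatrix stays close to it until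
it meets the line `x = 0`. -/
theorem exists_return_near (ha : 0 < a) (h : IsSeparatrix a b c d W) {R ε : ℝ} (hε : 0 < ε) :
    ∃ Λ : ℝ, ∀ (x v : ℝ → ℝ), IsInnerSol W x v → ∀ τ, 0 ≤ τ → 0 ≤ x τ → v τ ≤ W (x τ) →
      Real.log (v τ) - contraction W (x τ) ≤ Λ →
      ∃ t₁ ≥ τ, x t₁ = 0 ∧ v t₁ < W 0 ∧
        Real.log (v t₁) ≤ Real.log (v τ) - contraction W (x τ) ∧
        ∀ t ∈ Icc τ t₁, 0 ≤ x t ∧ (x t ≤ R → v t < ε) := by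
  obtain ⟨Λ, hΛ⟩ := exists_return ha h
  refine ⟨min Λ (Real.log (ε / 2) - contraction W R), fun x v s τ hτ hx hv hM => ?_⟩
  obtain ⟨t₁, ht₁, h1, h2, h3⟩ := hΛ x v s τ hτ hx hv (hM.trans (min_le_left _ _))
  refine ⟨t₁, ht₁, h1, h2, ?_, fun t ht => ⟨(h3 t ht).1, fun hR => ?_⟩⟩
  · have := (h3 t₁ ⟨ht₁, le_rfl⟩).2.2
    rwa [h1, IsSeparatrix.contraction_zero, sub_zero] at this
  · obtain ⟨h4, -, h5⟩ := h3 t ht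
    have h6 := h.contraction_le_of_nonneg h4 hR
    have h7 := hM.trans (min_le_right _ _)
    have h8 : Real.log (v t) ≤ Real.log (ε / 2) := by linarith
    have := (Real.log_le_log_iff (s.pos t (hτ.trans ht.1)) (by positivity)).1 h8
    linarith

/-- An orbit above the isocline that is high enough to get beyond `x = X` stays close to the loop
until it meets the line `x = 0` again, below the isocline. -/
theorem eventually_upper_pass (ha : 0 < a) (h : IsSeparatrix a b c d W) (R H : ℝ) {ε : ℝ}
    (hε : 0 < ε) :
    ∀ᶠ X in atTop, ∀ (x v : ℝ → ℝ), IsInnerSol W x v → ∀ τ, 0 ≤ τ → W (x τ) ≤ v τ →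
      (∀ z ∈ Icc 0 X, lienardCurve a b c d z + X * (X + 1) + 1
        ≤ lienardCurve a b c d (x τ) + (v τ - W (x τ))) →
      ∃ t₁ ≥ τ, x t₁ = 0 ∧ v t₁ < W 0 ∧
        (∃ r ≥ X, Real.log (v t₁) ≤ Real.log (W r) - contraction W r) ∧
        (∀ t ∈ Icc τ t₁, NearLoop a b c d W R ε H (x t) (v t)) ∧
        ∃ t₂ ∈ Icc τ t₁, X ≤ x t₂ ∧ ∀ t ∈ Icc t₂ t₁, 0 ≤ x t ∧ (x t ≤ R → v t < ε) := by
  obtain ⟨Λ, hΛ⟩ := exists_return_near ha h (R := R) hε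
  have e1 := (h.tendsto_log_sub_contraction ha).eventually (eventually_le_atBot Λ)
  filter_upwards [eventually_gt_atTop R, eventually_gt_atTop 0,
    (tendsto_lienardCurve_atTop ha b c d).eventually (eventually_ge_atTop H),
    eventually_forall_ge_atTop.2 e1] with X hXR hX0 hXH hXΛ x v s τ hτ hv hF
  set y := fun t => lienardCurve a b c d (x t) + (v t - W (x t)) with hydef
  have hF0 : lienardCurve a b c d 0 = 0 := by simp [lienardCurve]
  have hXX : 0 < X * (X + 1) := by positivity
  have hy0 : 0 < y τ := by
    have := hF 0 ⟨le_rfl, hX0.le⟩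
    rw [hF0] at this
    simp only [hydef]
    linarith
  have hyX : H + 1 ≤ y τ - X * (X + 1) := by
    have := hF X ⟨hX0.le, le_rfl⟩
    simp only [hydef]
    linarith
  -- the orbit moves to the right half-plane
  obtain ⟨t₀, ht₀, hx0, hv0, hyτ, hn0⟩ : ∃ t₀ ≥ τ, 0 ≤ x t₀ ∧ W (x t₀) ≤ v t₀ ∧ y τ ≤ y t₀ ∧
      ∀ t ∈ Icc τ t₀, y τ ≤ y t := by
    rcases le_total 0 (x τ) with hx | hx
    · refine ⟨τ, le_rfl, hx, hv, le_rfl, fun t ht => ?_⟩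
      obtain rfl : t = τ := le_antisymm ht.2 ht.1
      exact le_rfl
    · obtain ⟨t₀, ht₀, hx0, hn⟩ := s.exists_reach_top h hτ hx hv hy0
      have h1 := (hn t₀ ⟨ht₀, le_rfl⟩).2
      refine ⟨t₀, ht₀, hx0.ge, ?_, h1, fun t ht => (hn t ht).2⟩
      rw [hx0, hF0] at h1
      rw [hx0]
      have h2 : 0 < y τ := hy0
      simp only [hydef] at h2
      linarith
  obtain ⟨t₁, ht₁, hx1, hv1, hn1⟩ := s.exists_reach_right h (hτ.trans ht₀) hx0 hX0
    (fun z hz => (hF z hz).trans hyτ) hv0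
  have h01 := ht₀.le.trans ht₁
  obtain ⟨t₂, ht₂, hv2, hn2⟩ := s.exists_right_turn ha h (hτ.trans h01) (hX0.trans_le hx1) hv1
  have hx2 : X ≤ x t₂ := hx1.trans (hn2 t₂ ⟨ht₂, le_rfl⟩)
  have h02 := h01.trans ht₂
  have hM := hXΛ (x t₂) hx2
  obtain ⟨t₃, ht₃, hx3, hv3, hl3, hn3⟩ := hΛ x v s t₂ (hτ.trans h02) (hX0.le.trans hx2) hv2.le
    (by rw [hv2]; exact hM)
  refine ⟨t₃, h02.trans ht₃, hx3, hv3, ⟨x t₂, hx2, by rwa [hv2] at hl3⟩, fun t ht => ?_,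
    t₂, ⟨h02, ht₃⟩, hx2, hn3⟩
  rcases le_total t t₀ with h1 | h1
  · exact Or.inr (Or.inl (by have := hn0 t ⟨ht.1, h1⟩; simp only [hydef] at *; linarith))
  rcases le_total t t₁ with h2 | h2
  · exact Or.inr (Or.inl (by have := (hn1 t ⟨h1, h2⟩).2; simp only [hydef] at *; linarith))
  rcases le_total t t₂ with h3 | h3
  · exact Or.inl (hXR.trans_le (hx1.trans ((hn2 t ⟨h2, h3⟩).trans (le_abs_self _))))
  · obtain ⟨h4, h5⟩ := hn3 t ⟨h3, ht.2⟩
    rcases lt_or_ge R (x t) with h6 | h6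
    · exact Or.inl (h6.trans_le (le_abs_self _))
    · exact Or.inr (Or.inr (h5 h6))

/-- An orbit on the left below the isocline and close to the loop turns far out, and stays close
to the separatrix until then. -/
theorem exists_lower_left_pass (h : IsSeparatrix a b c d W) {R ε : ℝ} (hR : 0 ≤ R) (hε : 0 < ε) :
    ∃ Λ : ℝ, ∀ (x v : ℝ → ℝ), IsInnerSol W x v → ∀ τ, 0 ≤ τ → x τ ≤ 0 → v τ < W (x τ) →
      (x τ < -R ∨ Real.log (v τ) - contraction W (x τ) ≤ Λ) →
      ∃ t₁ > τ, v t₁ = W (x t₁) ∧ x t₁ < -R ∧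
        ∀ t ∈ Icc τ t₁, x t₁ ≤ x t ∧ x t ≤ 0 ∧ (-R ≤ x t → v t < ε) := by
  obtain ⟨B, hB⟩ := h.bdd
  obtain ⟨x₀, hx₀, hmin⟩ := isCompact_Icc.exists_isMinOn
      (nonempty_Icc.2 (by linarith : -R ≤ 0)) h.continuous.continuousOn
  set m := W x₀ with hm
  have hm0 : 0 < m := h.pos _
  have hmW : ∀ z ∈ Icc (-R) 0, m ≤ W z := fun z hz => hmin hz
  have hε' : 0 < min ε m / 2 := by positivity
  refine ⟨Real.log (min ε m / 2) - contraction W (-R) - B / m, fun x v s τ hτ hx hv hs => ?_⟩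
  obtain ⟨t₁, ht₁, hv1, -, hn⟩ := s.exists_left_turn h hτ hx hv
  have hanti : ∀ p ∈ Icc τ t₁, ∀ t ∈ Icc p t₁, x t ≤ x p := fun p hp =>
    le_of_hasDerivWithinAt_nonpos (fun t ht => s.dx' (hτ.trans hp.1) ht)
      (fun t ht => by linarith [(hn t ⟨hp.1.trans ht.1, ht.2⟩).1])
  have key : ∀ t ∈ Icc τ t₁, -R ≤ x t → v t < min ε m := by
    intro t ht htR
    have hM := hs.resolve_left (by linarith [(hn t ht).2.2])
    have hr : ∀ r ∈ Icc τ t, x r ≤ 0 ∧ m ≤ W (x r) := by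
      intro r hr
      have h1 := hanti r ⟨hr.1, hr.2.trans ht.2⟩ t ⟨hr.2, ht.2⟩
      have h2 := (hn r ⟨hr.1, hr.2.trans ht.2⟩).2.2.trans hx
      exact ⟨h2, hmW _ ⟨by linarith, h2⟩⟩
    have h1 := s.left_estimate h hτ ht.1 hm0 hr
    have h2 : v t / m ≤ B / m :=
      div_le_div_of_nonneg_right ((hn t ht).1.trans (hB _)) hm0.le
    have h3 := h.contraction_le_of_nonpos (hr t ⟨ht.1, le_rfl⟩).1 htR
    have h4 : Real.log (v t) ≤ Real.log (min ε m / 2) := by linarith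
    have := (Real.log_le_log_iff (s.pos t (hτ.trans ht.1)) hε').1 h4
    linarith
  refine ⟨t₁, ht₁, hv1, ?_, fun t ht => ⟨(hn t ht).2.1, (hn t ht).2.2.trans hx, fun htR =>
    (key t ht htR).trans_le (min_le_left _ _)⟩⟩
  by_contra! hcon
  have h1 := key t₁ ⟨ht₁.le, le_rfl⟩ hcon
  have h2 := hmW (x t₁) ⟨hcon, (hn t₁ ⟨ht₁.le, le_rfl⟩).2.2.trans hx⟩
  rw [hv1] at h1
  exact absurd (h1.trans_le (min_le_right _ _)) (not_lt.2 h2)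

/-- An orbit that meets the line `x = 0` close to the separatrix goes around once, close to the
loop all the time, and comes at least twice closer. -/
theorem exists_lap (ha : 0 < a) (hb : 0 < b) (h : IsSeparatrix a b c d W) (H : ℝ) {R ε : ℝ}
    (hR : 0 ≤ R) (hε : 0 < ε) :
    ∃ δ > 0, ∀ (x v : ℝ → ℝ), IsInnerSol W x v → ∀ τ, 0 ≤ τ → x τ = 0 → v τ < δ →
      ∃ t₁ > τ, x t₁ = 0 ∧ v t₁ ≤ v τ / 2 ∧
        (∀ t ∈ Icc τ t₁, NearLoop a b c d W R ε H (x t) (v t)) ∧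
        ∀ z ∈ Icc (-R) R, ∃ t ∈ Icc τ t₁, x t = z ∧ v t < ε := by
  set β := 11 * b / (20 * a) with hβ
  have hβ0 : 0 < β := by positivity
  obtain ⟨X₀, hX₀⟩ := eventually_atTop.1 (eventually_upper_pass ha h R H hε)
  obtain ⟨Z₁, hZ₁, hβZ, hc₁⟩ := IsSeparatrix.exists_lienardCurve_comparison ha hb c d
  obtain ⟨Z₂, hc₂⟩ := h.exists_contraction_comparison ha hb
  obtain ⟨Z₃, hc₃⟩ := h.exists_le_on_left ha
  set Z := max (max (X₀ + β) (R + β)) (max Z₁ (max Z₂ Z₃)) with hZ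
  have hZR : R + β ≤ Z := (le_max_right _ _).trans (le_max_left _ _)
  obtain ⟨Λ, hΛ⟩ := exists_lower_left_pass h (R := Z) (by linarith) hε
  have hW0 := h.pos 0
  refine ⟨min (W 0) (Real.exp Λ), by positivity, fun x v s τ hτ hx hv => ?_⟩
  have hvτ := s.pos τ hτ
  have hK0 : contraction W 0 = 0 := IsSeparatrix.contraction_zero
  obtain ⟨t₁, ht₁, hv1, hx1, hn1⟩ := hΛ x v s τ hτ hx.le
    (by rw [hx]; exact hv.trans_le (min_le_left _ _))
    (Or.inr (by
      rw [hx, hK0, sub_zero]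
      exact (Real.log_le_iff_le_exp hvτ).2 (hv.le.trans (min_le_right _ _))))
  set z := - x t₁ with hz
  have hxz : x t₁ = -z := by rw [hz, neg_neg]
  have hzZ : Z < z := by linarith
  have hz0 : X₀ ≤ z - β := by
    have : X₀ + β ≤ Z := (le_max_left _ _).trans (le_max_left _ _)
    linarith
  have hz1 : Z₁ ≤ z := ((le_max_left _ _).trans (le_max_right _ _)).trans hzZ.le
  have hz2 : Z₂ ≤ z :=
    (((le_max_left _ _).trans (le_max_right _ _)).trans (le_max_right _ _)).trans hzZ.le
  have hz3 : Z₃ ≤ z :=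
    (((le_max_right _ _).trans (le_max_right _ _)).trans (le_max_right _ _)).trans hzZ.le
  have ht1 := hτ.trans ht₁.le
  obtain ⟨t₂, ht₂, hx2, -, ⟨r, hr, hlog⟩, hn2, t₃, ht₃, hx3, hn3⟩ := hX₀ (z - β) hz0 x v s t₁ ht1
    hv1.ge (fun w hw => by
      rw [hv1, sub_self, add_zero, hxz]
      exact hc₁ z hz1 w hw)
  have hest := s.left_estimate h hτ ht₁.le (h.pos (-z)) (fun t ht => ⟨(hn1 t ht).2.1,
    hc₃ z hz3 (x t) ⟨by linarith [(hn1 t ht).1], (hn1 t ht).2.1⟩⟩)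
  have hcmp := hc₂ z hz2 r hr
  rw [hx, hK0, hv1, hxz, div_self (h.pos _).ne'] at hest
  have hv2 := s.pos t₂ (ht1.trans ht₂)
  refine ⟨t₂, ht₁.trans_le ht₂, hx2, ?_, fun t ht => ?_, fun w hw => ?_⟩
  · rw [← Real.log_le_log_iff hv2 (by positivity), Real.log_div hvτ.ne' two_ne_zero]
    have := Real.log_two_lt_d9
    linarith
  · rcases le_total t t₁ with h1 | h1
    · obtain ⟨-, h2, h3⟩ := hn1 t ⟨ht.1, h1⟩
      rcases lt_or_ge (x t) (-Z) with h4 | h4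
      · exact Or.inl (by rw [abs_of_nonpos h2]; linarith)
      · exact Or.inr (Or.inr (h3 h4))
    · exact hn2 t ⟨h1, ht.2⟩
  · rcases le_total w 0 with hw0 | hw0
    · obtain ⟨t, ht, hxt⟩ := intermediate_value_Icc' ht₁.le (s.continuousOn_x hτ)
        (show w ∈ Icc (x t₁) (x τ) from ⟨by linarith [hw.1], by rw [hx]; exact hw0⟩)
      exact ⟨t, ⟨ht.1, ht.2.trans ht₂⟩, hxt, (hn1 t ht).2.2 (by linarith [hw.1])⟩
    · obtain ⟨t, ht, hxt⟩ := intermediate_value_Icc' ht₃.2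
        (s.continuousOn_x (hτ.trans (ht₁.le.trans ht₃.1)))
        (show w ∈ Icc (x t₂) (x t₃) from ⟨by rw [hx2]; exact hw0, by linarith [hw.2]⟩)
      exact ⟨t, ⟨(ht₁.le.trans ht₃.1).trans ht.1, ht.2⟩, hxt,
        (hn3 t ht).2 (by rw [hxt]; exact hw.2)⟩

/-- The laps of an orbit close to the loop fill the whole half-line of time: since `v` is halved by
each lap, it would vanish at a finite accumulation time. -/
theorem exists_laps (ha : 0 < a) (hb : 0 < b) (h : IsSeparatrix a b c d W) (H : ℝ) {R ε : ℝ}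
    (hR : 0 ≤ R) (hε : 0 < ε) :
    ∃ δ > 0, ∀ (x v : ℝ → ℝ), IsInnerSol W x v → ∀ τ, 0 ≤ τ → x τ = 0 → v τ < δ →
      (∀ t ≥ τ, NearLoop a b c d W R ε H (x t) (v t)) ∧
      ∀ η > 0, ∀ T, ∃ t ≥ T, τ ≤ t ∧ x t = 0 ∧ v t < η := by
  obtain ⟨δ, hδ, hlap⟩ := exists_lap ha hb h H hR hε
  refine ⟨δ, hδ, fun x v s τ hτ hx hv => ?_⟩
  let P := {t : ℝ // 0 ≤ t ∧ x t = 0 ∧ v t < δ}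
  have step : ∀ p : P, ∃ q : P, p.1 < q.1 ∧ v q.1 ≤ v p.1 / 2 ∧
      ∀ t ∈ Icc p.1 q.1, NearLoop a b c d W R ε H (x t) (v t) := by
    rintro ⟨p, hp, hxp, hvp⟩
    obtain ⟨q, hq, hxq, hvq, hn, -⟩ := hlap x v s p hp hxp hvp
    have := s.pos p hp
    exact ⟨⟨q, hp.trans hq.le, hxq, by linarith⟩, hq, hvq, hn⟩
  choose next hlt hhalf hnear using step
  let u : ℕ → P := fun n => n.rec ⟨τ, hτ, hx, hv⟩ fun _ p => next p
  have hu0 : (u 0).1 = τ := rfl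
  have hus : ∀ n, u (n + 1) = next (u n) := fun n => rfl
  have hmono : StrictMono fun n => (u n).1 := strictMono_nat_of_lt_succ fun n => by
    rw [hus]; exact hlt _
  have hvn : ∀ n, v (u n).1 ≤ v τ * (1 / 2) ^ n := by
    intro n
    induction n with
    | zero => simp [hu0]
    | succ n ih =>
      rw [hus, pow_succ]
      have := hhalf (u n)
      linarith
  have hgeo : Tendsto (fun n : ℕ => v τ * (1 / 2) ^ n) atTop (𝓝 0) := by
    have := (tendsto_pow_atTop_nhds_zero_of_lt_one (by norm_num : (0 : ℝ) ≤ 1 / 2)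
      (by norm_num)).const_mul (v τ)
    rwa [mul_zero] at this
  have htop : Tendsto (fun n => (u n).1) atTop atTop := by
    rcases tendsto_atTop_of_monotone hmono.monotone with ht | ⟨T, hT⟩
    · exact ht
    exfalso
    have hT0 : 0 ≤ T := ge_of_tendsto' hT fun n => (u n).2.1
    have h1 : Tendsto (fun n => v (u n).1) atTop (𝓝 (v T)) :=
      (s.dv T hT0).continuousWithinAt.tendsto.comp
        (tendsto_nhdsWithin_iff.2 ⟨hT, Eventually.of_forall fun n => (u n).2.1⟩)
    have h2 := le_of_tendsto_of_tendsto' h1 hgeo hvn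
    exact absurd (s.pos T hT0) (not_lt.2 h2)
  constructor
  · intro t ht
    have hex : ∃ n, t < (u n).1 := (htop.eventually (eventually_gt_atTop t)).exists
    classical
    obtain ⟨hn1, hn2⟩ := And.intro (Nat.find_spec hex) fun m => Nat.find_min hex (m := m)
    cases hfind : Nat.find hex with
    | zero =>
      rw [hfind, hu0] at hn1
      linarith
    | succ n =>
      rw [hfind] at hn1
      have h1 := hn2 n (by omega)
      exact hnear (u n) t ⟨not_lt.1 h1, by rw [← hus]; exact hn1.le⟩
  · intro η hη T
    obtain ⟨n, h1, h2⟩ := ((htop.eventually (eventually_ge_atTop T)).and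
      (hgeo.eventually (gt_mem_nhds hη))).exists
    exact ⟨(u n).1, h1, hu0 ▸ hmono.monotone (Nat.zero_le n), (u n).2.2.1, (hvn n).trans_lt h2⟩

/-- An orbit that starts close enough to the loop stays close to it until it meets the line
`x = 0` very close to the separatrix. -/
theorem exists_entry (ha : 0 < a) (h : IsSeparatrix a b c d W) (H : ℝ) {R ε δ : ℝ}
    (hε : 0 < ε) (hδ : 0 < δ) :
    ∃ R' ε' H' : ℝ, 0 < ε' ∧ ∀ (x v : ℝ → ℝ), IsInnerSol W x v →
      NearLoop a b c d W R' ε' H' (x 0) (v 0) →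
      ∃ τ ≥ 0, x τ = 0 ∧ v τ < δ ∧ ∀ t ∈ Icc 0 τ, NearLoop a b c d W R ε H (x t) (v t) := by
  have hlt : ∀ {u : ℝ}, 0 < u → Real.log u ≤ Real.log (δ / 2) → u < δ := fun hu hl => by
    have := (Real.log_le_log_iff hu (by positivity)).1 hl
    linarith
  have hTail := h.tendsto_log_sub_contraction ha
  -- the orbits that start above the isocline
  obtain ⟨X, hX, hXtail, hX0⟩ := ((eventually_upper_pass ha h R H hε).and
    ((eventually_forall_ge_atTop.2 (hTail.eventually (eventually_le_atBot
      (Real.log (δ / 2))))).and (eventually_ge_atTop 0))).exists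
  obtain ⟨C, hC⟩ := (isCompact_Icc (a := 0) (b := X)).exists_bound_of_continuousOn
    (continuous_lienardCurve a b c d).continuousOn
  set Y := C + X * (X + 1) + 1 with hY
  have upper : ∀ (x v : ℝ → ℝ), IsInnerSol W x v → ∀ τ, 0 ≤ τ → W (x τ) ≤ v τ →
      Y ≤ lienardCurve a b c d (x τ) + (v τ - W (x τ)) →
      ∃ t₁ ≥ τ, x t₁ = 0 ∧ v t₁ < δ ∧
        ∀ t ∈ Icc τ t₁, NearLoop a b c d W R ε H (x t) (v t) := by
    intro x v s τ hτ hv hy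
    obtain ⟨t₁, ht₁, hx1, -, ⟨r, hr, hlog⟩, hn, -⟩ := hX x v s τ hτ hv (fun z hz => by
      have := (le_abs_self _).trans (hC z hz)
      linarith)
    exact ⟨t₁, ht₁, hx1, hlt (s.pos t₁ (hτ.trans ht₁)) (hlog.trans (hXtail r hr)), hn⟩
  -- `R₁` is so large that the isocline is higher than `Y` outside of `[-R₁, R₁]`
  obtain ⟨Λ₁, hΛ₁⟩ := exists_return_near ha h (R := R) hε
  obtain ⟨R₁, hR₁, hR0, hRR, hRtail⟩ := (((eventually_forall_ge_atTop.2
    (((tendsto_lienardCurve_atTop ha b c d).eventually (eventually_ge_atTop Y)).and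
    (((tendsto_lienardCurve_atBot ha b c d).comp tendsto_neg_atTop_atBot).eventually
      (eventually_ge_atTop Y)))).and ((eventually_ge_atTop 0).and ((eventually_ge_atTop R).and
    (eventually_forall_ge_atTop.2 (hTail.eventually (eventually_le_atBot
      (min Λ₁ (Real.log (δ / 2)))))))))).exists
  have hYF : ∀ z, R₁ < |z| → Y ≤ lienardCurve a b c d z := by
    intro z hz
    rcases le_total 0 z with h0 | h0
    · exact (hR₁ z (by rw [abs_of_nonneg h0] at hz; exact hz.le)).1
    · have := (hR₁ (-z) (by rw [abs_of_nonpos h0] at hz; exact hz.le)).2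
      rwa [Function.comp_apply, neg_neg] at this
  obtain ⟨Λ₂, hΛ₂⟩ := exists_lower_left_pass h hR0 hε
  obtain ⟨x₀, hx₀, hmin⟩ := (isCompact_Icc (a := -R₁) (b := R₁)).exists_isMinOn
      (nonempty_Icc.2 (by linarith)) h.continuous.continuousOn
  obtain ⟨D, hD⟩ := (isCompact_Icc (a := -R₁) (b := R₁)).exists_bound_of_continuousOn
    (continuous_lienardCurve a b c d).continuousOn
  have hm0 : 0 < W x₀ := h.pos _
  set N := min (min Λ₁ Λ₂) (Real.log (δ / 2)) with hN
  refine ⟨R₁, min (W x₀) (Real.exp N), max Y D, by positivity, fun x v s hnear => ?_⟩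
  have hv0 := s.pos 0 le_rfl
  have hlogN : v 0 < min (W x₀) (Real.exp N) → Real.log (v 0) ≤ N := fun hv =>
    (Real.log_le_iff_le_exp hv0).2 (hv.le.trans (min_le_right _ _))
  rcases le_or_gt (W (x 0)) (v 0) with hv | hv
  · refine upper x v s 0 le_rfl hv ?_
    have hbig : R₁ < |x 0| → Y ≤ lienardCurve a b c d (x 0) + (v 0 - W (x 0)) := fun h1 => by
      have := hYF _ h1
      linarith
    rcases hnear with h1 | h1 | h1
    · exact hbig h1
    · exact (le_max_left _ _).trans h1.le
    · refine hbig ?_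
      by_contra! hcon
      have h2 : W x₀ ≤ W (x 0) := hmin (abs_le.1 hcon)
      have h3 := h1.trans_le (min_le_left _ _)
      linarith
  have hnear' : R₁ < |x 0| ∨ Real.log (v 0) ≤ N := by
    rcases hnear with h1 | h1 | h1
    · exact Or.inl h1
    · refine Or.inl ?_
      by_contra! hcon
      have h2 := (le_abs_self _).trans (hD (x 0) (abs_le.1 hcon))
      have h3 := (le_max_right Y D).trans_lt h1
      linarith
    · exact Or.inr (hlogN h1)
  rcases le_total (x 0) 0 with hx | hx
  · obtain ⟨t₁, ht₁, hv1, hx1, hn1⟩ := hΛ₂ x v s 0 le_rfl hx hv (by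
      refine hnear'.imp (fun h1 => ?_) fun h1 => ?_
      · rw [abs_of_nonpos hx] at h1
        linarith
      · have h2 := h.contraction_le_of_nonpos le_rfl hx
        rw [IsSeparatrix.contraction_zero] at h2
        have h3 : N ≤ Λ₂ := (min_le_left _ _).trans (min_le_right _ _)
        linarith)
    have hlow := hYF (x t₁) (by rw [abs_of_nonpos (by linarith)]; linarith)
    obtain ⟨t₂, ht₂, hx2, hv2, hn2⟩ := upper x v s t₁ ht₁.le hv1.ge
      (by rw [hv1, sub_self, add_zero]; exact hlow)
    refine ⟨t₂, ht₁.le.trans ht₂, hx2, hv2, fun t ht => ?_⟩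
    rcases le_total t t₁ with h1 | h1
    · obtain ⟨-, h2, h3⟩ := hn1 t ⟨ht.1, h1⟩
      rcases lt_or_ge (x t) (-R₁) with h4 | h4
      · exact Or.inl (by rw [abs_of_nonpos h2]; linarith)
      · exact Or.inr (Or.inr (h3 h4))
    · exact hn2 t ⟨h1, ht.2⟩
  · have hM : Real.log (v 0) - contraction W (x 0) ≤ min Λ₁ (Real.log (δ / 2)) := by
      rcases hnear' with h1 | h1
      · rw [abs_of_nonneg hx] at h1
        have h2 := hRtail (x 0) h1.le
        have h3 := Real.log_le_log hv0 hv.le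
        linarith
      · have h2 := h.contraction_le_of_nonneg le_rfl hx
        rw [IsSeparatrix.contraction_zero] at h2
        have h3 : N ≤ min Λ₁ (Real.log (δ / 2)) :=
          min_le_min_right _ (min_le_left _ _)
        linarith
    obtain ⟨t₁, ht₁, hx1, -, hl1, hn1⟩ := hΛ₁ x v s 0 le_rfl hx hv.le
      (hM.trans (min_le_left _ _))
    refine ⟨t₁, ht₁, hx1, hlt (s.pos t₁ ht₁) (hl1.trans (hM.trans (min_le_right _ _))),
      fun t ht => ?_⟩
    obtain ⟨h2, h3⟩ := hn1 t ht
    rcases lt_or_ge R (x t) with h4 | h4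
    · exact Or.inl (h4.trans_le (le_abs_self _))
    · exact Or.inr (Or.inr (h3 h4))

/-- Attraction to the loop, in the coordinates `(x, v)`: an orbit that starts close to the loop
stays close to it, converges to it, and accumulates at each point of the separatrix. -/
theorem attraction (ha : 0 < a) (hb : 0 < b) (h : IsSeparatrix a b c d W) (R H : ℝ) {ε : ℝ}
    (hε : 0 < ε) :
    ∃ R' ε' H' : ℝ, 0 < ε' ∧ ∀ (x v : ℝ → ℝ), IsInnerSol W x v →
      NearLoop a b c d W R' ε' H' (x 0) (v 0) →
      (∀ t ≥ 0, NearLoop a b c d W R ε H (x t) (v t)) ∧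
      (∀ r h η, 0 < η → ∀ᶠ t in atTop, NearLoop a b c d W r η h (x t) (v t)) ∧
      ∀ z η, 0 < η → ∃ᶠ t in atTop, x t = z ∧ v t < η := by
  obtain ⟨δ, hδ, hδ'⟩ := exists_laps ha hb h H (abs_nonneg R) hε
  obtain ⟨R', ε', H', hε', hent⟩ := exists_entry ha h H (R := |R|) hε hδ
  have hRabs : ∀ {R ε H x v : ℝ}, NearLoop a b c d W |R| ε H x v →
      NearLoop a b c d W R ε H x v :=
    fun hn => hn.imp_left ((le_abs_self _).trans_lt)
  refine ⟨R', ε', H', hε', fun x v s hn => ?_⟩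
  obtain ⟨τ, hτ, hx, hv, hn⟩ := hent x v s hn
  obtain ⟨h1, h2⟩ := hδ' x v s τ hτ hx hv
  refine ⟨fun t ht => ?_, fun r h' η hη => ?_, fun z η hη => ?_⟩
  · rcases le_total t τ with h3 | h3
    · exact hRabs (hn t ⟨ht, h3⟩)
    · exact hRabs (h1 t h3)
  · obtain ⟨δ', hδ', hlaps⟩ := exists_laps ha hb h h' (abs_nonneg r) hη
    obtain ⟨t, -, ht, hxt, hvt⟩ := h2 δ' hδ' 0
    filter_upwards [eventually_ge_atTop t] with q hq
    exact hRabs ((hlaps x v s t (hτ.trans ht) hxt hvt).1 q hq)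
  · obtain ⟨δ', hδ', hlap⟩ := exists_lap ha hb h 0 (abs_nonneg z) hη
    rw [frequently_atTop]
    intro T
    obtain ⟨t, hT, ht, hxt, hvt⟩ := h2 δ' hδ' T
    obtain ⟨t₁, -, -, -, -, hz⟩ := hlap x v s t (hτ.trans ht) hxt hvt
    obtain ⟨q, hq, hxq, hvq⟩ := hz z ⟨neg_abs_le z, le_abs_self z⟩
    exact ⟨q, hT.trans hq.1, hxq, hvq⟩

end IsInnerSol

/-! ### Global solutions inside the loop -/

theorem HasDerivWithinAt.fst_comp {γ : ℝ → ℝ × ℝ} {γ' : ℝ × ℝ} {s : Set ℝ} {t : ℝ}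
    (h : HasDerivWithinAt γ γ' s t) : HasDerivWithinAt (fun t => (γ t).1) γ'.1 s t :=
  (hasFDerivAt_fst (𝕜 := ℝ) (p := γ t)).comp_hasDerivWithinAt t h

theorem HasDerivWithinAt.snd_comp {γ : ℝ → ℝ × ℝ} {γ' : ℝ × ℝ} {s : Set ℝ} {t : ℝ}
    (h : HasDerivWithinAt γ γ' s t) : HasDerivWithinAt (fun t => (γ t).2) γ'.2 s t :=
  (hasFDerivAt_snd (𝕜 := ℝ) (p := γ t)).comp_hasDerivWithinAt t h

/-- A solution of a homogeneous linear equation does not change its sign. -/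
theorem pos_of_hasDerivWithinAt_mul {g u : ℝ → ℝ} {p q : ℝ} (hg : ContinuousOn g (Icc p q))
    (hu : ∀ t ∈ Icc p q, HasDerivWithinAt u (g t * u t) (Icc p q) t) (hp : 0 < u p) :
    ∀ t ∈ Icc p q, 0 < u t := by
  obtain ⟨G, hG⟩ := isCompact_Icc.exists_bound_of_continuousOn hg
  intro t ht
  have := le_of_hasDerivWithinAt_nonneg_of_lt (c := 0) (h := fun t => u t * Real.exp (G * t))
    (h' := fun t => (g t + G) * (u t * Real.exp (G * t)))
    (fun r hr => by
      have h1 := (((hasDerivAt_id r).const_mul G).exp).hasDerivWithinAt (s := Icc p q)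
      refine ((hu r hr).mul h1).congr_deriv ?_
      simp only [id]
      ring) (mul_pos hp (Real.exp_pos _))
    (fun r hr hpos => mul_nonneg (by linarith [(abs_le.1 (hG r hr)).1]) hpos.le) t ht
  have h2 : 0 < u t * Real.exp (G * t) := (mul_pos hp (Real.exp_pos _)).trans_le this
  exact pos_of_mul_pos_left h2 (Real.exp_pos _).le

theorem ContDiff.exists_lipschitzOnWith_closedBall {E F : Type*} [NormedAddCommGroup E]
    [NormedSpace ℝ E] [ProperSpace E] [NormedAddCommGroup F] [NormedSpace ℝ F] {X : E → F}
    (hX : ContDiff ℝ 1 X) (p : E) (ρ : ℝ) :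
    ∃ K, LipschitzOnWith K X (Metric.closedBall p ρ) :=
  (hX.locallyLipschitz.locallyLipschitzOn).exists_lipschitzOnWith_of_compact
    (isCompact_closedBall p ρ)

/-- Uniqueness of the solutions of an autonomous differential equation. -/
theorem eqOn_Icc_of_hasDerivWithinAt {E : Type*} [NormedAddCommGroup E] [NormedSpace ℝ E]
    [ProperSpace E] {X : E → E} (hX : ContDiff ℝ 1 X) {σ₁ σ₂ : ℝ → E} {p q : ℝ}
    (h₁ : ∀ t ∈ Icc p q, HasDerivWithinAt σ₁ (X (σ₁ t)) (Icc p q) t)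
    (h₂ : ∀ t ∈ Icc p q, HasDerivWithinAt σ₂ (X (σ₂ t)) (Icc p q) t) (h : σ₁ p = σ₂ p) :
    EqOn σ₁ σ₂ (Icc p q) := by
  have c₁ : ContinuousOn σ₁ (Icc p q) := fun t ht => (h₁ t ht).continuousWithinAt
  have c₂ : ContinuousOn σ₂ (Icc p q) := fun t ht => (h₂ t ht).continuousWithinAt
  obtain ⟨ρ₁, hρ₁⟩ := isCompact_Icc.exists_bound_of_continuousOn c₁
  obtain ⟨ρ₂, hρ₂⟩ := isCompact_Icc.exists_bound_of_continuousOn c₂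
  obtain ⟨K, hK⟩ := hX.exists_lipschitzOnWith_closedBall 0 (max ρ₁ ρ₂)
  exact ODE_solution_unique_of_mem_Icc_right (v := fun _ => X)
    (s := fun _ => Metric.closedBall 0 (max ρ₁ ρ₂)) (fun _ _ => hK)
    c₁ (fun t ht => (h₁ t (Ico_subset_Icc_self ht)).Ici_of_Icc ht)
    (fun t ht => mem_closedBall_zero_iff.2
      ((hρ₁ t (Ico_subset_Icc_self ht)).trans (le_max_left _ _)))
    c₂ (fun t ht => (h₂ t (Ico_subset_Icc_self ht)).Ici_of_Icc ht)
    (fun t ht => mem_closedBall_zero_iff.2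
      ((hρ₂ t (Ico_subset_Icc_self ht)).trans (le_max_right _ _))) h

/-- If the solutions starting at `p` are bounded on `[0, T]` by a constant, one of them is defined
on `[0, T]`: it also solves the equation whose right side is cut off far from the origin. -/
theorem exists_solution_of_bound {X : ℝ × ℝ → ℝ × ℝ} (hX : ContDiff ℝ 1 X) {p : ℝ × ℝ} {T ρ : ℝ}
    (hT : 0 ≤ T) (hρ : ∀ q ∈ Icc 0 T, ∀ σ : ℝ → ℝ × ℝ, σ 0 = p →
      (∀ t ∈ Icc 0 q, HasDerivWithinAt σ (X (σ t)) (Icc 0 q) t) → ‖σ q‖ ≤ ρ) :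
    ∃ σ : ℝ → ℝ × ℝ, σ 0 = p ∧
      ∀ t ∈ Icc 0 T, HasDerivWithinAt σ (X (σ t)) (Icc 0 T) t := by
  have hρ0 : ‖p‖ ≤ ρ := by
    refine hρ 0 ⟨le_rfl, hT⟩ (fun _ => p) rfl fun t ht => ?_
    rw [Icc_self]
    exact HasFDerivWithinAt.of_subsingleton subsingleton_singleton
  set r := ρ + 1 with hr
  have hr0 : 0 ≤ r := by linarith [norm_nonneg p]
  set clamp : ℝ × ℝ → ℝ × ℝ := fun z => (max (-r) (min r z.1), max (-r) (min r z.2)) with hclamp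
  have hc1 : LipschitzWith 1 clamp := by
    have h1 : LipschitzWith 1 fun z : ℝ × ℝ => max (-r) (min r z.1) :=
      (LipschitzWith.prod_fst.const_min r).const_max (-r)
    have h2 : LipschitzWith 1 fun z : ℝ × ℝ => max (-r) (min r z.2) :=
      (LipschitzWith.prod_snd.const_min r).const_max (-r)
    simpa using h1.prodMk h2
  have hcm : ∀ z, clamp z ∈ Metric.closedBall (0 : ℝ × ℝ) r := by
    intro z
    have : ∀ w : ℝ, |max (-r) (min r w)| ≤ r := fun w =>
      abs_le.2 ⟨le_max_left _ _, max_le (by linarith) (min_le_left _ _)⟩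
    rw [mem_closedBall_zero_iff, Prod.norm_def]
    exact max_le (this _) (this _)
  have hce : ∀ z, ‖z‖ ≤ r → clamp z = z := by
    intro z hz
    have h1 := abs_le.1 ((norm_fst_le z).trans hz)
    have h2 := abs_le.1 ((norm_snd_le z).trans hz)
    simp only [hclamp, min_eq_right h1.2, min_eq_right h2.2, max_eq_right h1.1, max_eq_right h2.1]
  obtain ⟨K, hK⟩ := hX.exists_lipschitzOnWith_closedBall 0 r
  obtain ⟨L, hL⟩ := (isCompact_closedBall (0 : ℝ × ℝ) r).exists_bound_of_continuousOn
    hX.continuous.continuousOn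
  have hlip : LipschitzWith K (X ∘ clamp) := by
    have := hK.comp (hc1.lipschitzOnWith (s := univ)) (fun z _ => hcm z)
    rwa [mul_one, lipschitzOnWith_univ] at this
  have hL0 : 0 ≤ L := (norm_nonneg _).trans (hL _ (hcm 0))
  obtain ⟨σ, h0, hσ⟩ := exists_solution_of_lipschitz_of_bounded (v := fun _ => X ∘ clamp) hT hL0
    (fun _ _ => hlip) (fun _ => continuousOn_const) (fun _ _ z => hL _ (hcm z)) p
  have hcont : ContinuousOn σ (Icc 0 T) := fun t ht => (hσ t ht).continuousWithinAt
  have hbd : ∀ t ∈ Icc 0 T, ‖σ t‖ ≤ r := by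
    by_contra! hcon
    obtain ⟨t, ht, htr⟩ := hcon
    obtain ⟨t₁, ht₁, he, hlt⟩ := exists_first_eq (h := fun t => r - ‖σ t‖) (c := 0)
      (continuousOn_const.sub hcont.norm) (by simp only [h0]; linarith) ⟨t, ht, by linarith⟩
    have := hρ t₁ ⟨ht₁.1.le, ht₁.2⟩ σ h0 fun q hq => by
      have h1 := (hσ q ⟨hq.1, hq.2.trans ht₁.2⟩).mono (Icc_subset_Icc_right ht₁.2)
      rwa [Function.comp_apply, hce] at h1
      rcases hq.2.eq_or_lt with rfl | h2
      · linarith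
      · linarith [hlt q ⟨hq.1, h2⟩]
    linarith
  refine ⟨σ, h0, fun t ht => ?_⟩
  have h1 := hσ t ht
  rwa [Function.comp_apply, hce _ (hbd t ht)] at h1

/-- If the solutions starting at `p` are bounded on bounded time intervals, one of them is defined
for all positive times. -/
theorem exists_isForwardSolution {X : ℝ × ℝ → ℝ × ℝ} (hX : ContDiff ℝ 1 X) {p : ℝ × ℝ}
    (hρ : ∀ T ≥ 0, ∃ ρ, ∀ q ∈ Icc 0 T, ∀ σ : ℝ → ℝ × ℝ, σ 0 = p →
      (∀ t ∈ Icc 0 q, HasDerivWithinAt σ (X (σ t)) (Icc 0 q) t) → ‖σ q‖ ≤ ρ) :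
    ∃ σ, IsForwardSolution X p σ := by
  have hex : ∀ n : ℕ, ∃ σ : ℝ → ℝ × ℝ, σ 0 = p ∧
      ∀ t ∈ Icc 0 (n : ℝ), HasDerivWithinAt σ (X (σ t)) (Icc 0 (n : ℝ)) t := fun n => by
    obtain ⟨ρ, h⟩ := hρ n n.cast_nonneg
    exact exists_solution_of_bound hX n.cast_nonneg h
  choose α hα0 hα using hex
  have hagree : ∀ m n : ℕ, m ≤ n → EqOn (α m) (α n) (Icc 0 (m : ℝ)) := fun m n hmn =>
    eqOn_Icc_of_hasDerivWithinAt hX (hα m)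
      (fun t ht => ((hα n t ⟨ht.1, ht.2.trans (Nat.cast_le.2 hmn)⟩).mono
        (Icc_subset_Icc_right (Nat.cast_le.2 hmn)))) (by rw [hα0, hα0])
  set σ : ℝ → ℝ × ℝ := fun t => α ⌈t⌉₊ t with hσ
  have hσn : ∀ n : ℕ, EqOn σ (α n) (Icc 0 (n : ℝ)) := fun n t ht =>
    hagree _ n (Nat.ceil_le.2 ht.2) ⟨ht.1, Nat.le_ceil t⟩
  refine ⟨σ, by simp [hσ, hα0], fun t ht => ?_⟩
  obtain ⟨n, hn⟩ := exists_nat_gt t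
  have h1 := (hα n t ⟨ht, hn.le⟩).congr (hσn n) (hσn n ⟨ht, hn.le⟩)
  rw [← hσn n ⟨ht, hn.le⟩] at h1
  refine h1.mono_of_mem_nhdsWithin ?_
  rw [← Ici_inter_Iic]
  exact inter_mem_nhdsWithin _ (Iic_mem_nhds hn)

theorem lienard_eq (a b c d : ℝ) (p : ℝ × ℝ) :
    lienard a b c d p = (p.2 - lienardCurve a b c d p.1, -p.1) := rfl

theorem contDiff_lienard (a b c d : ℝ) : ContDiff ℝ 1 (lienard a b c d) := by
  unfold lienard
  fun_prop

/-- The curve `y = F x - W x` is invariant: the height above it solves a linear equation. -/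
theorem hasDerivWithinAt_height {a b c d : ℝ} {W : ℝ → ℝ} {σ : ℝ → ℝ × ℝ} {s : Set ℝ} {t : ℝ}
    (hpos : W (σ t).1 ≠ 0)
    (hW : HasDerivAt W (lienardDamping a b c d (σ t).1 - (σ t).1 / W (σ t).1) (σ t).1)
    (hσ : HasDerivWithinAt σ (lienard a b c d (σ t)) s t) :
    HasDerivWithinAt (fun t => (σ t).2 - (lienardCurve a b c d (σ t).1 - W (σ t).1))
      (-((σ t).1 / W (σ t).1) * ((σ t).2 - (lienardCurve a b c d (σ t).1 - W (σ t).1))) s t := by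
  have h1 := hσ.snd_comp.sub
    (((hasDerivAt_lienardCurve a b c d (σ t).1).sub hW).comp_hasDerivWithinAt t hσ.fst_comp)
  refine h1.congr_deriv ?_
  rw [lienard_eq]
  field_simp
  ring

namespace IsSeparatrix

variable {a b c d : ℝ} {W : ℝ → ℝ}

theorem exists_abs_le (ha : 0 < a) (h : IsSeparatrix a b c d W) :
    ∃ C, ∀ x, |x| ≤ lienardCurve a b c d x - W x + C := by
  obtain ⟨B, hB⟩ := h.bdd
  have hright : ∀ {b c d : ℝ}, ∃ C, ∀ x, 0 ≤ x → x ≤ lienardCurve a b c d x + C := by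
    intro b c d
    obtain ⟨X, hX, H⟩ := exists_damping_bounds ha b c d
    obtain ⟨C, hC⟩ := (isCompact_Icc (a := 0) (b := X)).exists_bound_of_continuousOn
      (continuous_lienardCurve a b c d).continuousOn
    refine ⟨C + X, fun x hx => ?_⟩
    rcases le_total x X with hxX | hxX
    · have := (abs_le.1 (hC x ⟨hx, hxX⟩)).1
      linarith
    · have := le_of_hasDerivWithinAt_nonneg (p := X) (q := x)
        (h := fun x => lienardCurve a b c d x - x)
        (fun r _ => ((hasDerivAt_lienardCurve a b c d r).sub (hasDerivAt_id r)).hasDerivWithinAt)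
        (fun r hr => by
          have := (H r hr.1).1
          linarith [hr.1]) x ⟨hxX, le_rfl⟩
      have h2 := (abs_le.1 (hC X ⟨by linarith, le_rfl⟩)).1
      linarith
  obtain ⟨C₁, h₁⟩ := hright (b := b) (c := c) (d := d)
  obtain ⟨C₂, h₂⟩ := hright (b := -b) (c := c) (d := -d)
  refine ⟨B + max C₁ C₂, fun x => ?_⟩
  have := hB x
  rcases le_total 0 x with hx | hx
  · rw [abs_of_nonneg hx]
    linarith [h₁ x hx, le_max_left C₁ C₂]
  · have h3 := h₂ (-x) (by linarith)
    rw [← lienardCurve_neg, neg_neg] at h3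
    rw [abs_of_nonpos hx]
    linarith [le_max_right C₁ C₂]

/-- The orbits above the separatrix are defined for all positive times, and stay above it. -/
theorem exists_isInnerSol (ha : 0 < a) (h : IsSeparatrix a b c d W) {p : ℝ × ℝ}
    (hp : lienardCurve a b c d p.1 - W p.1 < p.2) :
    ∃ σ, IsForwardSolution (lienard a b c d) p σ ∧ IsInnerSol W (fun t => (σ t).1)
      (fun t => (σ t).2 - (lienardCurve a b c d (σ t).1 - W (σ t).1)) := by
  obtain ⟨C, hC⟩ := h.exists_abs_le ha
  have hY : ∀ q : ℝ, ∀ σ : ℝ → ℝ × ℝ, σ 0 = p →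
      (∀ t ∈ Icc 0 q, HasDerivWithinAt σ (lienard a b c d (σ t)) (Icc 0 q) t) →
      ∀ t ∈ Icc 0 q, 0 < (σ t).2 - (lienardCurve a b c d (σ t).1 - W (σ t).1) := by
    intro q σ h0 hσ
    have hcont : ContinuousOn (fun t => (σ t).1) (Icc 0 q) := fun t ht =>
      (hσ t ht).fst_comp.continuousWithinAt
    refine pos_of_hasDerivWithinAt_mul (g := fun t => -((σ t).1 / W (σ t).1))
      (hcont.div (h.continuous.comp_continuousOn hcont) fun t _ => (h.pos _).ne').neg
      (fun t ht => hasDerivWithinAt_height (h.pos _).ne' (h.hasDerivAt _) (hσ t ht)) ?_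
    rw [h0]
    linarith
  obtain ⟨σ, hσ⟩ := exists_isForwardSolution (contDiff_lienard a b c d) (p := p) (by
    intro T hT
    refine ⟨(p.2 + C) * Real.exp T + |C|, fun q hq σ h0 hσ => ?_⟩
    have hpos := hY q σ h0 hσ
    have hexp := le_of_hasDerivWithinAt_nonpos (p := 0) (q := q)
      (h := fun t => ((σ t).2 + C) * Real.exp (-t))
      (h' := fun t => -(σ t).1 * Real.exp (-t) + ((σ t).2 + C) * (Real.exp (-t) * -1))
      (fun t ht => ((hσ t ht).snd_comp.add_const C).mul
        ((hasDerivAt_id t).neg.exp).hasDerivWithinAt)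
      (fun t ht => by
        have h1 := hpos t ht
        have h2 := hC (σ t).1
        have h3 := neg_abs_le (σ t).1
        have h4 : -(σ t).1 * Real.exp (-t) + ((σ t).2 + C) * (Real.exp (-t) * -1)
          = (-(σ t).1 - ((σ t).2 + C)) * Real.exp (-t) := by ring
        rw [h4]
        exact mul_nonpos_of_nonpos_of_nonneg (by linarith) (Real.exp_pos _).le) q
      ⟨hq.1, le_rfl⟩
    simp only [neg_zero, Real.exp_zero, mul_one, h0] at hexp
    have h1 := hpos q ⟨hq.1, le_rfl⟩
    have h2 := hC (σ q).1
    have hp0 : 0 ≤ p.2 + C := by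
      have := hC p.1
      linarith [abs_nonneg p.1]
    have h3 : (σ q).2 + C ≤ (p.2 + C) * Real.exp T := by
      rw [Real.exp_neg, ← div_eq_mul_inv, div_le_iff₀ (Real.exp_pos q)] at hexp
      exact hexp.trans (mul_le_mul_of_nonneg_left (Real.exp_le_exp.2 hq.2) hp0)
    have h4 := neg_abs_le C
    have h5 := le_abs_self C
    have h6 := abs_nonneg (σ q).1
    rw [Prod.norm_def]
    refine max_le ?_ ?_
    · rw [Real.norm_eq_abs]
      linarith
    · rw [Real.norm_eq_abs, abs_le]
      constructor <;> linarith)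
  refine ⟨σ, hσ, fun t ht => ?_, fun t ht => ?_, fun t ht => ?_⟩
  · refine (hσ.2 t ht).fst_comp.congr_deriv ?_
    rw [lienard_eq]
    ring
  · refine (hasDerivWithinAt_height (h.pos _).ne' (h.hasDerivAt _) (hσ.2 t ht)).congr_deriv ?_
    ring
  · exact hY t σ hσ.1 (fun r hr => (hσ.2 r hr.1).mono fun z hz => hz.1) t ⟨ht, le_rfl⟩

end IsSeparatrix

/-! ### Homoclinic loops at infinity are graphs of separatrices -/

/-- An orbit of the Liénard system, with time interval `I`, whose height `y` tends to infinity at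
both ends of `I`. -/
structure IsLoopOrbit (a b c d : ℝ) (I : Set ℝ) (x y : ℝ → ℝ) : Prop where
  ordConnected : I.OrdConnected
  isOpen : IsOpen I
  dx : ∀ t ∈ I, HasDerivAt x (y t - lienardCurve a b c d (x t)) t
  dy : ∀ t ∈ I, HasDerivAt y (-x t) t
  top : ∀ N, ∃ t₀ ∈ I, ∀ t ∈ I, t₀ ≤ t → N < y t
  bot : ∀ N, ∃ t₀ ∈ I, ∀ t ∈ I, t ≤ t₀ → N < y t

theorem nonpos_of_hasDerivWithinAt_mul {g u : ℝ → ℝ} {p q : ℝ} (hg : ContinuousOn g (Icc p q))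
    (hu : ∀ t ∈ Icc p q, HasDerivWithinAt u (g t * u t) (Icc p q) t) (hp : u p ≤ 0) :
    ∀ t ∈ Icc p q, u t ≤ 0 := by
  rcases hp.lt_or_eq with h | h
  · intro t ht
    have := pos_of_hasDerivWithinAt_mul (u := fun t => - u t) hg
      (fun t ht => (hu t ht).fun_neg.congr_deriv (by ring)) (by linarith) t ht
    linarith
  · obtain ⟨G, hG⟩ := isCompact_Icc.exists_bound_of_continuousOn hg
    have := ODE_solution_unique_of_mem_Icc_right (v := fun t u => g t * u) (f := u)
      (g := fun _ => 0) (s := fun _ => univ) (a := p) (b := q) (K := Real.toNNReal G)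
      (fun t ht => (LipschitzWith.of_dist_le_mul fun w z => by
        rw [Real.dist_eq, Real.dist_eq, ← mul_sub, abs_mul]
        exact mul_le_mul_of_nonneg_right
          ((hG t (Ico_subset_Icc_self ht)).trans (Real.le_coe_toNNReal G))
          (abs_nonneg _)).lipschitzOnWith)
      (fun t ht => (hu t ht).continuousWithinAt)
      (fun t ht => (hu t (Ico_subset_Icc_self ht)).Ici_of_Icc ht) (fun _ _ => mem_univ _)
      continuousOn_const
      (fun t _ => by simpa using hasDerivWithinAt_const t (Ici t) (0 : ℝ))
      (fun _ _ => mem_univ _) h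
    exact fun t ht => (this ht).le

namespace IsLoopOrbit

variable {a b c d : ℝ} {I : Set ℝ} {x y : ℝ → ℝ} {s t : ℝ}

/-- The symmetry `(x, t) ↦ (-x, -t)`. -/
theorem reflect (h : IsLoopOrbit a b c d I x y) :
    IsLoopOrbit a (-b) c (-d) (-I) (fun t => - x (-t)) (fun t => y (-t)) where
  ordConnected := by
    constructor
    intro s hs t ht r hr
    exact h.ordConnected.out (mem_neg.1 ht) (mem_neg.1 hs)
      ⟨neg_le_neg hr.2, neg_le_neg hr.1⟩
  isOpen := h.isOpen.neg
  dx t ht := by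
    have h1 := ((h.dx (-t) ht).scomp t (hasDerivAt_neg t)).neg
    refine h1.congr_deriv ?_
    rw [← lienardCurve_neg, neg_neg]
    simp
  dy t ht := by
    have h1 := (h.dy (-t) ht).scomp t (hasDerivAt_neg t)
    refine h1.congr_deriv ?_
    simp
  top N := by
    obtain ⟨t₀, ht₀, h1⟩ := h.bot N
    exact ⟨-t₀, by simpa using ht₀, fun t ht htt => h1 (-t) ht (by linarith)⟩
  bot N := by
    obtain ⟨t₀, ht₀, h1⟩ := h.top N
    exact ⟨-t₀, by simpa using ht₀, fun t ht htt => h1 (-t) ht (by linarith)⟩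

theorem dx' (h : IsLoopOrbit a b c d I x y) (hs : s ∈ I) (ht : t ∈ I) {r : ℝ}
    (hr : r ∈ Icc s t) :
    HasDerivWithinAt x (y r - lienardCurve a b c d (x r)) (Icc s t) r :=
  (h.dx r (h.ordConnected.out hs ht hr)).hasDerivWithinAt

theorem dy' (h : IsLoopOrbit a b c d I x y) (hs : s ∈ I) (ht : t ∈ I) {r : ℝ}
    (hr : r ∈ Icc s t) : HasDerivWithinAt y (-x r) (Icc s t) r :=
  (h.dy r (h.ordConnected.out hs ht hr)).hasDerivWithinAt

theorem continuousOn_x (h : IsLoopOrbit a b c d I x y) (hs : s ∈ I) (ht : t ∈ I) :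
    ContinuousOn x (Icc s t) := fun _ hr => (h.dx' hs ht hr).continuousWithinAt

/-- Close to the right end of the time interval, after any given time, `y` exceeds any bound. -/
theorem exists_gt (h : IsLoopOrbit a b c d I x y) (hs : s ∈ I) (N : ℝ) :
    ∃ t ∈ I, s ≤ t ∧ ∀ r ∈ I, t ≤ r → N < y r := by
  obtain ⟨t, ht, h1⟩ := h.top N
  refine ⟨max s t, ?_, le_max_left _ _, fun r hr hle => h1 r hr ((le_max_right _ _).trans hle)⟩
  rcases max_choice s t with h2 | h2 <;> rw [h2] <;> assumption

/-- Close to the right end, `x < 0`: where `y > 0`, the line `x = 0` is crossed to the right only,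
and `y` decreases on the right. -/
theorem exists_neg (h : IsLoopOrbit a b c d I x y) :
    ∃ t₀ ∈ I, ∀ t ∈ I, t₀ ≤ t → x t < 0 := by
  obtain ⟨t₀, ht₀, hy⟩ := h.top 0
  refine ⟨t₀, ht₀, fun s hs hst => ?_⟩
  by_contra! hcon
  have hF0 : lienardCurve a b c d 0 = 0 := by simp [lienardCurve]
  have hx : ∀ t ∈ I, s ≤ t → 0 ≤ x t := by
    intro t ht hle
    have := nonpos_of_hasDerivWithinAt_neg (p := s) (q := t) (h := fun t => - x t)
      (fun r hr => (h.dx' hs ht hr).fun_neg) (by linarith)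
      (fun r hr h0 => by
        have h1 : x r = 0 := by linarith
        have := hy r (h.ordConnected.out hs ht hr) (hst.trans hr.1)
        rw [h1, hF0]
        linarith) t ⟨hle, le_rfl⟩
    linarith
  obtain ⟨t, ht, hst', h1⟩ := h.exists_gt hs (y s)
  have := le_of_hasDerivWithinAt_nonpos (p := s) (q := t) (fun r hr => h.dy' hs ht hr)
    (fun r hr => by linarith [hx r (h.ordConnected.out hs ht hr) hr.1]) t ⟨hst', le_rfl⟩
  linarith [h1 t ht le_rfl]

/-- There is a first point on the line `x = 0`. -/
theorem exists_first_zero (h : IsLoopOrbit a b c d I x y) :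
    ∃ t₀ ∈ I, x t₀ = 0 ∧ ∀ t ∈ I, t < t₀ → 0 < x t := by
  obtain ⟨q, hq, hxq⟩ := h.exists_neg
  obtain ⟨p, hp, hxp⟩ := h.reflect.exists_neg
  have hxp' : ∀ t ∈ I, t ≤ -p → 0 < x t := fun t ht htp => by
    have := hxp (-t) (by simpa using ht) (by linarith)
    simp only [neg_neg] at this
    linarith
  have hpq : -p < q := by
    by_contra! hle
    linarith [hxp' (-p) hp le_rfl, hxq (-p) hp hle]
  obtain ⟨t₀, ht₀, he, hlt⟩ := exists_first_eq (h := x) (c := 0) (h.continuousOn_x hp hq)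
    (hxp' _ hp le_rfl) ⟨q, ⟨hpq.le, le_rfl⟩, (hxq q hq le_rfl).le⟩
  refine ⟨t₀, h.ordConnected.out hp hq ⟨ht₀.1.le, ht₀.2⟩, he, fun t ht htt => ?_⟩
  rcases le_total t (-p) with h1 | h1
  · exact hxp' t ht h1
  · exact hlt t ⟨h1, htt⟩

/-- After its last point on the line `x = 0`, the orbit escapes to the left, below the isocline. -/
theorem exists_last_zero (h : IsLoopOrbit a b c d I x y) :
    ∃ t₀ ∈ I, x t₀ = 0 ∧ y t₀ < 0 ∧
      (∀ t ∈ I, t₀ < t → x t < 0 ∧ y t < lienardCurve a b c d (x t)) ∧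
      ∀ N, ∃ t ∈ I, t₀ < t ∧ x t < -N := by
  obtain ⟨t₁, ht₁, hx₁, hlt⟩ := h.reflect.exists_first_zero
  set t₀ := -t₁ with ht₀def
  have ht₀ : t₀ ∈ I := ht₁
  have hx₀ : x t₀ = 0 := by linarith
  have hneg : ∀ t ∈ I, t₀ < t → x t < 0 := fun t ht htt => by
    have := hlt (-t) (by simpa using ht) (by linarith)
    rw [neg_neg] at this
    linarith
  have hF0 : lienardCurve a b c d 0 = 0 := by simp [lienardCurve]
  have hFc := continuous_lienardCurve a b c d
  have hnext : ∃ q ∈ I, t₀ < q := by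
    obtain ⟨e, he, hI⟩ := Metric.isOpen_iff.1 h.isOpen t₀ ht₀
    exact ⟨t₀ + e / 2, hI (by rw [Metric.mem_ball, Real.dist_eq, abs_lt]; constructor <;> linarith),
      by linarith⟩
  have hy₀ : y t₀ < 0 := by
    rcases lt_trichotomy (y t₀) 0 with h0 | h0 | h0
    · exact h0
    · -- the orbit would be the singular point
      exfalso
      obtain ⟨t, ht, htt, h1⟩ := h.exists_gt ht₀ 0
      have := eqOn_Icc_of_hasDerivWithinAt (contDiff_lienard a b c d) (p := t₀) (q := t)
        (σ₁ := fun t => (x t, y t)) (σ₂ := fun _ => 0)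
        (fun r hr => (h.dx' ht₀ ht hr).prodMk (h.dy' ht₀ ht hr))
        (fun r _ => by
          have : lienard a b c d 0 = 0 := by simp [lienard]
          rw [this]
          exact hasDerivWithinAt_const _ _ _) (by simp [hx₀, h0]) (right_mem_Icc.2 htt)
      have h2 : y t = 0 := congrArg Prod.snd this
      linarith [h1 t ht le_rfl]
    · exfalso
      obtain ⟨q, hq, htq⟩ := hnext
      have hev : ∀ᶠ r in 𝓝[>] t₀, 0 < y r - lienardCurve a b c d (x r) := by
        refine eventually_nhdsWithin_of_eventually_nhds
          (((h.dy t₀ ht₀).continuousAt.sub (hFc.continuousAt.comp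
            (h.dx t₀ ht₀).continuousAt)).eventually (lt_mem_nhds (a := 0) ?_))
        simp only [Pi.sub_apply, Function.comp_apply, hx₀, hF0]
        linarith
      obtain ⟨m, hm, hev⟩ := mem_nhdsGT_iff_exists_Ioc_subset.1
        (inter_mem hev (Ioc_mem_nhdsGT htq))
      have hmI := h.ordConnected.out ht₀ hq ⟨(hev (right_mem_Ioc.2 hm)).2.1.le,
        (hev (right_mem_Ioc.2 hm)).2.2⟩
      have h1 := le_of_hasDerivWithinAt_nonneg (p := t₀) (q := m)
        (fun r hr => h.dx' ht₀ hmI hr) (fun r hr => by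
          rcases hr.1.eq_or_lt with rfl | h2
          · rw [hx₀, hF0]
            linarith
          · exact (hev ⟨h2, hr.2⟩).1.le) m ⟨le_of_lt hm, le_rfl⟩
      linarith [hneg m hmI hm]
  have hbelow : ∀ t ∈ I, t₀ < t → y t < lienardCurve a b c d (x t) := by
    intro s hs hts
    by_contra! hcon
    have hxs := hneg s hs hts
    have hsp : ∀ t ∈ I, s ≤ t → lienardCurve a b c d (x t) ≤ y t := by
      intro t ht hst
      have := nonpos_of_hasDerivWithinAt_neg (p := s) (q := t)
        (h := fun t => lienardCurve a b c d (x t) - y t)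
        (fun r hr => ((hasDerivAt_lienardCurve a b c d (x r)).comp_hasDerivWithinAt r
          (h.dx' hs ht hr)).sub (h.dy' hs ht hr)) (by linarith)
        (fun r hr h0 => by
          have h1 : y r - lienardCurve a b c d (x r) = 0 := by linarith
          have := hneg r (h.ordConnected.out hs ht hr) (hts.trans_le hr.1)
          rw [h1, mul_zero]
          linarith) t ⟨hst, le_rfl⟩
      linarith
    have hmono : ∀ t ∈ I, s ≤ t → x s ≤ x t := fun t ht hst =>
      le_of_hasDerivWithinAt_nonneg (fun r hr => h.dx' hs ht hr)
        (fun r hr => by linarith [hsp r (h.ordConnected.out hs ht hr) hr.1]) t ⟨hst, le_rfl⟩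
    obtain ⟨C, hC⟩ := (isCompact_Icc (a := x s) (b := 0)).exists_bound_of_continuousOn
      hFc.continuousOn
    obtain ⟨p, hp, hsp', hyp⟩ := h.exists_gt hs (C + 1)
    obtain ⟨q, hq, hpq, hyq⟩ := h.exists_gt hp (y p + (-x s) * (-x s))
    have hI := fun r (hr : r ∈ Icc p q) => h.ordConnected.out hp hq hr
    have h1 := le_of_hasDerivWithinAt_nonneg (p := p) (q := q) (h := fun t => x t - t)
      (fun r hr => (h.dx' hp hq hr).sub (hasDerivWithinAt_id r _))
      (fun r hr => by
        have h2 := hyp r (hI r hr) hr.1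
        have h3 := (le_abs_self _).trans (hC (x r) ⟨hmono r (hI r hr) (hsp'.trans hr.1),
          (hneg r (hI r hr) (hts.trans_le (hsp'.trans hr.1))).le⟩)
        linarith) q ⟨hpq, le_rfl⟩
    have h2 := le_of_hasDerivWithinAt_nonpos (p := p) (q := q) (h := fun t => y t - (-x s) * t)
      (fun r hr => (h.dy' hp hq hr).sub ((hasDerivWithinAt_id r _).const_mul (-x s)))
      (fun r hr => by linarith [hmono r (hI r hr) (hsp'.trans hr.1)]) q ⟨hpq, le_rfl⟩
    have h3 := hneg q hq (hts.trans_le (hsp'.trans hpq))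
    have h4 := hmono p hp hsp'
    have h5 := hyq q hq le_rfl
    have h6 : (-x s) * (q - p) ≤ (-x s) * (-x s) :=
      mul_le_mul_of_nonneg_left (by linarith) (by linarith)
    linarith
  refine ⟨t₀, ht₀, hx₀, hy₀, fun t ht htt => ⟨hneg t ht htt, hbelow t ht htt⟩, fun N => ?_⟩
  obtain ⟨q, hq, htq⟩ := hnext
  obtain ⟨C, hC⟩ := (isCompact_Icc (a := -N) (b := 0)).exists_bound_of_continuousOn
      hFc.continuousOn
  obtain ⟨t, ht, hqt, hyt⟩ := h.exists_gt hq C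
  have htt := htq.trans_le hqt
  refine ⟨t, ht, htt, ?_⟩
  by_contra! hcon
  have h1 := (le_abs_self _).trans (hC (x t) ⟨hcon, (hneg t ht htt).le⟩)
  linarith [hbelow t ht htt, hyt t ht le_rfl]

/-- A piece of the orbit below the isocline is a graph over the `x`-axis. -/
theorem exists_graph (h : IsLoopOrbit a b c d I x y) {J : Set ℝ} (hJI : J ⊆ I)
    (hJ : IsOpen J) (hJc : J.OrdConnected)
    (hlt : ∀ t ∈ J, y t < lienardCurve a b c d (x t)) :
    ∃ W : ℝ → ℝ, ∀ t ∈ J, y t = lienardCurve a b c d (x t) - W (x t) ∧ 0 < W (x t) ∧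
      HasDerivAt W (lienardDamping a b c d (x t) - x t / W (x t)) (x t) := by
  have hanti : StrictAntiOn x J := by
    refine strictAntiOn_of_deriv_neg hJc.convex
      (fun t ht => (h.dx t (hJI ht)).continuousAt.continuousWithinAt) fun t ht => ?_
    rw [(h.dx t (hJI (interior_subset ht))).deriv]
    linarith [hlt t (interior_subset ht)]
  set T := Function.invFunOn x J with hT
  have hTx : ∀ t ∈ J, T (x t) = t := fun t ht => hanti.injOn.leftInvOn_invFunOn ht
  refine ⟨fun z => lienardCurve a b c d z - y (T z), fun t ht => ?_⟩
  have hl := hlt t ht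
  simp only [hTx t ht]
  refine ⟨by ring, by linarith, ?_⟩
  have hder : ∀ᶠ r in 𝓝 t, HasDerivAt x (y r - lienardCurve a b c d (x r)) r :=
    (hJ.eventually_mem ht).mono fun r hr => h.dx r (hJI hr)
  have hstrict : HasStrictDerivAt x (y t - lienardCurve a b c d (x t)) t :=
    hasStrictDerivAt_of_hasDerivAt_of_continuousAt (f' := fun r => y r - lienardCurve a b c d (x r))
      hder ((h.dy t (hJI ht)).continuousAt.sub
        ((continuous_lienardCurve a b c d).continuousAt.comp (h.dx t (hJI ht)).continuousAt))
  have hTd := (hstrict.to_local_left_inverse (by linarith)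
    ((hJ.eventually_mem ht).mono hTx)).hasDerivAt
  have hyT : HasDerivAt (fun z => y (T z)) _ (x t) :=
    HasDerivAt.comp (x t) (by rw [hTx t ht]; exact h.dy t (hJI ht)) hTd
  refine ((hasDerivAt_lienardCurve a b c d (x t)).sub hyT).congr_deriv ?_
  have h1 : y t - lienardCurve a b c d (x t) ≠ 0 := by linarith
  have h2 : lienardCurve a b c d (x t) - y t ≠ 0 := by linarith
  field_simp
  ring

/-- If the orbit meets the line `x = 0` below the isocline before it does so for the last time, it
winds outwards on the left: otherwise it would be trapped below its final piece. -/
theorem lt_of_last_zero (h : IsLoopOrbit a b c d I x y) {t₀ : ℝ} (ht₀ : t₀ ∈ I) (hx₀ : x t₀ = 0)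
    (hy₀ : y t₀ < 0) (hbelow : ∀ t ∈ I, t₀ < t → x t < 0 ∧ y t < lienardCurve a b c d (x t))
    (hfar : ∀ N, ∃ t ∈ I, t₀ < t ∧ x t < -N) (hs : s ∈ I) (hxs : x s = 0) (hys : y s < 0)
    (hst : s < t₀) : y t₀ < y s := by
  by_contra! hcon
  have hF0 : lienardCurve a b c d 0 = 0 := by simp [lienardCurve]
  have hFc := continuous_lienardCurve a b c d
  have hcont : ∀ t ∈ I, ContinuousAt (fun t => y t - lienardCurve a b c d (x t)) t := fun t ht =>
    (h.dy t ht).continuousAt.sub (hFc.continuousAt.comp (h.dx t ht).continuousAt)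
  -- the final piece of the orbit is the graph of `F - W` over the half-line `x ≤ 0`
  obtain ⟨m, hm, hev⟩ := mem_nhdsLT_iff_exists_Ico_subset.1
    (inter_mem (mem_nhdsWithin_of_mem_nhds ((hcont t₀ ht₀).eventually (gt_mem_nhds
      (show y t₀ - lienardCurve a b c d (x t₀) < 0 by rw [hx₀, hF0]; linarith)))) (Ioo_mem_nhdsLT hst))
  have hm : m < t₀ := hm
  have hmI : m ∈ I := h.ordConnected.out hs ht₀ ⟨(hev ⟨le_rfl, hm⟩).2.1.le, hm.le⟩
  obtain ⟨W, hW⟩ := h.exists_graph (J := I ∩ Ioi m) inter_subset_left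
    (h.isOpen.inter isOpen_Ioi) (h.ordConnected.inter ordConnected_Ioi) (by
      rintro t ⟨ht, hmt⟩
      rcases lt_trichotomy t t₀ with h1 | rfl | h1
      · have : y t - lienardCurve a b c d (x t) < 0 := (hev ⟨le_of_lt hmt, h1⟩).1
        linarith
      · rw [hx₀, hF0]
        exact hy₀
      · exact (hbelow t ht h1).2)
  have hW' : ∀ z ≤ 0, 0 < W z ∧ HasDerivAt W (lienardDamping a b c d z - z / W z) z := by
    intro z hz
    obtain ⟨t, ht, htt, hxt⟩ := hfar (-z)
    obtain ⟨r, hr, hxr⟩ := intermediate_value_Icc' htt.le (h.continuousOn_x ht₀ ht)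
      (show z ∈ Icc (x t) (x t₀) from ⟨by linarith, by linarith⟩)
    have := (hW r ⟨h.ordConnected.out ht₀ ht hr, hm.trans_le hr.1⟩).2
    rwa [hxr] at this
  have hy₀W : y t₀ = lienardCurve a b c d 0 - W 0 := by
    have := (hW t₀ ⟨ht₀, hm⟩).1
    rwa [hx₀] at this
  -- the first return to `x = 0` after the time `s`
  obtain ⟨m₁, hm₁, hev₁⟩ := mem_nhdsGT_iff_exists_Ioc_subset.1
    (inter_mem (mem_nhdsWithin_of_mem_nhds ((hcont s hs).eventually (gt_mem_nhds
      (show y s - lienardCurve a b c d (x s) < 0 by rw [hxs, hF0]; linarith)))) (Ioc_mem_nhdsGT hst))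
  have hm₁ : s < m₁ := hm₁
  have hm₁t : m₁ ≤ t₀ := (hev₁ ⟨hm₁, le_rfl⟩).2.2
  have hm₁I : m₁ ∈ I := h.ordConnected.out hs ht₀ ⟨hm₁.le, hm₁t⟩
  have hneg : ∀ t ∈ Ioc s m₁, x t < 0 := neg_of_hasDerivWithinAt_neg
    (fun r hr => h.dx' hs hm₁I hr) hxs.le (fun r hr _ => by
      rcases hr.1.eq_or_lt with rfl | h2
      · rw [hxs, hF0]
        linarith
      · exact (hev₁ ⟨h2, hr.2⟩).1)
  obtain ⟨q, hq, hxq, hxlt⟩ := exists_first_eq (h := fun t => - x t) (c := 0)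
    (h.continuousOn_x hm₁I ht₀).neg (by linarith [hneg m₁ ⟨hm₁, le_rfl⟩])
    ⟨t₀, ⟨hm₁t, le_rfl⟩, by linarith⟩
  have hqI : q ∈ I := h.ordConnected.out hs ht₀ ⟨hm₁.le.trans hq.1.le, hq.2⟩
  have hsq : s ≤ q := hm₁.le.trans hq.1.le
  have hx0 : ∀ t ∈ Icc s q, x t ≤ 0 := by
    intro t ht
    rcases ht.1.eq_or_lt with rfl | h1
    · exact hxs.le
    rcases le_total t m₁ with h2 | h2
    · exact (hneg t ⟨h1, h2⟩).le
    rcases ht.2.eq_or_lt with rfl | h3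
    · linarith
    · linarith [hxlt t ⟨h2, h3⟩]
  have hxc := h.continuousOn_x hs hqI
  have hWc : ContinuousOn (fun t => W (x t)) (Icc s q) := fun t ht =>
    ((hW' _ (hx0 t ht)).2.continuousAt.comp_continuousWithinAt (hxc t ht))
  have hle := nonpos_of_hasDerivWithinAt_mul (p := s) (q := q) (g := fun t => -(x t / W (x t)))
    (hxc.div hWc fun t ht => (hW' _ (hx0 t ht)).1.ne').neg
    (fun t ht => hasDerivWithinAt_height (σ := fun t => (x t, y t)) (hW' _ (hx0 t ht)).1.ne'
      (hW' _ (hx0 t ht)).2 ((h.dx' hs hqI ht).prodMk (h.dy' hs hqI ht)))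
    (by simp only [hxs, ← hy₀W]; linarith)
  have := le_of_hasDerivWithinAt_nonpos (p := m₁) (q := q) (fun r hr => h.dx' hm₁I hqI hr)
    (fun r hr => by
      have hr' : r ∈ Icc s q := ⟨hm₁.le.trans hr.1, hr.2⟩
      have h1 := hle r hr'
      have h2 := (hW' _ (hx0 r hr')).1
      simp only at h1
      linarith) q ⟨hq.1.le, le_rfl⟩
  linarith [hneg m₁ ⟨hm₁, le_rfl⟩]

/-- The orbit is the graph of `F - W` for a function `W` on the whole line. -/
theorem exists_graph_univ (h : IsLoopOrbit a b c d I x y) :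
    ∃ W : ℝ → ℝ, (∀ z, 0 < W z ∧ HasDerivAt W (lienardDamping a b c d z - z / W z) z) ∧
      (∀ t ∈ I, y t = lienardCurve a b c d (x t) - W (x t)) ∧ ∀ z, ∃ t ∈ I, x t = z := by
  obtain ⟨t₀, ht₀, hx₀, hy₀, hbelow, hfar⟩ := h.exists_last_zero
  obtain ⟨s, hs, hxs, hys, hbelow', hfar'⟩ := h.reflect.exists_last_zero
  have hF0 : lienardCurve a b c d 0 = 0 := by simp [lienardCurve]
  have hxs' : x (-s) = 0 := by linarith
  have hbef : ∀ t ∈ I, t < -s → 0 < x t ∧ y t < lienardCurve a b c d (x t) := fun t ht hts => by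
    have := hbelow' (-t) (by simpa using ht) (by linarith)
    rw [← lienardCurve_neg] at this
    simp only [neg_neg] at this
    exact ⟨by linarith, this.2⟩
  have hst : -s = t₀ := by
    rcases lt_trichotomy (-s) t₀ with h1 | h1 | h1
    · have h2 := h.lt_of_last_zero ht₀ hx₀ hy₀ hbelow hfar hs hxs' hys h1
      have h3 := h.reflect.lt_of_last_zero hs hxs hys hbelow' hfar' (s := -t₀)
        (by simpa using ht₀) (by simp [hx₀]) (by simpa using hy₀) (by linarith)
      rw [neg_neg] at h3
      linarith
    · exact h1
    · linarith [(hbef t₀ ht₀ h1).1]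
  rw [hst] at hbef
  have hlt : ∀ t ∈ I, y t < lienardCurve a b c d (x t) := by
    intro t ht
    rcases lt_trichotomy t t₀ with h1 | rfl | h1
    · exact (hbef t ht h1).2
    · rw [hx₀, hF0]
      exact hy₀
    · exact (hbelow t ht h1).2
  have hsurj : ∀ z, ∃ t ∈ I, x t = z := by
    intro z
    obtain ⟨p, hp, hsp, hxp⟩ := hfar' z
    obtain ⟨q, hq, htq, hxq⟩ := hfar (-z)
    obtain ⟨r, hr, hxr⟩ := intermediate_value_Icc' (show -p ≤ q by linarith)
      (h.continuousOn_x hp hq) (show z ∈ Icc (x q) (x (-p)) from ⟨by linarith, by linarith⟩)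
    exact ⟨r, h.ordConnected.out hp hq hr, hxr⟩
  obtain ⟨W, hW⟩ := h.exists_graph subset_rfl h.isOpen h.ordConnected hlt
  refine ⟨W, fun z => ?_, fun t ht => (hW t ht).1, hsurj⟩
  obtain ⟨t, ht, rfl⟩ := hsurj z
  exact (hW t ht).2

end IsLoopOrbit

/-- A solution `W` that exceeds `1` far out grows like `x ^ 3` at least, so that the invariant curve
`F - W`, whose slope is `x / W`, is bounded on the right. -/
theorem exists_forall_ge_le_one {a b c d : ℝ} {W : ℝ → ℝ} (ha : 0 < a)
    (hpos : ∀ z, 0 < W z)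
    (hW : ∀ z, HasDerivAt W (lienardDamping a b c d z - z / W z) z)
    (hunb : ∀ p N, ∃ z ≥ p, N < lienardCurve a b c d z - W z) :
    ∃ X, ∀ z ≥ X, W z ≤ 1 := by
  obtain ⟨X, hX, H⟩ := exists_damping_bounds ha b c d
  refine ⟨X, fun p hp => ?_⟩
  by_contra! hcon
  have hp1 : 1 ≤ p := hX.le.trans hp
  have hslope : ∀ z ≥ p, 1 ≤ W z → 2 * a * z ^ 2 ≤ lienardDamping a b c d z - z / W z := by
    intro z hz hWz
    obtain ⟨h1, h2, -⟩ := H z (hp.trans hz)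
    have h3 : z / W z ≤ z := div_le_self (by linarith) hWz
    have h4 : a * z ^ 2 * 1 ≤ a * z ^ 2 * z :=
      mul_le_mul_of_nonneg_left (by linarith) (by positivity)
    nlinarith
  have hge : ∀ z ≥ p, 1 ≤ W z := by
    intro z hz
    have := le_of_hasDerivWithinAt_nonneg_of_lt (p := p) (q := z) (c := 1)
      (fun r _ => (hW r).hasDerivWithinAt) hcon
      (fun r hr h1 => le_trans (by positivity) (hslope r hr.1 h1.le)) z ⟨hz, le_rfl⟩
    linarith
  set K := max (3 / (2 * a)) (p ^ 3) with hK
  have hK0 : 0 < K := lt_max_of_lt_left (by positivity)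
  have hcube : ∀ z ≥ p, z ^ 3 / K ≤ W z := by
    intro z hz
    have h0 : p ^ 3 / K ≤ 1 := (div_le_one hK0).2 (le_max_right _ _)
    have := le_of_hasDerivWithinAt_nonneg (p := p) (q := z) (h := fun z => W z - z ^ 3 / K)
      (fun r _ => ((hW r).sub ((hasDerivAt_pow 3 r).div_const K)).hasDerivWithinAt)
      (fun r hr => by
        have h1 := hslope r hr.1 (hge r hr.1)
        have h2 : (3 : ℝ) / K ≤ 2 * a := by
          rw [div_le_iff₀ hK0, ← div_le_iff₀' (by positivity)]
          exact le_max_left _ _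
        have h3 : ((3 : ℕ) : ℝ) * r ^ (3 - 1) / K = 3 / K * r ^ 2 := by
          norm_num
          ring
        rw [h3]
        nlinarith [mul_le_mul_of_nonneg_right h2 (sq_nonneg r)]) z ⟨hz, le_rfl⟩
    linarith
  obtain ⟨z, hz, hlt⟩ := hunb p (lienardCurve a b c d p - W p + K / p)
  have := le_of_hasDerivWithinAt_nonpos (p := p) (q := z)
    (h := fun z => lienardCurve a b c d z - W z + K * z⁻¹)
    (fun r hr => (((hasDerivAt_lienardCurve a b c d r).sub (hW r)).add
      ((hasDerivAt_inv (by linarith [hr.1])).const_mul K)).hasDerivWithinAt)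
    (fun r hr => by
      have hr0 : 0 < r := by linarith [hr.1]
      have h1 := hcube r hr.1
      have h2 : r / W r ≤ K * (r ^ 2)⁻¹ := by
        rw [div_le_iff₀ (hpos r)]
        calc r = K * (r ^ 2)⁻¹ * (r ^ 3 / K) := by field_simp
          _ ≤ _ := mul_le_mul_of_nonneg_left h1 (by positivity)
      linarith) z ⟨hz, le_rfl⟩
  have hz0 : 0 < K * z⁻¹ := mul_pos hK0 (inv_pos.2 (by linarith))
  rw [div_eq_mul_inv] at hlt
  linarith

/-- The height of the isocline over a loop is bounded, since `y` is unbounded at both ends. -/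
theorem IsLoopOrbit.exists_isSeparatrix {a b c d : ℝ} {I : Set ℝ} {x y : ℝ → ℝ} (ha : 0 < a)
    (h : IsLoopOrbit a b c d I x y) :
    ∃ W, IsSeparatrix a b c d W ∧
      (fun t => (x t, y t)) '' I = {p | p.2 = lienardCurve a b c d p.1 - W p.1} := by
  obtain ⟨W, hW, hy, hsurj⟩ := h.exists_graph_univ
  have hright : ∀ {b c d : ℝ} {I : Set ℝ} {x y W : ℝ → ℝ}, IsLoopOrbit a b c d I x y →
      (∀ z, 0 < W z ∧ HasDerivAt W (lienardDamping a b c d z - z / W z) z) →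
      (∀ t ∈ I, y t = lienardCurve a b c d (x t) - W (x t)) → (∀ z, ∃ t ∈ I, x t = z) →
      ∃ X, ∀ z ≥ X, W z ≤ 1 := by
    intro b c d I x y W h hW hy hsurj
    refine exists_forall_ge_le_one ha (fun z => (hW z).1) (fun z => (hW z).2) fun p N => ?_
    -- the points of the orbit before the time where it meets `x = p` are on the right of it
    obtain ⟨s, hs, hxs⟩ := hsurj p
    obtain ⟨t₀, ht₀, hN⟩ := h.bot N
    set t := min s t₀ with ht
    have htI : t ∈ I := by
      rcases min_choice s t₀ with h2 | h2 <;> rw [ht, h2] <;> assumption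
    refine ⟨x t, ?_, ?_⟩
    · have := le_of_hasDerivWithinAt_nonpos (p := t) (q := s) (fun r hr => h.dx' htI hs hr)
        (fun r hr => by
          have h1 := hy r (h.ordConnected.out htI hs hr)
          have h2 := (hW (x r)).1
          linarith) s ⟨min_le_left _ _, le_rfl⟩
      linarith
    · rw [← hy t htI]
      exact hN t htI (min_le_right _ _)
  obtain ⟨X₁, h₁⟩ := hright h hW hy hsurj
  obtain ⟨X₂, h₂⟩ := hright (W := fun z => W (-z)) h.reflect
    (fun z => ⟨(hW (-z)).1, by
      have := (hW (-z)).2.scomp z (hasDerivAt_neg z)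
      refine this.congr_deriv ?_
      rw [lienardDamping_neg]
      simp only [smul_eq_mul]
      ring⟩)
    (fun t ht => by
      simp only [neg_neg]
      rw [← lienardCurve_neg, neg_neg]
      exact hy (-t) ht)
    (fun z => by
      obtain ⟨t, ht, hxt⟩ := hsurj (-z)
      exact ⟨-t, by simpa using ht, by simp [hxt]⟩)
  obtain ⟨C, hC⟩ := (isCompact_Icc (a := -X₂) (b := X₁)).exists_bound_of_continuousOn
    (f := W) fun z _ => (hW z).2.continuousAt.continuousWithinAt
  refine ⟨W, ⟨fun z => (hW z).1, fun z => (hW z).2, max 1 C, fun z => ?_⟩, ?_⟩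
  · rcases le_total X₁ z with hz | hz
    · exact (h₁ z hz).trans (le_max_left _ _)
    rcases le_total X₂ (-z) with hz' | hz'
    · have := h₂ (-z) hz'
      rw [neg_neg] at this
      exact this.trans (le_max_left _ _)
    · exact ((le_abs_self _).trans (hC z ⟨by linarith, hz⟩)).trans (le_max_right _ _)
  · ext ⟨z, w⟩
    simp only [mem_image, Prod.mk.injEq, mem_ofPred_eq]
    constructor
    · rintro ⟨t, ht, rfl, rfl⟩
      exact hy t ht
    · intro hw
      obtain ⟨t, ht, rfl⟩ := hsurj z
      exact ⟨t, ht, rfl, by rw [hw, hy t ht]⟩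

/-! ### The Poincaré sphere -/

theorem continuous_toPoincareSphere : Continuous toPoincareSphere := by
  unfold toPoincareSphere
  have h : Continuous fun p : ℝ × ℝ => (!₂[p.1, p.2, 1] : EuclideanSpace ℝ (Fin 3)) := by
    refine (PiLp.continuous_toLp 2 _).comp (continuous_pi fun i => ?_)
    fin_cases i <;> simp <;> fun_prop
  have hs : Continuous fun p : ℝ × ℝ => Real.sqrt (p.1 ^ 2 + p.2 ^ 2 + 1) := by fun_prop
  exact (hs.inv₀ fun p => by positivity).smul h

theorem toPoincareSphere_apply_zero (p : ℝ × ℝ) :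
    toPoincareSphere p 0 = (Real.sqrt (p.1 ^ 2 + p.2 ^ 2 + 1))⁻¹ * p.1 := by
  simp [toPoincareSphere]

theorem toPoincareSphere_apply_one (p : ℝ × ℝ) :
    toPoincareSphere p 1 = (Real.sqrt (p.1 ^ 2 + p.2 ^ 2 + 1))⁻¹ * p.2 := by
  simp [toPoincareSphere]

theorem toPoincareSphere_apply_two (p : ℝ × ℝ) :
    toPoincareSphere p 2 = (Real.sqrt (p.1 ^ 2 + p.2 ^ 2 + 1))⁻¹ := by
  simp [toPoincareSphere]

theorem toPoincareSphere_apply_two_pos (p : ℝ × ℝ) : 0 < toPoincareSphere p 2 := by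
  rw [toPoincareSphere_apply_two]
  positivity

theorem toPoincareSphere_injective : Function.Injective toPoincareSphere := by
  intro p q hpq
  have h2 : toPoincareSphere p 2 = toPoincareSphere q 2 := by rw [hpq]
  have h0 : toPoincareSphere p 0 = toPoincareSphere q 0 := by rw [hpq]
  have h1 : toPoincareSphere p 1 = toPoincareSphere q 1 := by rw [hpq]
  have hne := (toPoincareSphere_apply_two_pos q).ne'
  rw [toPoincareSphere_apply_two, toPoincareSphere_apply_two] at h2
  rw [toPoincareSphere_apply_two] at hne
  rw [toPoincareSphere_apply_zero, toPoincareSphere_apply_zero, h2] at h0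
  rw [toPoincareSphere_apply_one, toPoincareSphere_apply_one, h2] at h1
  exact Prod.ext (mul_left_cancel₀ hne h0) (mul_left_cancel₀ hne h1)

theorem toPoincareSphere_ne_northPoint (p : ℝ × ℝ) : toPoincareSphere p ≠ northPoint := by
  intro h
  have h1 := toPoincareSphere_apply_two_pos p
  rw [h] at h1
  simp [northPoint] at h1

theorem tendsto_snd_of_tendsto_northPoint {ι : Type*} {l : Filter ι} {γ : ι → ℝ × ℝ}
    (h : Tendsto (fun t => toPoincareSphere (γ t)) l (𝓝 northPoint)) :
    Tendsto (fun t => (γ t).2) l atTop := by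
  have hc : ∀ i, Tendsto (fun t => toPoincareSphere (γ t) i) l (𝓝 (northPoint i)) := fun i =>
    ((EuclideanSpace.proj (𝕜 := ℝ) i).continuous.tendsto _).comp h
  have h1 : Tendsto (fun t => toPoincareSphere (γ t) 1) l (𝓝 1) := by
    simpa [northPoint] using hc 1
  have h2 : Tendsto (fun t => toPoincareSphere (γ t) 2) l (𝓝[>] 0) :=
    tendsto_nhdsWithin_iff.2 ⟨by simpa [northPoint] using hc 2,
      Eventually.of_forall fun t => toPoincareSphere_apply_two_pos _⟩
  refine (h1.pos_mul_atTop one_pos h2.inv_tendsto_nhdsGT_zero).congr fun t => ?_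
  have h3 := toPoincareSphere_apply_two_pos (γ t)
  rw [toPoincareSphere_apply_two] at h3
  rw [Pi.inv_apply, toPoincareSphere_apply_one, toPoincareSphere_apply_two]
  field_simp

/-- The points `(x, y)` with `x / y` and `1 / y` close to `0` form a neighbourhood of
`(0, 1, 0)`. -/
theorem exists_toPoincareSphere_mem {A : Set (EuclideanSpace ℝ (Fin 3))} (hA : A ∈ 𝓝 northPoint) :
    ∃ κ > 0, ∀ p : ℝ × ℝ, κ * (|p.1| + 1) ≤ p.2 → toPoincareSphere p ∈ A := by
  set Ψ : ℝ × ℝ → EuclideanSpace ℝ (Fin 3) := fun q =>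
    (Real.sqrt (q.1 ^ 2 + 1 + q.2 ^ 2))⁻¹ • !₂[q.1, 1, q.2] with hΨ
  have hcont : Continuous Ψ := by
    have h : Continuous fun p : ℝ × ℝ => (!₂[p.1, 1, p.2] : EuclideanSpace ℝ (Fin 3)) := by
      refine (PiLp.continuous_toLp 2 _).comp (continuous_pi fun i => ?_)
      fin_cases i <;> simp <;> fun_prop
    have hs : Continuous fun p : ℝ × ℝ => Real.sqrt (p.1 ^ 2 + 1 + p.2 ^ 2) := by fun_prop
    exact (hs.inv₀ fun p => by positivity).smul h
  have h0 : Ψ 0 = northPoint := by simp [hΨ, northPoint]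
  have hA' : Ψ ⁻¹' A ∈ 𝓝 (0 : ℝ × ℝ) := hcont.continuousAt.preimage_mem_nhds (by rwa [h0])
  obtain ⟨η, hη, hball⟩ := Metric.mem_nhds_iff.1 hA'
  refine ⟨2 / η, by positivity, fun p hp => ?_⟩
  have hp1 : 0 < |p.1| + 1 := by positivity
  have hy : 0 < p.2 := lt_of_lt_of_le (by positivity) hp
  have hle : |p.1| + 1 ≤ η / 2 * p.2 := by
    have := mul_le_mul_of_nonneg_left hp (half_pos hη).le
    have h1 : η / 2 * (2 / η * (|p.1| + 1)) = |p.1| + 1 := by field_simp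
    linarith
  have hmem : (p.1 / p.2, 1 / p.2) ∈ Metric.ball (0 : ℝ × ℝ) η := by
    rw [mem_ball_zero_iff, Prod.norm_def, max_lt_iff]
    simp only [Real.norm_eq_abs, abs_div, abs_of_pos hy, abs_one, div_lt_iff₀ hy]
    have : 0 < η / 2 * p.2 := by positivity
    constructor <;> linarith [abs_nonneg p.1]
  have := hball hmem
  have he : Ψ (p.1 / p.2, 1 / p.2) = toPoincareSphere p := by
    have hs : Real.sqrt ((p.1 / p.2) ^ 2 + 1 + (1 / p.2) ^ 2)
        = Real.sqrt (p.1 ^ 2 + p.2 ^ 2 + 1) / p.2 := by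
      rw [← Real.sqrt_sq hy.le, ← Real.sqrt_div' _ (sq_nonneg _), Real.sqrt_sq hy.le]
      congr 1
      field_simp
    ext i
    simp only [hΨ, hs, toPoincareSphere]
    fin_cases i <;> simp <;> field_simp
  rwa [mem_preimage, he] at this

/-! ### The loop on the sphere -/

theorem eventually_comap_nhdsLT {α ω : EReal} (h : α < ω) {P : ℝ → Prop}
    (hP : ∀ᶠ t in comap ((↑) : ℝ → EReal) (𝓝[<] ω), P t) :
    ∃ t₀ : ℝ, (α < t₀ ∧ t₀ < ω) ∧ ∀ t : ℝ, t < ω → t₀ ≤ t → P t := by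
  rw [eventually_comap] at hP
  obtain ⟨l, hl, hlP⟩ := (mem_nhdsLT_iff_exists_Ioo_subset' h).1 hP
  obtain ⟨t₀, h1, h2⟩ := EReal.lt_iff_exists_real_btwn.1 (max_lt h hl)
  exact ⟨t₀, ⟨(le_max_left _ _).trans_lt h1, h2⟩, fun t ht htt =>
    hlP ⟨((le_max_right _ _).trans_lt h1).trans_le (EReal.coe_le_coe_iff.2 htt), ht⟩ t rfl⟩

theorem eventually_comap_nhdsGT {α ω : EReal} (h : α < ω) {P : ℝ → Prop}
    (hP : ∀ᶠ t in comap ((↑) : ℝ → EReal) (𝓝[>] α), P t) :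
    ∃ t₀ : ℝ, (α < t₀ ∧ t₀ < ω) ∧ ∀ t : ℝ, α < t → t ≤ t₀ → P t := by
  rw [eventually_comap] at hP
  obtain ⟨l, hl, hlP⟩ := (mem_nhdsGT_iff_exists_Ioo_subset' h).1 hP
  obtain ⟨t₀, h1, h2⟩ := EReal.lt_iff_exists_real_btwn.1 (lt_min h hl)
  exact ⟨t₀, ⟨h1, h2.trans_le (min_le_left _ _)⟩, fun t ht htt =>
    hlP ⟨ht, (EReal.coe_le_coe_iff.2 htt).trans_lt (h2.trans_le (min_le_right _ _))⟩ t rfl⟩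

/-- A homoclinic loop at infinity is the invariant curve of a separatrix. -/
theorem IsHomoclinicLoop.exists_isSeparatrix {a b c d : ℝ} {Γ : Set (ℝ × ℝ)} (ha : 0 < a)
    (h : IsHomoclinicLoop (lienard a b c d) Γ) :
    ∃ W, IsSeparatrix a b c d W ∧ Γ = {p | p.2 = lienardCurve a b c d p.1 - W p.1} := by
  obtain ⟨α, ω, γ, hαω, hγ, hα, hω, rfl⟩ := h
  have hder : ∀ t ∈ {t : ℝ | α < t ∧ t < ω}, HasDerivAt γ (lienard a b c d (γ t)) t :=
    fun t ht => hγ t ht.1 ht.2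
  have horb : IsLoopOrbit a b c d {t : ℝ | α < t ∧ t < ω} (fun t => (γ t).1)
      (fun t => (γ t).2) := by
    refine ⟨⟨fun s hs t ht r hr => ⟨hs.1.trans_le (EReal.coe_le_coe_iff.2 hr.1),
      (EReal.coe_le_coe_iff.2 hr.2).trans_lt ht.2⟩⟩,
      isOpen_Ioo.preimage continuous_coe_real_ereal, fun t ht => ?_, fun t ht => ?_,
      fun N => ?_, fun N => ?_⟩
    · exact hasDerivWithinAt_univ.1 (hder t ht).hasDerivWithinAt.fst_comp
    · exact hasDerivWithinAt_univ.1 (hder t ht).hasDerivWithinAt.snd_comp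
    · obtain ⟨t₀, h1, h2⟩ := eventually_comap_nhdsLT hαω
        ((tendsto_snd_of_tendsto_northPoint hω).eventually (eventually_gt_atTop N))
      exact ⟨t₀, h1, fun t ht => h2 t ht.2⟩
    · obtain ⟨t₀, h1, h2⟩ := eventually_comap_nhdsGT hαω
        ((tendsto_snd_of_tendsto_northPoint hα).eventually (eventually_gt_atTop N))
      exact ⟨t₀, h1, fun t ht => h2 t ht.1⟩
  exact horb.exists_isSeparatrix ha

namespace IsSeparatrix

variable {a b c d : ℝ} {W : ℝ → ℝ}

/-- The separatrix is steeper than any line far out. -/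
theorem exists_superlinear (ha : 0 < a) (h : IsSeparatrix a b c d W) (κ : ℝ) :
    ∃ R, ∀ x, R < |x| → κ * (|x| + 1) ≤ lienardCurve a b c d x - W x := by
  obtain ⟨B, hB⟩ := h.bdd
  obtain ⟨R₁, h₁⟩ := eventually_atTop.1 ((tendsto_lienardCurve_atTop ha b c (d - κ)).eventually
    (eventually_ge_atTop (κ + B)))
  obtain ⟨R₂, h₂⟩ := eventually_atBot.1 ((tendsto_lienardCurve_atBot ha b c (d + κ)).eventually
    (eventually_ge_atTop (κ + B)))
  refine ⟨max R₁ (-R₂), fun x hx => ?_⟩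
  have h3 := hB x
  rcases le_total 0 x with hx0 | hx0
  · rw [abs_of_nonneg hx0] at hx ⊢
    have := h₁ x ((le_max_left _ _).trans hx.le)
    unfold lienardCurve at this ⊢
    linarith
  · rw [abs_of_nonpos hx0] at hx ⊢
    have := h₂ x (by linarith [(le_max_right R₁ (-R₂)).trans hx.le])
    unfold lienardCurve at this ⊢
    linarith

/-- The points far out on and above the separatrix are close to `(0, 1, 0)`. -/
theorem exists_mem_of_far (ha : 0 < a) (h : IsSeparatrix a b c d W)
    {A : Set (EuclideanSpace ℝ (Fin 3))} (hA : A ∈ 𝓝 northPoint) :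
    ∃ R H : ℝ, ∀ p : ℝ × ℝ, lienardCurve a b c d p.1 - W p.1 ≤ p.2 → R < |p.1| ∨ H < p.2 →
      toPoincareSphere p ∈ A := by
  obtain ⟨κ, hκ, hmem⟩ := exists_toPoincareSphere_mem hA
  obtain ⟨R, hR⟩ := h.exists_superlinear ha κ
  refine ⟨R, κ * (R + 1), fun p hp hfar => hmem p ?_⟩
  rcases lt_or_ge R |p.1| with h1 | h1
  · exact (hR _ h1).trans hp
  · refine le_trans ?_ (hfar.resolve_left (not_lt.2 h1)).le
    exact mul_le_mul_of_nonneg_left (by linarith) hκ.le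

/-- The invariant curve `y = F x - W x`, as a set of points of the plane. -/
def graph (a b c d : ℝ) (W : ℝ → ℝ) : Set (ℝ × ℝ) := {p | p.2 = lienardCurve a b c d p.1 - W p.1}

theorem continuous_height (h : IsSeparatrix a b c d W) :
    Continuous fun x => lienardCurve a b c d x - W x :=
  (continuous_lienardCurve a b c d).sub h.continuous

theorem isClosed_closedLoop (ha : 0 < a) (h : IsSeparatrix a b c d W) :
    IsClosed (closedLoop (graph a b c d W)) := by
  rw [← isOpen_compl_iff, isOpen_iff_mem_nhds]
  intro w hw
  have hwn : w ≠ northPoint := fun he => hw (he ▸ mem_insert _ _)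
  obtain ⟨B, hB, A, hA, hAB⟩ := Filter.disjoint_iff.1 (disjoint_nhds_nhds.2 hwn)
  obtain ⟨R, H, hfar⟩ := h.exists_mem_of_far ha hA
  have hK : IsCompact ((fun x => toPoincareSphere (x, lienardCurve a b c d x - W x)) '' Icc (-R) R) :=
    isCompact_Icc.image (continuous_toPoincareSphere.comp
      (continuous_id.prodMk h.continuous_height))
  have hwK : w ∉ (fun x => toPoincareSphere (x, lienardCurve a b c d x - W x)) '' Icc (-R) R := by
    rintro ⟨x, -, rfl⟩
    exact hw (mem_insert_of_mem _ ⟨_, rfl, rfl⟩)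
  filter_upwards [hB, hK.isClosed.isOpen_compl.mem_nhds hwK] with z hzB hzK hz
  rcases hz with rfl | ⟨p, hp, rfl⟩
  · exact disjoint_left.1 hAB hzB (mem_of_mem_nhds hA)
  · rcases lt_or_ge R |p.1| with h1 | h1
    · exact disjoint_left.1 hAB hzB (hfar p (le_of_eq (Eq.symm hp)) (Or.inl h1))
    · have hp' : p.2 = lienardCurve a b c d p.1 - W p.1 := hp
      exact hzK ⟨p.1, abs_le.1 h1, by simp only [← hp']⟩

/-- Each neighbourhood of the loop contains the inner points that satisfy `NearLoop` for suitable
constants. -/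
theorem exists_mem_of_nearLoop (ha : 0 < a) (h : IsSeparatrix a b c d W)
    {U : Set (EuclideanSpace ℝ (Fin 3))} (hU : U ∈ 𝓝ˢ (closedLoop (graph a b c d W))) :
    ∃ R ε H : ℝ, 0 < ε ∧ ∀ p : ℝ × ℝ, lienardCurve a b c d p.1 - W p.1 < p.2 →
      NearLoop a b c d W R ε H p.1 (p.2 - (lienardCurve a b c d p.1 - W p.1)) →
      toPoincareSphere p ∈ U := by
  have hU' := mem_nhdsSet_iff_forall.1 hU
  obtain ⟨R, H, hfar⟩ := h.exists_mem_of_far ha (hU' _ (mem_insert _ _))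
  have hK : IsCompact ((fun x => (x, lienardCurve a b c d x - W x)) '' Icc (-R) R) :=
    isCompact_Icc.image (continuous_id.prodMk h.continuous_height)
  obtain ⟨ε, hε, hthick⟩ := hK.exists_thickening_subset_open
    (isOpen_interior.preimage continuous_toPoincareSphere (t := interior U)) (by
      rintro _ ⟨x, -, rfl⟩
      exact mem_preimage.2 (mem_interior_iff_mem_nhds.2
        (hU' _ (mem_insert_of_mem _ ⟨_, rfl, rfl⟩))))
  refine ⟨R, ε, H, hε, fun p hp hn => ?_⟩
  rcases lt_or_ge R |p.1| with h1 | h1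
  · exact hfar p hp.le (Or.inl h1)
  rcases hn with h2 | h2 | h2
  · exact absurd h2 (not_lt.2 h1)
  · exact hfar p hp.le (Or.inr (by linarith))
  · refine interior_subset (hthick (Metric.mem_thickening_iff.2
      ⟨_, mem_image_of_mem _ (abs_le.1 h1), ?_⟩))
    rw [Prod.dist_eq, max_lt_iff, dist_self, Real.dist_eq, abs_of_pos (by linarith)]
    exact ⟨hε, h2⟩

/-- The points that satisfy `NearLoop` fill a neighbourhood of the loop. -/
theorem exists_nhdsSet_nearLoop (h : IsSeparatrix a b c d W) (R H : ℝ) {ε : ℝ} (hε : 0 < ε) :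
    ∃ V ∈ 𝓝ˢ (closedLoop (graph a b c d W)), ∀ p : ℝ × ℝ, toPoincareSphere p ∈ V →
      NearLoop a b c d W R ε H p.1 (p.2 - (lienardCurve a b c d p.1 - W p.1)) := by
  set Y := fun x => lienardCurve a b c d x - W x with hY
  have hYc : Continuous Y := h.continuous_height
  obtain ⟨D, hD⟩ := (isCompact_Icc (a := -R) (b := R)).exists_bound_of_continuousOn
    hYc.continuousOn
  set C : Set (ℝ × ℝ) := {p | |p.1| ≤ R ∧ Y p.1 + ε ≤ p.2 ∧ p.2 ≤ H} with hC
  have hCc : IsCompact C := by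
    refine (isCompact_Icc.prod isCompact_Icc :
      IsCompact (Icc (-R) R ×ˢ Icc (-D) H)).of_isClosed_subset ?_ ?_
    · refine (isClosed_le continuous_fst.abs continuous_const).inter
        ((isClosed_le ?_ continuous_snd).inter (isClosed_le continuous_snd continuous_const))
      exact (hYc.comp continuous_fst).add continuous_const
    · rintro p ⟨h1, h2, h3⟩
      have := (abs_le.1 (hD p.1 (abs_le.1 h1))).1
      exact ⟨abs_le.1 h1, by linarith, h3⟩
  refine ⟨(toPoincareSphere '' C)ᶜ, ((hCc.image
    continuous_toPoincareSphere).isClosed.isOpen_compl.mem_nhdsSet).2 ?_, fun p hp => ?_⟩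
  · rintro _ (rfl | ⟨p, hp, rfl⟩) ⟨q, hq, he⟩
    · exact toPoincareSphere_ne_northPoint q he
    · rw [toPoincareSphere_injective he] at hq
      have hp' : p.2 = Y p.1 := hp
      linarith [hq.2.1]
  · by_contra hcon
    simp only [NearLoop, not_or, not_lt] at hcon
    exact hp ⟨p, ⟨hcon.1, by linarith [hcon.2.2], by linarith [hcon.2.1]⟩, rfl⟩

theorem loopInterior_subset (h : IsSeparatrix a b c d W) :
    loopInterior (graph a b c d W) ⊆ {p | lienardCurve a b c d p.1 - W p.1 < p.2} := by
  have hc : Continuous fun p : ℝ × ℝ => lienardCurve a b c d p.1 - W p.1 :=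
    h.continuous_height.comp continuous_fst
  have h0 : lienardCurve a b c d 0 - W 0 < 0 := by
    have := h.pos 0
    simp only [lienardCurve]
    linarith
  refine isPreconnected_connectedComponentIn.subset_left_of_subset_union
    (v := {p | p.2 < lienardCurve a b c d p.1 - W p.1}) (isOpen_lt hc continuous_snd)
    (isOpen_lt continuous_snd hc) ?_ ?_ ⟨0, mem_connectedComponentIn ?_, h0⟩
  · exact disjoint_left.2 fun p (h1 : lienardCurve a b c d p.1 - W p.1 < p.2)
      (h2 : p.2 < lienardCurve a b c d p.1 - W p.1) => lt_asymm h1 h2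
  · intro p hp
    rcases lt_trichotomy (lienardCurve a b c d p.1 - W p.1) p.2 with h1 | h1 | h1
    · exact Or.inl h1
    · exact absurd h1.symm (connectedComponentIn_subset _ _ hp)
    · exact Or.inr h1
  · intro he
    exact h0.ne' he

/-- The loop attracts the orbits in its interior. -/
theorem isAttractingLoop (ha : 0 < a) (hb : 0 < b) (h : IsSeparatrix a b c d W) :
    IsAttractingLoop (lienard a b c d) (graph a b c d W) := by
  intro U hU
  obtain ⟨R, ε, H, hε, hUmem⟩ := h.exists_mem_of_nearLoop ha hU
  obtain ⟨R', ε', H', hε', hattr⟩ := IsInnerSol.attraction ha hb h R H hε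
  obtain ⟨V, hV, hVnear⟩ := h.exists_nhdsSet_nearLoop R' H' hε'
  refine ⟨V, hV, fun p hp hpV => ?_⟩
  obtain ⟨σ, hσ, s⟩ := h.exists_isInnerSol ha (h.loopInterior_subset hp)
  obtain ⟨hstay, hconv, hfreq⟩ := hattr _ _ s (by rw [hσ.1]; exact hVnear p hpV)
  have hpos : ∀ t ≥ 0, lienardCurve a b c d (σ t).1 - W (σ t).1 < (σ t).2 := fun t ht => by
    linarith [s.pos t ht]
  refine ⟨σ, hσ, fun t ht => hUmem _ (hpos t ht) (hstay t ht), ?_⟩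
  have hgraph : ∀ z, MapClusterPt (toPoincareSphere (z, lienardCurve a b c d z - W z)) atTop
      fun t => toPoincareSphere (σ t) := by
    intro z
    rw [mapClusterPt_iff_frequently]
    intro A hA
    have hA' := continuous_toPoincareSphere.continuousAt.preimage_mem_nhds hA
    obtain ⟨η, hη, hball⟩ := Metric.mem_nhds_iff.1 hA'
    refine ((hfreq z η hη).and_eventually (eventually_ge_atTop 0)).mono ?_
    rintro t ⟨⟨hx, hv⟩, ht⟩
    refine hball ?_
    have h1 := hpos t ht
    rw [hx] at h1 hv
    rw [Metric.mem_ball, Prod.dist_eq, max_lt_iff, hx, dist_self, Real.dist_eq,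
      abs_of_pos (by linarith)]
    exact ⟨hη, hv⟩
  refine Subset.antisymm (fun w hw => ?_) ?_
  · by_contra hcon
    obtain ⟨A, hA, B, hB, hAB⟩ := Filter.disjoint_iff.1
      (_root_.disjoint_nhdsSet_nhds.2 (by rwa [(h.isClosed_closedLoop ha).closure_eq]))
    obtain ⟨r, η, k, hη, hmem⟩ := h.exists_mem_of_nearLoop ha hA
    have hev : ∀ᶠ t in atTop, toPoincareSphere (σ t) ∈ A := by
      filter_upwards [hconv r k η hη, eventually_ge_atTop 0] with t ht ht0
      exact hmem _ (hpos t ht0) ht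
    obtain ⟨t, h1, h2⟩ := ((mapClusterPt_iff_frequently.1 hw B hB).and_eventually hev).exists
    exact disjoint_left.1 hAB h2 h1
  · rintro _ (rfl | ⟨⟨z, y⟩, hp, rfl⟩)
    · show MapClusterPt _ _ _
      rw [mapClusterPt_iff_frequently]
      intro A hA
      obtain ⟨r, k, hfar⟩ := h.exists_mem_of_far ha (interior_mem_nhds.2 hA)
      have h1 := hfar (|r| + 1, lienardCurve a b c d (|r| + 1) - W (|r| + 1)) le_rfl
        (Or.inl (by
          rw [abs_of_pos (by positivity)]
          linarith [le_abs_self r]))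
      exact mapClusterPt_iff_frequently.1 (hgraph _) A (mem_interior_iff_mem_nhds.1 h1)
    · obtain rfl : y = lienardCurve a b c d z - W z := hp
      exact hgraph z

/-- The invariant curve is a homoclinic loop: `x' = - W x` on it, with solutions on the whole line
as `W` is bounded. -/
theorem isHomoclinicLoop (ha : 0 < a) (h : IsSeparatrix a b c d W) :
    IsHomoclinicLoop (lienard a b c d) (graph a b c d W) := by
  obtain ⟨B, hB⟩ := h.bdd
  have hB0 : 0 < B := (h.pos 0).trans_le (hB 0)
  have hcinv : Continuous fun x => (W x)⁻¹ := h.continuous.inv₀ fun x => (h.pos x).ne'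
  set S : ℝ → ℝ := fun z => ∫ s in (0 : ℝ)..z, (W s)⁻¹ with hS
  have hSd : ∀ z, HasDerivAt S (W z)⁻¹ z := fun z =>
    intervalIntegral.integral_hasDerivAt_right (hcinv.intervalIntegrable _ _)
      (hcinv.stronglyMeasurableAtFilter _ _) hcinv.continuousAt
  have hSc : Continuous S := continuous_iff_continuousAt.2 fun z => (hSd z).continuousAt
  have hmono : StrictMono S := strictMono_of_deriv_pos fun z => by
    rw [(hSd z).deriv]
    exact inv_pos.2 (h.pos z)
  have hlin : ∀ p q, p ≤ q → (q - p) / B ≤ S q - S p := by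
    intro p q hpq
    have := le_of_hasDerivWithinAt_nonneg (p := p) (q := q) (h := fun z => S z - z / B)
      (fun r _ => ((hSd r).sub ((hasDerivAt_id r).div_const B)).hasDerivWithinAt)
      (fun r _ => by
        have := inv_anti₀ (h.pos r) (hB r)
        rw [one_div]
        linarith) q ⟨hpq, le_rfl⟩
    rw [sub_div]
    linarith
  have htop : Tendsto S atTop atTop := by
    refine tendsto_atTop_mono' _ ?_ (tendsto_id.atTop_div_const hB0)
    filter_upwards [eventually_ge_atTop 0] with z hz
    have := hlin 0 z hz
    simp only [hS, intervalIntegral.integral_same, sub_zero] at this ⊢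
    exact this
  have hbot : Tendsto S atBot atBot := by
    refine tendsto_atBot_mono' _ ?_ (tendsto_id.atBot_div_const hB0)
    filter_upwards [eventually_le_atBot 0] with z hz
    have := hlin z 0 hz
    simp only [hS, intervalIntegral.integral_same, zero_sub, neg_div, id] at this ⊢
    linarith
  let e : ℝ ≃o ℝ := hmono.orderIsoOfSurjective S (hSc.surjective htop hbot)
  have heS : ∀ t, S (e.symm t) = t := fun t => e.apply_symm_apply t
  have hxd : ∀ t, HasDerivAt (fun t => e.symm (-t)) (-W (e.symm (-t))) t := by
    intro t
    have h1 : HasDerivAt e.symm ((W (e.symm (-t)))⁻¹)⁻¹ (-t) :=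
      HasDerivAt.of_local_left_inverse e.symm.continuous.continuousAt (hSd _)
        (inv_ne_zero (h.pos _).ne') (Eventually.of_forall heS)
    refine (h1.scomp t (hasDerivAt_neg t)).congr_deriv ?_
    simp
  set x := fun t => e.symm (-t) with hx
  have hYfar : ∀ l : Filter ℝ, Tendsto (fun t => |x t|) l atTop →
      Tendsto (fun t => toPoincareSphere (x t, lienardCurve a b c d (x t) - W (x t))) l
        (𝓝 northPoint) := by
    intro l hl A hA
    obtain ⟨R, H, hfar⟩ := h.exists_mem_of_far ha hA
    exact mem_map.2 ((hl.eventually (eventually_gt_atTop R)).mono fun t ht =>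
      hfar (x t, _) le_rfl (Or.inl ht))
  refine ⟨⊥, ⊤, fun t => (x t, lienardCurve a b c d (x t) - W (x t)), bot_lt_top,
    fun t _ _ => ?_, ?_, ?_, ?_⟩
  · have h1 := ((hasDerivAt_lienardCurve a b c d (x t)).sub (h.hasDerivAt (x t))).comp t (hxd t)
    refine ((hxd t).prodMk h1).congr_deriv ?_
    have := (h.pos (x t)).ne'
    rw [lienard_eq, Prod.mk.injEq]
    constructor
    · simp only [hx]
      ring
    · simp only [hx] at this ⊢
      field_simp
      ring
  · have : comap ((↑) : ℝ → EReal) (𝓝[>] ⊥) = atBot := by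
      rw [Ioi_bot, EReal.nhdsWithin_bot, comap_map EReal.coe_injective]
    rw [this]
    exact hYfar _ (tendsto_abs_atTop_atTop.comp
      (e.symm.tendsto_atTop.comp tendsto_neg_atBot_atTop))
  · have : comap ((↑) : ℝ → EReal) (𝓝[<] ⊤) = atTop := by
      rw [Iio_top, EReal.nhdsWithin_top, comap_map EReal.coe_injective]
    rw [this]
    exact hYfar _ (tendsto_abs_atBot_atTop.comp
      (e.symm.tendsto_atBot.comp tendsto_neg_atTop_atBot))
  · ext ⟨z, y⟩
    constructor
    · intro hy
      refine ⟨-S z, ⟨EReal.bot_lt_coe _, EReal.coe_lt_top _⟩, ?_⟩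
      have h1 : x (-S z) = z := by
        simp only [hx, neg_neg]
        exact e.symm_apply_apply z
      obtain rfl : y = lienardCurve a b c d z - W z := hy
      simp only [h1]
    · rintro ⟨t, -, ht⟩
      rw [← ht]
      rfl

end IsSeparatrix

/-! ### Instability of the singular point -/

/-- For `d < 0` the singular point is unstable: the quadratic form `(x ^ 2 + y ^ 2) / 2 + ε x y`
grows exponentially along the orbits close to it. -/
theorem not_isStablePoint_lienard (a b c : ℝ) {d : ℝ} (hd : d < 0) :
    ¬ IsStablePoint (lienard a b c d) 0 := by
  intro hstable
  have hlim : Tendsto (fun x : ℝ => |x * (a * x ^ 2 + b * x + c)|) (𝓝 0) (𝓝 0) := by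
    have : Continuous fun x : ℝ => |x * (a * x ^ 2 + b * x + c)| := by fun_prop
    simpa using this.tendsto 0
  obtain ⟨ρ, hρ, hball⟩ := Metric.eventually_nhds_iff.1
    (hlim.eventually (gt_mem_nhds (show 0 < -d / 2 by linarith)))
  have hF : ∀ x, |x| < ρ → x * lienardCurve a b c d x ≤ d / 2 * x ^ 2 ∧
      |lienardCurve a b c d x| ≤ -2 * d * |x| := by
    intro x hx
    have h1 : |x * (a * x ^ 2 + b * x + c)| < -d / 2 := hball (by simpa using hx)
    obtain ⟨h2, h3⟩ := abs_lt.1 h1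
    have h4 : lienardCurve a b c d x = x * (d + x * (a * x ^ 2 + b * x + c)) := by
      unfold lienardCurve
      ring
    rw [h4]
    constructor
    · nlinarith [sq_nonneg x]
    · rw [abs_mul, mul_comm]
      exact mul_le_mul_of_nonneg_right (abs_le.2 ⟨by linarith, by linarith⟩) (abs_nonneg x)
  set ε := min (1 / 2) (-d / (4 * (1 + 2 * d ^ 2))) with hε
  have hε0 : 0 < ε := lt_min (by norm_num) (div_pos (by linarith) (by positivity))
  have hε1 : ε ≤ 1 / 2 := min_le_left _ _
  have hε2 : ε * (1 + 2 * d ^ 2) ≤ -d / 4 := by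
    have : ε ≤ -d / (4 * (1 + 2 * d ^ 2)) := min_le_right _ _
    rw [le_div_iff₀ (by positivity)] at this
    linarith
  obtain ⟨V, hV, hVs⟩ := hstable (Metric.ball 0 ρ) (Metric.ball_mem_nhds _ hρ)
  obtain ⟨η, hη, hηV⟩ := Metric.mem_nhds_iff.1 hV
  obtain ⟨σ, ⟨hσ0, hσ⟩, hin⟩ := hVs (η / 2, 0) (hηV (by
    rw [mem_ball_zero_iff, Prod.norm_def, max_lt_iff]
    simp only [Real.norm_eq_abs, abs_zero, abs_of_pos (half_pos hη)]
    exact ⟨by linarith, hη⟩))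
  have hin1 : ∀ t, 0 ≤ t → |(σ t).1| < ρ := fun t ht =>
    (norm_fst_le _).trans_lt (mem_ball_zero_iff.1 (hin t ht))
  have hin2 : ∀ t, 0 ≤ t → |(σ t).2| < ρ := fun t ht =>
    (norm_snd_le _).trans_lt (mem_ball_zero_iff.1 (hin t ht))
  set Q : ℝ → ℝ := fun t => ((σ t).1 * (σ t).1 + (σ t).2 * (σ t).2) / 2
    + ε * ((σ t).1 * (σ t).2) with hQ
  have hQ0 : Q 0 = η ^ 2 / 8 := by
    simp only [hQ, hσ0]
    ring
  have hgrow : ∀ T, 0 ≤ T → Q 0 ≤ Q T * Real.exp (-(ε / 2 * T)) := by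
    intro T hT
    have := le_of_hasDerivWithinAt_nonneg (p := 0) (q := T)
      (h := fun t => Q t * Real.exp (-(ε / 2 * t)))
      (h' := fun t => (-((σ t).1 * lienardCurve a b c d (σ t).1) + ε * ((σ t).2 ^ 2
        - (σ t).2 * lienardCurve a b c d (σ t).1 - (σ t).1 ^ 2) - ε / 2 * Q t)
        * Real.exp (-(ε / 2 * t)))
      (fun t ht => by
        have h0 := (hσ t ht.1).mono (show Icc 0 T ⊆ Ici 0 from fun r hr => hr.1)
        have hx := h0.fst_comp
        have hy := h0.snd_comp
        refine (((((hx.mul hx).add (hy.mul hy)).div_const 2).add ((hx.mul hy).const_mul ε)).mul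
          ((((hasDerivAt_id t).const_mul (ε / 2)).neg.exp).hasDerivWithinAt)).congr_deriv ?_
        simp only [id, lienard_eq, Pi.add_apply, Pi.mul_apply, Pi.neg_apply, hQ]
        ring)
      (fun t ht => by
        refine mul_nonneg ?_ (Real.exp_pos _).le
        obtain ⟨h1, h2⟩ := hF _ (hin1 t ht.1)
        set x := (σ t).1
        set y := (σ t).2
        have h3 : y * lienardCurve a b c d x ≤ y ^ 2 / 2 + 2 * d ^ 2 * x ^ 2 := by
          have h4 : y * lienardCurve a b c d x ≤ |y| * (-2 * d * |x|) := by
            refine (le_abs_self _).trans ?_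
            rw [abs_mul]
            exact mul_le_mul_of_nonneg_left h2 (abs_nonneg _)
          have h5 := sq_nonneg (|y| + 2 * d * |x|)
          have h6 := sq_abs x
          have h7 := sq_abs y
          nlinarith
        have h8 : ε * (y * lienardCurve a b c d x) ≤ ε * (y ^ 2 / 2 + 2 * d ^ 2 * x ^ 2) :=
          mul_le_mul_of_nonneg_left h3 hε0.le
        have h9 := mul_le_mul_of_nonneg_right hε2 (sq_nonneg x)
        have h10 : ε / 2 * ((x * x + y * y) / 2 + ε * (x * y)) ≤ ε / 2 * (x ^ 2 + y ^ 2) := by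
          refine mul_le_mul_of_nonneg_left ?_ (by positivity)
          nlinarith [sq_nonneg (x - y), sq_nonneg (x + y)]
        have h11 : ε * x ^ 2 ≤ -d / 4 * x ^ 2 :=
          mul_le_mul_of_nonneg_right (by nlinarith [sq_nonneg d]) (sq_nonneg x)
        change 0 ≤ -(x * lienardCurve a b c d x) + ε * (y ^ 2 - y * lienardCurve a b c d x - x ^ 2)
          - ε / 2 * ((x * x + y * y) / 2 + ε * (x * y))
        have h12 : 0 ≤ ε * x ^ 2 := by positivity
        linarith) T ⟨hT, le_rfl⟩
    simpa using this
  have hbd : ∀ t, 0 ≤ t → Q t ≤ 2 * ρ ^ 2 := by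
    intro t ht
    have h1 := sq_lt_sq' (abs_lt.1 (hin1 t ht)).1 (abs_lt.1 (hin1 t ht)).2
    have h2 := sq_lt_sq' (abs_lt.1 (hin2 t ht)).1 (abs_lt.1 (hin2 t ht)).2
    simp only [hQ]
    nlinarith [sq_nonneg ((σ t).1 - (σ t).2), sq_nonneg ((σ t).1 + (σ t).2)]
  set T := 32 * ρ ^ 2 / (ε * η ^ 2) with hT
  have hT0 : 0 ≤ T := by positivity
  have h1 := hgrow T hT0
  rw [hQ0, Real.exp_neg, ← div_eq_mul_inv, le_div_iff₀ (Real.exp_pos _)] at h1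
  have h2 := Real.add_one_le_exp (ε / 2 * T)
  have h3 : η ^ 2 / 8 * (ε / 2 * T) = 2 * ρ ^ 2 := by
    rw [hT]
    field_simp
    ring
  have h4 := hbd T hT0
  have h5 : 0 < η ^ 2 / 8 := by positivity
  nlinarith

theorem theorem1 (a b c : ℝ) (ha : 0 < a) (hb : 0 < b) :
    ∃ d : ℝ, d < 0 ∧
      (∀ d' : ℝ, (∃ Γ : Set (ℝ × ℝ), IsHomoclinicLoop (lienard a b c d') Γ) ↔ d' = d) ∧
      ∀ Γ : Set (ℝ × ℝ), IsHomoclinicLoop (lienard a b c d) Γ →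
        (IsAttractingLoop (lienard a b c d) Γ ↔ ¬ IsStablePoint (lienard a b c d) 0) := by
  obtain ⟨d, W, h⟩ := exists_isSeparatrix a b c ha hb
  have hd := h.param_neg hb
  refine ⟨d, hd, fun d' => ⟨?_, ?_⟩, fun Γ hΓ => ?_⟩
  · rintro ⟨Γ, hΓ⟩
    obtain ⟨W', h', -⟩ := hΓ.exists_isSeparatrix ha
    exact h'.param_unique h
  · rintro rfl
    exact ⟨_, h.isHomoclinicLoop ha⟩
  -- both sides of the equivalence hold, because `d < 0`
  · obtain ⟨W', h', rfl⟩ := hΓ.exists_isSeparatrix ha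
    exact iff_of_true (h'.isAttractingLoop ha hb) (not_isStablePoint_lienard a b c hd)
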